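/- Work over $\mathbb C$. Let $\underline p=(p_1\ge\dots\ge p_r>0)$ be a partition of $N$, let $V$ have basis $e_{(a,i)}$ ($1\le a\le r$, $1\le i\le p_a$), with matrix units $E_{\alpha\beta}$, and let $\mathfrak g=\mathfrak{gl}(V)=\mathfrak{gl}_N$ with the trace form $(x|y)=\mathrm{tr}(xy)$. Let $f e_{(a,i)}=e_{(a,i+1)}$ for $i<p_a$, $f e_{(a,p_a)}=0$, let $\chi e_{(a,i)}=\big(\tfrac{p_a+1}2-i\big)e_{(a,i)}$, and let $\mathfrak g=\bigoplus_{k\in\frac12\mathbb Z}\mathfrak g_k$ be the eigenspace decomposition of $\mathrm{ad}\,\chi$. For a subspace $\mathfrak a\subset\mathfrak g$ let $\mathcal V(\mathfrak a)=S(\mathbb C[\partial]\mathfrak a)$ be the algebra of differential polynomials over $\mathfrak a$. Let $\{\cdot_\lambda\cdot\}$ be the Poisson vertex algebra $\lambda$-bracket on $\mathcal V(\mathfrak g)$ with $\{a_\lambda b\}=[a,b]+(a|b)\lambda$ for $a,b\in\mathfrak g$, and let $\rho:\mathcal V(\mathfrak g)\to\mathcal V(\mathfrak g_{\le\frac12})$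 be the differential algebra homomorphism with $\rho(a)=\pi_{\le\frac12}(a)+(f|a)$ for $a\in\mathfrak g$, where $\pi_{\le\frac12}$ is the projection with kernel $\mathfrak g_{\ge1}$. The classical $\mathcal W$-algebra is $$\mathcal W=\mathcal W(\mathfrak{gl}_N,\underline p)=\{w\in\mathcal V(\mathfrak g_{\le\frac12})\mid\rho\{a_\lambda w\}=0\ \text{for all}\ a\in\mathfrak g_{\ge\frac12}\}.$$ Let $\mathfrak g^f$ be the centralizer of $f$ and, for $1\le a,b\le r$ and $0\le i<\min\{p_a,p_b\}$, let $f_{ab;i}=\sum_{j=0}^iE_{(a,p_a+j-i),(b,j+1)}\in\mathfrak g^f$. Let $U$ be the span of the $E_{(b,1),(a,p_a-i)}$ for the same $a,b,i$, let $U^\perp$ be its orthogonal complement in $\mathfrak g_{\le\frac12}$, and let $\langle U^\perp\rangle$ be the differential ideal of $\mathcal V(\mathfrak g_{\le\frac12})$ generated by $U^\perp$. Then for every $q\in\mathcal V(\mathfrak g^f)$ there is a unique $w(q)\in\mathcal W$ with $w(q)-q\in\langle U^\perp\rangle$, and every element of $\mathcal W$ equals $w(q)$ for a unique $q\in\mathcal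 V(\mathfrak g^f)$. Let $w_{ab;i}=w(f_{ab;i})$, and let $W(\partial)$ be the $r\times r$ matrix with $(a,b)$ entry $\sum_{i=0}^{\min\{p_a,p_b\}-1}w_{ba;i}(-\partial)^i$. Let $A(\partial)$ be the matrix differential operator, with rows and columns indexed by the basis of $V$, whose $(\alpha,\beta)$ entry is $\delta_{\alpha\beta}\partial+E_{\beta\alpha}$ with $E_{\beta\alpha}\in\mathfrak g\subset\mathcal V(\mathfrak g)$, and let $\rho A(\partial)$ be obtained by applying $\rho$ to its coefficients. Let $V_+$ and $V_-$ be the spans of the $e_{(a,1)}$ and of the $e_{(a,p_a)}$, respectively; with these bases, operators $V_-\to V_+$, $V_+\to V_-$, $V_\pm\to V_\pm$ are written as $r\times r$ matrices. Let $s$ be the number of distinct parts of $\underline p$, and for $1\le k\le s$ let $V_{\pm,k}$ be the span of the above basis vectors of $V_\pm$ with $p_a$ equal to the $k$-th largest distinct part; let $V_{\pm,\ge k}=\bigoplus_{l\ge k}V_{\pm,l}$. Write $\mathbb 1_Y$ for the inclusion of, or the coordinate projection onto, a coordinate subspace $Y$, and $(\cdot)_+$ for the part of a pseudodifferential operator with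 non-negative powers of $\partial$. Then the quasideterminant $$T(\partial)=|\rho A(\partial)|_{V_+,V_-}=\big(\mathbb 1_{V_-}(\rho A(\partial))^{-1}\mathbb 1_{V_+}\big)^{-1}$$ exists over $\mathcal V(\mathfrak g_{\le\frac12})((\partial^{-1}))$. Put $T^{(s)}=T$, $W^{(k)}=\mathbb 1_{V_{+,\ge k}}T^{(k)}\mathbb 1_{V_{-,\ge k}}$ for $1\le k\le s$ and, for $k=s-1,\dots,1$, $$T^{(k)}=\Big(\mathbb 1_{V_+}-\mathbb 1_{V_{+,k}}\big(T^{(k+1)}(W^{(k+1)})^{-1}\big)_+\Big)\,T^{(k+1)}\,\Big(\mathbb 1_{V_-}-\big((W^{(k+1)})^{-1}T^{(k+1)}\big)_+\mathbb 1_{V_{-,k}}\Big).$$ This recursion is well defined: for $1\le k\le s$ the entries of $T^{(k)}$ are differential operators over $\mathcal V(\mathfrak g_{\le\frac12})$, and $W^{(k)}$ is invertible over $\mathcal V(\mathfrak g_{\le\frac12})((\partial^{-1}))$. Its last term is $$W^{(1)}(\partial)=-(-\partial)^{\underline p}+W(\partial),\qquad(-\partial)^{\underline p}=\mathrm{diag}\big((-\partial)^{p_1},\dots,(-\partial)^{p_r}\big).$$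 -/

import Mathlib

namespace WGL

noncomputable section

open scoped Differential

/-- The additive group of formal sums `∑ₙ aₙ ∂ⁿ` over `n : ℤ` with `aₙ = 0` for `n` large. -/
def psiAddSubgroup (R : Type*) [AddCommGroup R] : AddSubgroup (ℤ → R) where
  carrier := {a | ∃ M : ℤ, ∀ n, M < n → a n = 0}
  zero_mem' := ⟨0, fun _ _ => rfl⟩
  add_mem' := by
    rintro a b ⟨M, hM⟩ ⟨N, hN⟩
    refine ⟨max M N, fun n hn => ?_⟩
    simp [hM n (lt_of_le_of_lt (le_max_left _ _) hn), hN n (lt_of_le_of_lt (le_max_right _ _) hn)]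
  neg_mem' := by
    rintro a ⟨M, hM⟩
    exact ⟨M, fun n hn => by simp [hM n hn]⟩

/-- Pseudodifferential operators `R((∂⁻¹))` over a commutative differential ring `R`. -/
def PsiDO (R : Type*) [CommRing R] : Type _ := psiAddSubgroup R

namespace PsiDO

variable {R : Type*} [CommRing R]

instance : AddCommGroup (PsiDO R) := inferInstanceAs (AddCommGroup (psiAddSubgroup R))

/-- The coefficient of `∂ⁿ`, with coefficients written on the left. -/
def coeff (a : PsiDO R) (n : ℤ) : R := a.1 n

@[ext] theorem ext {a b : PsiDO R} (h : ∀ n, a.coeff n = b.coeff n) : a = b :=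
  Subtype.ext (funext h)

/-- `a` has order at most `A`. -/
def OrdLE (a : PsiDO R) (A : ℤ) : Prop := ∀ n, A < n → a.coeff n = 0

theorem exists_ordLE (a : PsiDO R) : ∃ A, a.OrdLE A := a.2

@[simp] theorem coeff_zero (n : ℤ) : (0 : PsiDO R).coeff n = 0 := rfl
@[simp] theorem coeff_add (a b : PsiDO R) (n : ℤ) : (a + b).coeff n = a.coeff n + b.coeff n := rfl
@[simp] theorem coeff_neg (a : PsiDO R) (n : ℤ) : (-a).coeff n = -a.coeff n := rfl
@[simp] theorem coeff_sub (a b : PsiDO R) (n : ℤ) : (a - b).coeff n = a.coeff n - b.coeff n := rfl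

/-- The monomial `x ∂ᵐ`. -/
def mono (m : ℤ) (x : R) : PsiDO R :=
  ⟨Pi.single m x, m, fun n hn => by simp [hn.ne']⟩

theorem coeff_mono (m : ℤ) (x : R) (n : ℤ) : (mono m x).coeff n = if n = m then x else 0 := by
  simp [mono, coeff, Pi.single_apply]

theorem ordLE_mono (m : ℤ) (x : R) : (mono m x).OrdLE m :=
  fun n hn => by simp [coeff_mono, hn.ne']

/-- The element `∂`. -/
def D : PsiDO R := mono 1 1

/-- The operator of multiplication by `x : R`. -/
def const (x : R) : PsiDO R := mono 0 x

/-- The positive part `a₊`, which keeps the coefficients of `∂ⁿ` with `n ≥ 0`. -/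
def posPart (a : PsiDO R) : PsiDO R :=
  ⟨fun n => if 0 ≤ n then a.coeff n else 0, by
    obtain ⟨A, hA⟩ := a.exists_ordLE
    exact ⟨A, fun n hn => by simp [hA n hn]⟩⟩

/-- `a` lies in the subring `R[∂]` of differential operators. -/
def IsDiffOp (a : PsiDO R) : Prop := ∀ n : ℤ, n < 0 → a.coeff n = 0

/-- Apply a ring homomorphism to all coefficients. -/
def map {S : Type*} [CommRing S] (f : R →+* S) (a : PsiDO R) : PsiDO S :=
  ⟨fun n => f (a.coeff n), by
    obtain ⟨A, hA⟩ := a.exists_ordLE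
    exact ⟨A, fun n hn => by simp [hA n hn]⟩⟩

instance : One (PsiDO R) := ⟨mono 0 1⟩

/-- An additive property that holds for monomials and in low order holds everywhere. -/
theorem induct {P : PsiDO R → Prop} (d : ℤ) (hadd : ∀ a b, P a → P b → P (a + b))
    (hmono : ∀ m x, P (mono m x)) (hlow : ∀ a, a.OrdLE d → P a) (a : PsiDO R) : P a := by
  obtain ⟨A, hA⟩ := a.exists_ordLE
  obtain ⟨k, hk⟩ : ∃ k : ℕ, A ≤ d + k := ⟨(A - d).toNat, by omega⟩
  replace hA : a.OrdLE (d + k) := fun n hn => hA n (by omega)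
  clear hk
  induction k generalizing a with
  | zero => exact hlow a (by simpa using hA)
  | succ k ih =>
    rw [← sub_add_cancel a (mono (d + k + 1) (a.coeff (d + k + 1)))]
    refine hadd _ _ (ih _ fun n hn => ?_) (hmono _ _)
    rw [coeff_sub, coeff_mono]
    split_ifs with h
    · rw [h, sub_self]
    · rw [sub_zero]
      exact hA n (by push_cast; omega)

variable [Differential R]

/-- The iterated derivative of an element of `R`. -/
def der (n : ℕ) (x : R) : R := (Differential.deriv : Derivation ℤ R R)^[n] x

theorem der_succ (n : ℕ) (x : R) : der (n + 1) x = (der n x)′ := Function.iterate_succ_apply' _ _ _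

@[simp] theorem der_zero_left (x : R) : der 0 x = x := rfl

theorem der_add_left (m n : ℕ) (x : R) : der (m + n) x = der m (der n x) :=
  Function.iterate_add_apply _ _ _ _

@[simp] theorem der_zero (n : ℕ) : der n (0 : R) = 0 := by
  induction n with
  | zero => rfl
  | succ n ih => rw [der_succ, ih, map_zero]

theorem der_add (n : ℕ) (x y : R) : der n (x + y) = der n x + der n y := by
  induction n with
  | zero => rfl
  | succ n ih => simp [der_succ, ih]

theorem der_one (n : ℕ) : der n (1 : R) = if n = 0 then 1 else 0 := by
  cases n with
  | zero => rfl
  | succ n =>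
    rw [der_add_left]
    simp [der_succ]

theorem der_zsmul (n : ℕ) (k : ℤ) (x : R) : der n (k • x) = k • der n x := by
  induction n with
  | zero => rfl
  | succ n ih => simp only [der_succ, ih, map_zsmul]

theorem der_mul (n : ℕ) (x y : R) :
    der n (x * y) = ∑ ij ∈ Finset.HasAntidiagonal.antidiagonal n, n.choose ij.1 • (der ij.1 x * der ij.2 y) := by
  induction n with
  | zero => simp
  | succ n ih =>
    rw [Finset.sum_antidiagonal_choose_succ_nsmul (fun i j => der i x * der j y), der_succ, ih,
      map_sum, ← Finset.sum_add_distrib]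
    refine Finset.sum_congr rfl fun ij hij => ?_
    have h : n.choose ij.2 = n.choose ij.1 := by
      rw [Finset.HasAntidiagonal.mem_antidiagonal] at hij
      rw [← hij, Nat.add_comm ij.1, Nat.choose_symm_add]
    simp only [map_nsmul, Derivation.leibniz, smul_eq_mul, der_succ, h]
    rw [← smul_add, mul_comm (der ij.2 y)]

/-- A summand of the coefficient of `∂ᵏ` in `a ∘ b`. -/
def mulTerm (a b : PsiDO R) (k : ℤ) (x : ℤ × ℕ) : R :=
  Ring.choose x.1 x.2 • (a.coeff x.1 * der x.2 (b.coeff (k - x.1 + x.2)))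

theorem support_mulTerm {a b : PsiDO R} {A B : ℤ} (ha : a.OrdLE A) (hb : b.OrdLE B) (k : ℤ) :
    Function.support (mulTerm a b k) ⊆
      ((Finset.Icc (k - B) A ×ˢ Finset.range (A + B - k + 1).toNat : Finset (ℤ × ℕ)) :
        Set (ℤ × ℕ)) := by
  rintro ⟨m, j⟩ h
  rw [Function.mem_support] at h
  have h1 : m ≤ A := by
    by_contra hm
    exact h (by simp [mulTerm, ha m (not_le.1 hm)])
  have h2 : k - m + j ≤ B := by
    by_contra hm
    exact h (by simp [mulTerm, hb _ (not_le.1 hm)])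
  simp only [Finset.coe_product, Set.mem_prod, Finset.coe_Icc, Set.mem_Icc, Finset.coe_range,
    Set.mem_Iio]
  omega

theorem finite_mulTerm (a b : PsiDO R) (k : ℤ) : (Function.support (mulTerm a b k)).Finite := by
  obtain ⟨A, hA⟩ := a.exists_ordLE
  obtain ⟨B, hB⟩ := b.exists_ordLE
  exact (Finset.finite_toSet _).subset (support_mulTerm hA hB k)

theorem finsum_mulTerm_eq_zero {a b : PsiDO R} {A B : ℤ} (ha : a.OrdLE A) (hb : b.OrdLE B)
    {k : ℤ} (hk : A + B < k) : ∑ᶠ x, mulTerm a b k x = 0 := by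
  rw [finsum_eq_sum_of_support_subset _ (support_mulTerm ha hb k), Finset.Icc_eq_empty (by omega)]
  simp

/-- Composition of operators:
`(∑ aₘ ∂ᵐ) ∘ (∑ bₙ ∂ⁿ) = ∑_{m,n} ∑_{j ≥ 0} (m choose j) aₘ bₙ⁽ʲ⁾ ∂^{m+n-j}`. -/
instance : Mul (PsiDO R) :=
  ⟨fun a b => ⟨fun k => ∑ᶠ x : ℤ × ℕ, mulTerm a b k x, by
    obtain ⟨A, hA⟩ := a.exists_ordLE
    obtain ⟨B, hB⟩ := b.exists_ordLE
    exact ⟨A + B, fun k hk => finsum_mulTerm_eq_zero hA hB hk⟩⟩⟩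

theorem coeff_mul (a b : PsiDO R) (k : ℤ) :
    (a * b).coeff k = ∑ᶠ x : ℤ × ℕ,
      Ring.choose x.1 x.2 • (a.coeff x.1 * der x.2 (b.coeff (k - x.1 + x.2))) := rfl

theorem OrdLE.mul {a b : PsiDO R} {A B : ℤ} (ha : a.OrdLE A) (hb : b.OrdLE B) :
    (a * b).OrdLE (A + B) :=
  fun _ hk => finsum_mulTerm_eq_zero ha hb hk

theorem psi_add_mul (a b c : PsiDO R) : (a + b) * c = a * c + b * c := by
  ext k
  change ∑ᶠ x, mulTerm (a + b) c k x = ∑ᶠ x, mulTerm a c k x + ∑ᶠ x, mulTerm b c k x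
  rw [← finsum_add_distrib (finite_mulTerm a c k) (finite_mulTerm b c k)]
  exact finsum_congr fun x => by simp [mulTerm, add_mul]

theorem psi_mul_add (a b c : PsiDO R) : a * (b + c) = a * b + a * c := by
  ext k
  change ∑ᶠ x, mulTerm a (b + c) k x = ∑ᶠ x, mulTerm a b k x + ∑ᶠ x, mulTerm a c k x
  rw [← finsum_add_distrib (finite_mulTerm a b k) (finite_mulTerm a c k)]
  exact finsum_congr fun x => by simp [mulTerm, mul_add, der_add]

theorem coeff_mono_mul (m : ℤ) (x : R) {b : PsiDO R} {B : ℤ} (hb : b.OrdLE B) (t : ℕ) :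
    (mono m x * b).coeff (m + B - t) = ∑ ij ∈ Finset.HasAntidiagonal.antidiagonal t,
      Ring.choose m ij.2 • (x * der ij.2 (b.coeff (B - ij.1))) := by
  rw [coeff_mul, finsum_eq_sum_of_support_subset (s := (Finset.HasAntidiagonal.antidiagonal t).image
    fun ij => (m, ij.2))]
  · rw [Finset.sum_image]
    · refine Finset.sum_congr rfl fun ij hij => ?_
      rw [Finset.HasAntidiagonal.mem_antidiagonal] at hij
      have : m + B - (t : ℤ) - m + (ij.2 : ℤ) = B - ij.1 := by omega
      simp [coeff_mono, this]
    · rintro ⟨i, j⟩ hi ⟨i', j'⟩ hi' h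
      simp only [Finset.mem_coe,
        Finset.HasAntidiagonal.mem_antidiagonal, Prod.mk.injEq, true_and] at hi hi' h ⊢
      omega
  · rintro ⟨m', j⟩ h
    have h1 : m' = m := by
      by_contra hm
      exact h (by simp [coeff_mono, hm])
    subst h1
    have h2 : m' + B - (t : ℤ) - m' + j ≤ B := by
      by_contra hm
      exact h (by simp [hb _ (not_le.1 hm)])
    simp only [Finset.coe_image, Set.mem_image, Finset.mem_coe, Finset.HasAntidiagonal.mem_antidiagonal]
    exact ⟨(t - j, j), by simp; omega, rfl⟩

theorem coeff_mul_mono {a : PsiDO R} {A : ℤ} (ha : a.OrdLE A) (n : ℤ) (y : R) (t : ℕ) :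
    (a * mono n y).coeff (A + n - t) = ∑ ij ∈ Finset.HasAntidiagonal.antidiagonal t,
      Ring.choose (A - ij.1) ij.2 • (a.coeff (A - ij.1) * der ij.2 y) := by
  rw [coeff_mul, finsum_eq_sum_of_support_subset (s := (Finset.HasAntidiagonal.antidiagonal t).image
    fun ij => (A - (ij.1 : ℤ), ij.2))]
  · rw [Finset.sum_image]
    · refine Finset.sum_congr rfl fun ij hij => ?_
      rw [Finset.HasAntidiagonal.mem_antidiagonal] at hij
      have : A + n - (t : ℤ) - (A - ij.1) + (ij.2 : ℤ) = n := by omega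
      simp [coeff_mono, this]
    · rintro ⟨i, j⟩ hi ⟨i', j'⟩ hi' h
      simp only [Prod.mk.injEq] at h ⊢
      omega
  · rintro ⟨m', j⟩ h
    have h1 : m' ≤ A := by
      by_contra hm
      exact h (by simp [ha _ (not_le.1 hm)])
    have h2 : A + n - (t : ℤ) - m' + j = n := by
      by_contra hm
      exact h (by simp [coeff_mono, hm])
    simp only [Finset.coe_image, Set.mem_image, Finset.mem_coe, Finset.HasAntidiagonal.mem_antidiagonal]
    exact ⟨(t - j, j), by simp; omega, by simp; omega⟩

theorem coeff_mono_mul_mono (m n : ℤ) (x y : R) (i : ℕ) :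
    (mono m x * mono n y).coeff (m + n - i) = Ring.choose m i • (x * der i y) := by
  rw [coeff_mono_mul m x (ordLE_mono n y), Finset.sum_eq_single (0, i)]
  · simp [coeff_mono]
  · rintro ⟨u, v⟩ huv h
    rw [Finset.HasAntidiagonal.mem_antidiagonal] at huv
    have : u ≠ 0 := by
      rintro rfl
      simp_all
    simp [coeff_mono, this]
  · simp

theorem choose_vandermonde (m n : ℤ) (i j : ℕ) :
    Ring.choose (m + n - i) j * Ring.choose m i =
      ∑ vp ∈ Finset.HasAntidiagonal.antidiagonal j,
        Ring.choose m (i + vp.1) * Ring.choose n vp.2 * ((i + vp.1).choose i : ℤ) := by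
  rw [show m + n - (i : ℤ) = (m - i) + n by ring, Ring.add_choose_eq j (Commute.all _ _),
    Finset.sum_mul]
  refine Finset.sum_congr rfl fun vp _ => ?_
  have h := Ring.choose_add_smul_choose (m - (i : ℤ)) vp.1 i
  rw [sub_add_cancel, nsmul_eq_mul, Nat.add_comm vp.1 i] at h
  linear_combination -(Ring.choose n vp.2) * h

theorem mono_assoc (m n l : ℤ) (x y z : R) :
    mono m x * mono n y * mono l z = mono m x * (mono n y * mono l z) := by
  have h1 := (ordLE_mono m x).mul (ordLE_mono n y)
  have h2 := (ordLE_mono n y).mul (ordLE_mono l z)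
  ext k
  by_cases hk : m + n + l < k
  · rw [(h1.mul (ordLE_mono l z)) k hk, ((ordLE_mono m x).mul h2) k (by omega)]
  obtain ⟨t, rfl⟩ : ∃ t : ℕ, k = m + n + l - t := ⟨(m + n + l - k).toNat, by omega⟩
  rw [coeff_mul_mono h1, show m + n + l - (t : ℤ) = m + (n + l) - t by ring, coeff_mono_mul m x h2]
  simp only [coeff_mono_mul_mono, der_zsmul, der_mul, Finset.mul_sum, Finset.smul_sum,
    ← der_add_left]
  have hL : ∀ ij : ℕ × ℕ,
      Ring.choose (m + n - (ij.1 : ℤ)) ij.2 • (Ring.choose m ij.1 • (x * der ij.1 y) * der ij.2 z) =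
      ∑ vp ∈ Finset.HasAntidiagonal.antidiagonal ij.2,
        (Ring.choose m (ij.1 + vp.1) * Ring.choose n vp.2 * ((ij.1 + vp.1).choose ij.1 : ℤ)) •
          (x * der ij.1 y * der (vp.1 + vp.2) z) := by
    intro ij
    rw [smul_mul_assoc, smul_smul, choose_vandermonde, Finset.sum_smul]
    refine Finset.sum_congr rfl fun vp hvp => ?_
    rw [Finset.HasAntidiagonal.mem_antidiagonal.1 hvp]
  rw [Finset.sum_congr rfl fun ij _ => hL ij, Finset.sum_sigma', Finset.sum_sigma']
  refine Finset.sum_nbij' (fun s => ⟨(s.2.2, s.1.1 + s.2.1), (s.1.1, s.2.1)⟩)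
    (fun s => ⟨(s.2.1, s.2.2 + s.1.1), (s.2.2, s.1.1)⟩) ?_ ?_ ?_ ?_ ?_
  · rintro ⟨⟨i, j⟩, ⟨v, p⟩⟩ h
    simp only [Finset.mem_sigma, Finset.HasAntidiagonal.mem_antidiagonal] at h ⊢
    exact ⟨by omega, by trivial⟩
  · rintro ⟨⟨i, j⟩, ⟨v, p⟩⟩ h
    simp only [Finset.mem_sigma, Finset.HasAntidiagonal.mem_antidiagonal] at h ⊢
    exact ⟨by omega, by trivial⟩
  · rintro ⟨⟨i, j⟩, ⟨v, p⟩⟩ h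
    simp only [Finset.mem_sigma, Finset.HasAntidiagonal.mem_antidiagonal] at h ⊢
    obtain ⟨_, rfl⟩ := h
    rfl
  · rintro ⟨⟨i, j⟩, ⟨v, p⟩⟩ h
    simp only [Finset.mem_sigma, Finset.HasAntidiagonal.mem_antidiagonal] at h ⊢
    obtain ⟨_, rfl⟩ := h
    rfl
  · rintro ⟨⟨i, j⟩, ⟨v, p⟩⟩ h
    simp only [zsmul_eq_mul, nsmul_eq_mul]
    push_cast
    ring

theorem psi_mul_assoc (a b c : PsiDO R) : a * b * c = a * (b * c) := by
  obtain ⟨B, hB⟩ := b.exists_ordLE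
  obtain ⟨C, hC⟩ := c.exists_ordLE
  ext k
  refine induct (P := fun a => (a * b * c).coeff k = (a * (b * c)).coeff k)
    (k - B - C - 1) ?_ ?_ ?_ a
  · intro a a' h h'
    simp only [psi_add_mul, coeff_add, h, h']
  · intro m x
    refine induct (P := fun b => (mono m x * b * c).coeff k = (mono m x * (b * c)).coeff k)
      (k - m - C - 1) ?_ ?_ ?_ b
    · intro b b' h h'
      simp only [psi_add_mul, psi_mul_add, coeff_add, h, h']
    · intro n y
      refine induct (P := fun c => (mono m x * mono n y * c).coeff k =
        (mono m x * (mono n y * c)).coeff k) (k - m - n - 1) ?_ ?_ ?_ c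
      · intro b b' h h'
        simp only [psi_mul_add, coeff_add, h, h']
      · intro l z
        rw [mono_assoc]
      · intro c hc
        rw [(((ordLE_mono m x).mul (ordLE_mono n y)).mul hc) k (by omega),
          ((ordLE_mono m x).mul ((ordLE_mono n y).mul hc)) k (by omega)]
    · intro b hb
      rw [(((ordLE_mono m x).mul hb).mul hC) k (by omega),
        ((ordLE_mono m x).mul (hb.mul hC)) k (by omega)]
  · intro a ha
    rw [((ha.mul hB).mul hC) k (by omega), (ha.mul (hB.mul hC)) k (by omega)]

theorem psi_one_mul (a : PsiDO R) : 1 * a = a := by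
  ext k
  rw [coeff_mul, finsum_eq_single _ ((0 : ℤ), 0)]
  · simp [show (1 : PsiDO R) = mono 0 1 from rfl, coeff_mono]
  · rintro ⟨m, j⟩ h
    by_cases hm : m = 0
    · subst hm
      have : j ≠ 0 := by
        rintro rfl
        exact h rfl
      simp [Ring.choose_zero_ite, this]
    · simp [show (1 : PsiDO R) = mono 0 1 from rfl, coeff_mono, hm]

theorem psi_mul_one (a : PsiDO R) : a * 1 = a := by
  ext k
  rw [coeff_mul, finsum_eq_single _ (k, 0)]
  · simp [show (1 : PsiDO R) = mono 0 1 from rfl, coeff_mono]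
  · rintro ⟨m, j⟩ h
    simp only [show (1 : PsiDO R) = mono 0 1 from rfl, coeff_mono]
    split_ifs with hm
    · have : j ≠ 0 := by
        rintro rfl
        exact h (by simp; omega)
      simp [der_one, this]
    · simp

theorem psi_zero_mul (a : PsiDO R) : 0 * a = 0 := by
  have h := psi_add_mul 0 0 a
  rwa [add_zero, left_eq_add] at h

theorem psi_mul_zero (a : PsiDO R) : a * 0 = 0 := by
  have h := psi_mul_add a 0 0
  rwa [add_zero, left_eq_add] at h

instance : Ring (PsiDO R) where
  left_distrib := psi_mul_add
  right_distrib := psi_add_mul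
  zero_mul := psi_zero_mul
  mul_zero := psi_mul_zero
  mul_assoc := psi_mul_assoc
  one_mul := psi_one_mul
  mul_one := psi_mul_one
  neg_add_cancel := neg_add_cancel
  zsmul := (· • ·)
  zsmul_zero' := zero_zsmul
  zsmul_succ' n a := by exact SubNegMonoid.zsmul_succ' n a
  zsmul_neg' n a := by exact SubNegMonoid.zsmul_neg' n a
  nsmul := (· • ·)
  nsmul_zero := zero_nsmul
  nsmul_succ n a := by exact AddMonoid.nsmul_succ n a
  sub_eq_add_neg := sub_eq_add_neg

end PsiDO

/-! ### Differential polynomials and the classical affine Poisson vertex algebra of `gl` -/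

/-- The algebra of differential polynomials over `ℂ` in variables indexed by `σ`; the variable
`(x, n)` stands for the `n`-th derivative of `x`. -/
abbrev DiffPoly (σ : Type*) : Type _ := MvPolynomial (σ × ℕ) ℂ

/-- The derivation `∂` with `∂ x⁽ⁿ⁾ = x⁽ⁿ⁺¹⁾`. -/
instance (σ : Type*) : Differential (DiffPoly σ) where
  deriv := (MvPolynomial.mkDerivation ℂ fun y : σ × ℕ =>
    (MvPolynomial.X (y.1, y.2 + 1) : DiffPoly σ)).restrictScalars ℤ

/-- The operator `λ + ∂` on `R[λ]`, where `∂` acts on the coefficients. -/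
def lamD {R : Type*} [CommRing R] [Differential R] (q : Polynomial R) : Polynomial R :=
  Polynomial.X * q + Differential.mapCoeffs q

section Affine

variable {n : Type*} [Fintype n] [DecidableEq n]

/-- The matrix unit `E_{αβ}`. -/
def matUnit (x : n × n) : Matrix n n ℂ := Matrix.single x.1 x.2 1

/-- The inclusion of `gl` in `𝒱(gl) = S(ℂ[∂] gl)`; the variables of `𝒱(gl)` are the matrix units. -/
def emb (a : Matrix n n ℂ) : DiffPoly (n × n) :=
  ∑ x : n × n, MvPolynomial.C (a x.1 x.2) * MvPolynomial.X (x, 0)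

/-- The `λ`-bracket of the classical affine Poisson vertex algebra `𝒱(gl)`, with
`{a_λ b} = [a,b] + tr(ab) λ` on `gl`, extended by sesquilinearity and the Leibniz rules, that is
`{F_λ G} = ∑ (∂G/∂y⁽ʲ⁾) (λ+∂)ʲ {x_{λ+∂} y}_→ (-λ-∂)ⁱ (∂F/∂x⁽ⁱ⁾)`. -/
def affineBracket (F G : DiffPoly (n × n)) : Polynomial (DiffPoly (n × n)) :=
  ∑ x ∈ F.vars, ∑ y ∈ G.vars,
    let q : Polynomial (DiffPoly (n × n)) :=
      (fun z => -lamD z)^[x.2] (Polynomial.C (MvPolynomial.pderiv x F))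
    Polynomial.C (MvPolynomial.pderiv y G) *
      lamD^[y.2] (Polynomial.C (emb ⁅matUnit x.1, matUnit y.1⁆) * q +
        Polynomial.C (MvPolynomial.C (matUnit x.1 * matUnit y.1).trace) * lamD q)

end Affine

/-! ### Quasideterminants -/

section Quasidet

variable {m n A : Type*} [Fintype m] [DecidableEq m] [Fintype n] [DecidableEq n] [Ring A]

/-- Existence of the quasideterminant `|M|_{U,W}`, where `U` and `W` are the spans of the basis
vectors with indices `u a`, respectively `w a`. -/
def QuasidetExists (M : Matrix n n A) (u w : m → n) : Prop :=
  IsUnit M ∧ IsUnit ((Ring.inverse M).submatrix w u)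

/-- The quasideterminant `|M|_{U,W} = (1_W M⁻¹ 1_U)⁻¹`. -/
def quasidet (M : Matrix n n A) (u w : m → n) : Matrix m m A :=
  Ring.inverse ((Ring.inverse M).submatrix w u)

end Quasidet

/-! ### The pyramid, the grading and the `W`-algebra -/

/-- A partition `p₁ ≥ ⋯ ≥ p_r > 0` with `r` parts. -/
structure Pyramid (r : ℕ) where
  part : Fin r → ℕ
  anti : Antitone part
  pos : ∀ a, 0 < part a

namespace Pyramid

variable {r : ℕ} (P : Pyramid r)

/-- The index set of the basis of `V`. The second index starts at `0`. -/
abbrev Box : Type := Σ a : Fin r, Fin (P.part a)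

/-- The first (rightmost) box of a row; these boxes span `V₊`. -/
def firstBox (a : Fin r) : P.Box := ⟨a, ⟨0, P.pos a⟩⟩

/-- The last (leftmost) box of a row; these boxes span `V₋`. -/
def lastBox (a : Fin r) : P.Box := ⟨a, ⟨P.part a - 1, Nat.sub_lt (P.pos a) one_pos⟩⟩

/-- The Lie algebra `gl(V) = gl_N`. -/
abbrev gl : Type := Matrix P.Box P.Box ℂ

/-- The nilpotent element `f`, which sends `e_{(a,i)}` to `e_{(a,i+1)}`. -/
def nilp : P.gl :=
  Matrix.of fun x y => if x.1 = y.1 ∧ (x.2 : ℕ) = (y.2 : ℕ) + 1 then 1 else 0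

/-- The eigenvalue `(p_a + 1)/2 - i` of `χ` on `e_{(a,i)}` (here `i` is counted from `1`). -/
def chi (x : P.Box) : ℚ := ((P.part x.1 : ℚ) + 1) / 2 - (((x.2 : ℕ) : ℚ) + 1)

/-- The `ad χ`-eigenvalue of the matrix unit `E_{αβ}`. -/
def deg (x : P.Box × P.Box) : ℚ := P.chi x.1 - P.chi x.2

theorem lie_chi_matUnit (x : P.Box × P.Box) :
    ⁅Matrix.diagonal (fun y => (P.chi y : ℂ)), matUnit x⁆ = (P.deg x : ℂ) • matUnit x := by
  ext i j
  simp only [Ring.lie_def, matUnit, deg, Matrix.sub_apply, Matrix.diagonal_mul,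
    Matrix.mul_diagonal, Matrix.smul_apply, Matrix.single_apply, smul_eq_mul]
  split_ifs with h
  · obtain ⟨h1, h2⟩ := h
    rw [h1, h2]
    push_cast
    ring
  · simp

/-- `g_{≥ 1/2}`. -/
def gGe : Set P.gl := {a | ∀ x, a x.1 x.2 ≠ 0 → 1 / 2 ≤ P.deg x}

/-- `g_{≤ 1/2}`. -/
def gLe : Set P.gl := {a | ∀ x, a x.1 x.2 ≠ 0 → P.deg x ≤ 1 / 2}

/-- The differential algebra `𝒱(g)`. -/
abbrev Vg : Type := DiffPoly (P.Box × P.Box)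

/-- The differential algebra `𝒱(g_{≤ 1/2})`. -/
abbrev Vle : Type := DiffPoly {x : P.Box × P.Box // P.deg x ≤ 1 / 2}

/-- The inclusion of `𝒱(g_{≤ 1/2})` in `𝒱(g)`. -/
def incl : P.Vle →ₐ[ℂ] P.Vg := MvPolynomial.rename fun y => (y.1.1, y.2)

/-- The inclusion of `g_{≤ 1/2}` in `𝒱(g_{≤ 1/2})` (only used for `a ∈ g_{≤ 1/2}`). -/
def embLe (a : P.gl) : P.Vle :=
  ∑ x : {x : P.Box × P.Box // P.deg x ≤ 1 / 2},
    MvPolynomial.C (a x.1.1 x.1.2) * MvPolynomial.X (x, 0)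

/-- The differential algebra homomorphism `ρ : 𝒱(g) → 𝒱(g_{≤ 1/2})` with
`ρ(a) = π_{≤ 1/2}(a) + (f|a)` for `a ∈ g`. -/
def rho : P.Vg →ₐ[ℂ] P.Vle :=
  MvPolynomial.aeval fun y =>
    (if h : P.deg y.1 ≤ 1 / 2 then MvPolynomial.X (⟨y.1, h⟩, y.2) else 0) +
      (if y.2 = 0 then MvPolynomial.C (P.nilp * matUnit y.1).trace else 0)

/-- The classical `W`-algebra `W(gl_N, p)`. -/
def wAlgebra : Set P.Vle :=
  {w | ∀ a ∈ P.gGe, (affineBracket (emb a) (P.incl w)).map P.rho.toRingHom = 0}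

/-- The centralizer `g^f`. -/
def gf : Set P.gl := {a | ⁅P.nilp, a⁆ = 0}

/-- The element `f_{ab;i} = ∑_{j=0}^{i} E_{(a,p_a+j-i),(b,j+1)}` of `g^f` (in the formula the
second indices are counted from `1`). -/
def fElt (a b : Fin r) (i : Fin (min (P.part a) (P.part b))) : P.gl :=
  ∑ j : Fin ((i : ℕ) + 1),
    matUnit (⟨a, ⟨P.part a - 1 - i + j, by have := i.2; have := j.2; omega⟩⟩,
      ⟨b, ⟨j, by have := i.2; have := j.2; omega⟩⟩)

/-- The subspace `U`, spanned by the `E_{(b,1),(a,p_a-i)}` with `0 ≤ i < min(p_a, p_b)` (in the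
formula the second indices are counted from `1`). -/
def subU : Submodule ℂ P.gl :=
  Submodule.span ℂ {u | ∃ (a b : Fin r) (i : Fin (min (P.part a) (P.part b))),
    u = matUnit (P.firstBox b, ⟨a, ⟨P.part a - 1 - i, by have := i.2; omega⟩⟩)}

/-- The orthogonal complement of `U` in `g_{≤ 1/2}` for the trace form. -/
def uPerp : Set P.gl := {a | a ∈ P.gLe ∧ ∀ u ∈ P.subU, (a * u).trace = 0}

/-- The differential ideal `⟨U^⊥⟩` of `𝒱(g_{≤ 1/2})`. -/
def uPerpIdeal : Ideal P.Vle :=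
  Ideal.span {x | ∃ u ∈ P.uPerp, ∃ n : ℕ, x = PsiDO.der n (P.embLe u)}

/-- The differential subalgebra `𝒱(g^f)` of `𝒱(g_{≤ 1/2})`. -/
def vgf : Subalgebra ℂ P.Vle :=
  Algebra.adjoin ℂ {x | ∃ q ∈ P.gf, ∃ n : ℕ, x = PsiDO.der n (P.embLe q)}

/-- `x` is an element of the `W`-algebra of the form `q + r` with `r ∈ ⟨U^⊥⟩`. -/
def IsLift (q x : P.Vle) : Prop := x ∈ P.wAlgebra ∧ x - q ∈ P.uPerpIdeal

open Classical in
/-- The map `w : 𝒱(g^f) → W(gl_N, p)`: `w(q)` is the unique element of the `W`-algebra of the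
form `q + r` with `r ∈ ⟨U^⊥⟩`. -/
def wMap (q : P.Vle) : P.Vle := if h : ∃ x, P.IsLift q x then h.choose else 0

/-- The generator `w_{ab;i} = w(f_{ab;i})`. -/
def wGen (a b : Fin r) (i : Fin (min (P.part a) (P.part b))) : P.Vle :=
  P.wMap (P.embLe (P.fElt a b i))

/-- The generator matrix `W(∂)`, with entries `∑_i w_{ba;i} (-∂)ⁱ`. -/
def genMatrix : Matrix (Fin r) (Fin r) (PsiDO P.Vle) :=
  Matrix.of fun a b =>
    ∑ i : Fin (min (P.part b) (P.part a)), PsiDO.const (P.wGen b a i) * (-PsiDO.D) ^ (i : ℕ)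

/-- The diagonal matrix `(-∂)^p`. -/
def negDPow : Matrix (Fin r) (Fin r) (PsiDO P.Vle) :=
  Matrix.diagonal fun a => (-PsiDO.D) ^ P.part a

/-! ### The operator `T(∂)` and the recursion -/

/-- The matrix differential operator `A(∂) = 1 ∂ + ∑ u_i U^i`; the matrix unit dual to `E_{βα}`
for the trace form is `E_{αβ}`. -/
def opA : Matrix P.Box P.Box (PsiDO P.Vg) :=
  Matrix.of fun x y => (if x = y then PsiDO.D else 0) + PsiDO.const (emb (matUnit (y, x)))

/-- `ρA(∂)`. -/
def rhoA : Matrix P.Box P.Box (PsiDO P.Vle) := P.opA.map (PsiDO.map P.rho.toRingHom)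

/-- `T(∂) = |ρA(∂)|_{V₊,V₋}`; the `(a,b)` entry is the coefficient of `E_{(a,1),(b,p_b)}`. -/
def opT : Matrix (Fin r) (Fin r) (PsiDO P.Vle) := quasidet P.rhoA P.firstBox P.lastBox

/-- The number `s` of distinct parts. -/
def numBlocks : ℕ := (Finset.univ.image P.part).card

/-- The number `k ∈ {1,…,s}` of the rectangle that contains row `a`, so that row `a` contributes
to `V_{±,k}`. -/
def block (a : Fin r) : ℕ := ((Finset.univ.image P.part).filter fun l => P.part a < l).card + 1

/-- `1_{V_{+,≥k}} M 1_{V_{-,≥k}}`. -/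
def corner (k : ℕ) (M : Matrix (Fin r) (Fin r) (PsiDO P.Vle)) :
    Matrix {a // k ≤ P.block a} {a // k ≤ P.block a} (PsiDO P.Vle) :=
  M.submatrix Subtype.val Subtype.val

/-- `T⁽ᵏ⁺¹⁾ (W⁽ᵏ⁺¹⁾)⁻¹`, for `M = T⁽ᵏ⁺¹⁾`. -/
def rightQuot (k : ℕ) (M : Matrix (Fin r) (Fin r) (PsiDO P.Vle)) :
    Matrix (Fin r) {a // k + 1 ≤ P.block a} (PsiDO P.Vle) :=
  M.submatrix id Subtype.val * Ring.inverse (P.corner (k + 1) M)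

/-- `(W⁽ᵏ⁺¹⁾)⁻¹ T⁽ᵏ⁺¹⁾`, for `M = T⁽ᵏ⁺¹⁾`. -/
def leftQuot (k : ℕ) (M : Matrix (Fin r) (Fin r) (PsiDO P.Vle)) :
    Matrix {a // k + 1 ≤ P.block a} (Fin r) (PsiDO P.Vle) :=
  Ring.inverse (P.corner (k + 1) M) * M.submatrix Subtype.val id

/-- `E₋⁽ᵏ⁾ = 1 - 1_{V_{+,k}} (T⁽ᵏ⁺¹⁾ (W⁽ᵏ⁺¹⁾)⁻¹)₊`, for `M = T⁽ᵏ⁺¹⁾`. -/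
def eMinus (k : ℕ) (M : Matrix (Fin r) (Fin r) (PsiDO P.Vle)) :
    Matrix (Fin r) (Fin r) (PsiDO P.Vle) :=
  1 - Matrix.of fun a b =>
    if h : P.block a = k ∧ k + 1 ≤ P.block b then
      (P.rightQuot k M a ⟨b, h.2⟩).posPart
    else 0

/-- `F₋⁽ᵏ⁾ = 1 - ((W⁽ᵏ⁺¹⁾)⁻¹ T⁽ᵏ⁺¹⁾)₊ 1_{V_{-,k}}`, for `M = T⁽ᵏ⁺¹⁾`. -/
def fMinus (k : ℕ) (M : Matrix (Fin r) (Fin r) (PsiDO P.Vle)) :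
    Matrix (Fin r) (Fin r) (PsiDO P.Vle) :=
  1 - Matrix.of fun a b =>
    if h : k + 1 ≤ P.block a ∧ P.block b = k then
      (P.leftQuot k M ⟨a, h.1⟩ b).posPart
    else 0

/-- The operators `T⁽ˢ⁾, T⁽ˢ⁻¹⁾, …`. -/
def recAux : ℕ → Matrix (Fin r) (Fin r) (PsiDO P.Vle)
  | 0 => P.opT
  | j + 1 => P.eMinus (P.numBlocks - (j + 1)) (recAux j) * recAux j *
      P.fMinus (P.numBlocks - (j + 1)) (recAux j)

/-- `T⁽ᵏ⁾(∂)`, for `1 ≤ k ≤ s`. -/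
def recT (k : ℕ) : Matrix (Fin r) (Fin r) (PsiDO P.Vle) := P.recAux (P.numBlocks - k)

/-- `W⁽ᵏ⁾(∂) = 1_{V_{+,≥k}} T⁽ᵏ⁾(∂) 1_{V_{-,≥k}}`. -/
def recW (k : ℕ) : Matrix {a // k ≤ P.block a} {a // k ≤ P.block a} (PsiDO P.Vle) :=
  P.corner k (P.recT k)

theorem recT_numBlocks : P.recT P.numBlocks = P.opT := by
  rw [recT, Nat.sub_self, recAux]

theorem recT_of_lt {k : ℕ} (hk : k < P.numBlocks) :
    P.recT k = P.eMinus k (P.recT (k + 1)) * P.recT (k + 1) * P.fMinus k (P.recT (k + 1)) := by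
  obtain ⟨j, hj⟩ : ∃ j, P.numBlocks = k + j + 1 := ⟨P.numBlocks - k - 1, by omega⟩
  have h1 : P.numBlocks - k = j + 1 := by omega
  have h2 : P.numBlocks - (k + 1) = j := by omega
  have h3 : P.numBlocks - (j + 1) = k := by omega
  rw [recT, recT, h1, h2, recAux, h3]

theorem one_le_block (a : Fin r) : 1 ≤ P.block a := Nat.le_add_left _ _

end Pyramid

end

end WGL

/-!
Put `T ~ T'` when `T' = E T F` for unitriangular matrix differential operators `E` and `F`,
triangular with respect to the lengths of the rows of the pyramid. The factors in the recursion are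
of this kind, so `T(∂) ~ T⁽¹⁾(∂)`, and `T⁽¹⁾(∂)` is *reduced*: its `(a, b)` entry differs from that
of `-(-∂)^p` by terms of order less than `min {p_a, p_b}`. A comparison of orders shows that
equivalent reduced matrices are equal, so whatever preserves `T(∂)` up to equivalence fixes
`T⁽¹⁾(∂)`.

First, for `a ∈ g_{≥ 1/2}` the operator `w ↦ ρ{a_λ w}` is the infinitesimal part of a differential
homomorphism from `𝒱(g_{≤ 1/2})` to an extension with an element of square zero. On `ρA(∂)` it acts
as conjugation by a unipotent matrix, hence changes `T(∂)` only up to equivalence: the coefficients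
of `T⁽¹⁾(∂)` lie in the `W`-algebra. Secondly, after reduction modulo `⟨U^⊥⟩` the matrix `T(∂)` is
itself reduced, with the classes of the `f_{ab;i}` as coefficients, so `T⁽¹⁾(∂)` has the same
reduction.

Thus the coefficients of `T⁽¹⁾(∂)` lift the generators of `𝒱(g^f)`, and the `W`-algebra surjects
onto it. For injectivity, take an element of the `W`-algebra with zero reduction and a monomial of
lowest weight in it, for a suitable weight on the generators. It involves a variable from `U^⊥`,
and by nondegeneracy of `(f|[a, z])` some `ρ{a_λ ·}` acts to leading order as the partial
derivative by that variable, which cannot vanish.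
-/

namespace WGL

noncomputable section

open scoped Differential

open OrderDual (toDual)

/-! ### Pseudodifferential operators -/

/-- A homomorphism of differential rings: a ring homomorphism that commutes with the
derivations. -/
def IsDiffHom {R S : Type*} [CommRing R] [Differential R] [CommRing S] [Differential S]
    (φ : R →+* S) : Prop :=
  ∀ x, φ x′ = (φ x)′

theorem IsDiffHom.map_der {R S : Type*} [CommRing R] [Differential R] [CommRing S]
    [Differential S] {φ : R →+* S} (hφ : IsDiffHom φ) (n : ℕ) (x : R) :
    φ (PsiDO.der n x) = PsiDO.der n (φ x) := by
  induction n with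
  | zero => rfl
  | succ n ih => rw [PsiDO.der_succ, PsiDO.der_succ, hφ, ih]

namespace PsiDO

section Order

variable {R : Type*} [CommRing R] {a b : PsiDO R} {A B : ℤ}

theorem coeff_posPart (a : PsiDO R) (n : ℤ) :
    a.posPart.coeff n = if 0 ≤ n then a.coeff n else 0 := rfl

theorem coeff_map {S : Type*} [CommRing S] (f : R →+* S) (a : PsiDO R) (n : ℤ) :
    (a.map f).coeff n = f (a.coeff n) := rfl

theorem coeff_one (n : ℤ) : (1 : PsiDO R).coeff n = if n = 0 then 1 else 0 :=
  coeff_mono 0 1 n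

theorem coeff_const (x : R) (n : ℤ) : (const x).coeff n = if n = 0 then x else 0 :=
  coeff_mono 0 x n

theorem coeff_sum {ι : Type*} (s : Finset ι) (f : ι → PsiDO R) (n : ℤ) :
    (∑ i ∈ s, f i).coeff n = ∑ i ∈ s, (f i).coeff n :=
  map_sum (AddMonoidHom.mk' (fun a : PsiDO R => a.coeff n) fun _ _ => rfl) f s

theorem OrdLE.mono (ha : a.OrdLE A) (h : A ≤ B) : a.OrdLE B := fun n hn => ha n (h.trans_lt hn)

theorem OrdLE.add (ha : a.OrdLE A) (hb : b.OrdLE A) : (a + b).OrdLE A :=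
  fun n hn => by rw [coeff_add, ha n hn, hb n hn, add_zero]

theorem OrdLE.neg (ha : a.OrdLE A) : (-a).OrdLE A :=
  fun n hn => by rw [coeff_neg, ha n hn, neg_zero]

theorem OrdLE.sub (ha : a.OrdLE A) (hb : b.OrdLE A) : (a - b).OrdLE A :=
  sub_eq_add_neg a b ▸ ha.add hb.neg

theorem OrdLE.sum {ι : Type*} {s : Finset ι} {f : ι → PsiDO R}
    (h : ∀ i ∈ s, (f i).OrdLE A) : (∑ i ∈ s, f i).OrdLE A := fun n hn => by
  rw [coeff_sum]
  exact Finset.sum_eq_zero fun i hi => h i hi n hn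

theorem ordLE_zero (A : ℤ) : (0 : PsiDO R).OrdLE A := fun _ _ => rfl

theorem ordLE_one : (1 : PsiDO R).OrdLE 0 := ordLE_mono 0 1

theorem ordLE_D : (D : PsiDO R).OrdLE 1 := ordLE_mono 1 1

theorem ordLE_const (x : R) : (const x).OrdLE 0 := ordLE_mono 0 x

theorem OrdLE.posPart (ha : a.OrdLE A) : a.posPart.OrdLE A := fun n hn => by
  rw [coeff_posPart, ha n hn, ite_self]

theorem ordLE_sub_posPart (a : PsiDO R) : (a - a.posPart).OrdLE (-1) := fun n hn => by
  rw [coeff_sub, coeff_posPart, if_pos (by omega), sub_self]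

theorem exists_nat_forall_ordLE {m : Type*} [Finite m] (N : m → PsiDO R) :
    ∃ j : ℕ, ∀ b, (N b).OrdLE (j - 1) := by
  choose A hA using fun b => (N b).exists_ordLE
  obtain ⟨B, hB⟩ := (Set.finite_range A).bddAbove
  exact ⟨(B + 1).toNat, fun b => (hA b).mono (by have := hB ⟨b, rfl⟩; omega)⟩

theorem isDiffOp_posPart (a : PsiDO R) : a.posPart.IsDiffOp := fun n hn => by
  rw [coeff_posPart, if_neg (not_le.2 hn)]

theorem IsDiffOp.eq_zero (ha : a.IsDiffOp) (h : a.OrdLE (-1)) : a = 0 := by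
  ext n
  rcases lt_or_ge n 0 with hn | hn
  · exact ha n hn
  · exact h n (by omega)

theorem isDiffOp_mono (i : ℕ) (x : R) : (mono (i : ℤ) x).IsDiffOp := fun n hn => by
  rw [coeff_mono, if_neg (by omega)]

theorem isDiffOp_D : (D : PsiDO R).IsDiffOp := isDiffOp_mono 1 1

theorem isDiffOp_const (x : R) : (const x).IsDiffOp := isDiffOp_mono 0 x

end Order

variable {R : Type*} [CommRing R] [Differential R]

/-- The subring `R[∂]` of differential operators in `R((∂⁻¹))`. -/
def diffOps (R : Type*) [CommRing R] [Differential R] : Subring (PsiDO R) where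
  carrier := {a | a.IsDiffOp}
  zero_mem' := fun _ _ => rfl
  one_mem' := isDiffOp_mono 0 1
  add_mem' := fun {a b} ha hb n hn => by rw [coeff_add, ha n hn, hb n hn, add_zero]
  neg_mem' := fun {a} ha n hn => by rw [coeff_neg, ha n hn, neg_zero]
  mul_mem' := by
    intro a b ha hb k hk
    rw [coeff_mul]
    refine finsum_eq_zero_of_forall_eq_zero fun ⟨m, j⟩ => ?_
    rcases lt_or_ge m 0 with hm | hm
    · simp [ha m hm]
    rcases lt_or_ge (k - m + j) 0 with h | h
    · simp [hb _ h]
    lift m to ℕ using hm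
    simp [Ring.choose_natCast, Nat.choose_eq_zero_of_lt (show m < j by omega)]

theorem coeff_const_mul (x : R) (a : PsiDO R) (n : ℤ) : (const x * a).coeff n = x * a.coeff n := by
  rw [coeff_mul, finsum_eq_single _ ((0 : ℤ), 0)]
  · simp [coeff_const]
  · rintro ⟨m, j⟩ h
    by_cases hm : m = 0
    · have hj : j ≠ 0 := fun hj => h (by rw [hm, hj])
      simp [hm, Ring.choose_zero_ite, hj]
    · simp [coeff_const, hm]

theorem coeff_mul_mono_one (a : PsiDO R) (l n : ℤ) :
    (a * mono l 1).coeff n = a.coeff (n - l) := by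
  rw [coeff_mul, finsum_eq_single _ (n - l, 0)]
  · simp [coeff_mono]
  · rintro ⟨m, j⟩ h
    by_cases hm : n - m + j = l
    · have hj : j ≠ 0 := by
        rintro rfl
        exact h (Prod.ext (by push_cast at hm; dsimp only; omega) rfl)
      rw [coeff_mono, if_pos hm, der_one, if_neg hj, mul_zero, smul_zero]
    · simp [coeff_mono, hm]

theorem coeff_mul_D (a : PsiDO R) (n : ℤ) : (a * D).coeff n = a.coeff (n - 1) :=
  coeff_mul_mono_one a 1 n

theorem coeff_D_mul (a : PsiDO R) (n : ℤ) :
    (D * a).coeff n = a.coeff (n - 1) + (a.coeff n)′ := by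
  have choose_one {j : ℕ} (hj : 1 < j) : Ring.choose (1 : ℤ) j = 0 := by
    simpa [Nat.choose_eq_zero_of_lt hj] using Ring.choose_natCast (R := ℤ) 1 j
  rw [coeff_mul, finsum_eq_sum_of_support_subset (s := {((1 : ℤ), 0), (1, 1)})]
  · rw [Finset.sum_pair (by simp)]
    simp [D, coeff_mono, der_succ]
  · rintro ⟨m, j⟩ h
    by_cases hm : m = 1
    · have hj : j < 2 := by
        by_contra hj
        exact h (by simp [hm, choose_one (show 1 < j by omega)])
      interval_cases j <;> simp [hm]
    · exact absurd (by simp [D, coeff_mono, hm]) h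

theorem mono_one_mul_mono_one (k l : ℤ) : (mono k 1 * mono l 1 : PsiDO R) = mono (k + l) 1 := by
  ext n
  rw [coeff_mul_mono_one, coeff_mono, coeff_mono]
  exact if_congr (by omega) rfl rfl

/-- The inclusion of `R` in `R((∂⁻¹))`, as a ring homomorphism. -/
def constHom (R : Type*) [CommRing R] [Differential R] : R →+* PsiDO R where
  toFun := const
  map_zero' := by ext n; simp [coeff_const]
  map_one' := rfl
  map_add' x y := by ext n; simp only [coeff_const, coeff_add]; split_ifs <;> simp
  map_mul' x y := by ext n; simp [coeff_const_mul, coeff_const]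

theorem const_zero : (const 0 : PsiDO R) = 0 := map_zero (constHom R)

theorem D_mul_const (x : R) : D * const x = const x * D + const x′ := by
  ext n
  rw [coeff_D_mul, coeff_add, coeff_mul_D]
  simp only [coeff_const]
  split_ifs <;> simp

theorem neg_D_pow (i : ℕ) : ((-D) ^ i : PsiDO R) = mono i ((-1) ^ i) := by
  induction i with
  | zero => rw [pow_zero, pow_zero]; rfl
  | succ i ih =>
    ext n
    rw [pow_succ, ih, mul_neg, coeff_neg, coeff_mul_D, coeff_mono, coeff_mono, pow_succ]
    push_cast
    by_cases h : n = i + 1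
    · simp [h]
    · rw [if_neg h, if_neg (by omega), neg_zero]

theorem ordLE_neg_D_pow (i : ℕ) : ((-D) ^ i : PsiDO R).OrdLE i := by
  rw [neg_D_pow]
  exact ordLE_mono _ _

theorem isDiffOp_neg_D_pow (i : ℕ) : ((-D) ^ i : PsiDO R).IsDiffOp := by
  rw [neg_D_pow]
  exact isDiffOp_mono _ _

theorem coeff_const_mul_neg_D_pow (x : R) (i : ℕ) (n : ℤ) :
    (const x * (-D) ^ i).coeff n = if n = i then (-1) ^ i * x else 0 := by
  rw [coeff_const_mul, neg_D_pow, coeff_mono, mul_ite, mul_zero, mul_comm]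

theorem IsDiffOp.eq_sum {a : PsiDO R} (ha : a.IsDiffOp) {n : ℕ} (h : a.OrdLE (n - 1)) :
    a = ∑ i : Fin n, const ((-1) ^ (i : ℕ) * a.coeff i) * (-D) ^ (i : ℕ) := by
  ext k : 1
  simp only [coeff_sum, coeff_const_mul_neg_D_pow]
  by_cases hk : 0 ≤ k ∧ k < n
  · obtain ⟨i, rfl⟩ := Int.eq_ofNat_of_zero_le hk.1
    rw [Finset.sum_eq_single ⟨i, by omega⟩, if_pos rfl, ← mul_assoc, ← pow_add,
      Even.neg_one_pow ⟨i, rfl⟩, one_mul]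
    · exact fun j _ hj => if_neg fun h => hj (Fin.ext (by simpa using h.symm))
    · exact fun h => absurd (Finset.mem_univ _) h
  · rw [Finset.sum_eq_zero fun i _ => if_neg (by have := i.2; omega)]
    by_cases h0 : k < 0
    · exact ha k h0
    · exact h k (by omega)

theorem OrdLE.pow {a : PsiDO R} {A : ℤ} (ha : a.OrdLE A) (i : ℕ) : (a ^ i).OrdLE (i * A) := by
  induction i with
  | zero => simpa using ordLE_one
  | succ i ih => exact pow_succ a i ▸ (ih.mul ha).mono (by push_cast; linarith)

/-- The operator `∂` as a unit of `R((∂⁻¹))`. -/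
def unitD (R : Type*) [CommRing R] [Differential R] : (PsiDO R)ˣ where
  val := D
  inv := mono (-1) 1
  val_inv := mono_one_mul_mono_one 1 (-1)
  inv_val := mono_one_mul_mono_one (-1) 1

theorem ordLE_inv_neg_unitD_pow (i : ℕ) :
    ((-(-unitD R) ^ i)⁻¹).val.OrdLE (-i) := by
  have h : ((-unitD R)⁻¹).val.OrdLE (-1) := (ordLE_mono (-1) (1 : R)).neg
  rw [inv_neg, Units.val_neg, ← inv_pow, Units.val_pow_eq_pow_val]
  exact (h.pow i).neg.mono (by omega)

variable {S : Type*} [CommRing S] [Differential S] {φ : R →+* S}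

/-- The homomorphism `R((∂⁻¹)) → S((∂⁻¹))` induced by a homomorphism of differential rings. -/
def mapHom (φ : R →+* S) (hφ : IsDiffHom φ) : PsiDO R →+* PsiDO S where
  toFun := map φ
  map_zero' := by ext n; simp [coeff_map]
  map_one' := by ext n; simp only [coeff_map, coeff_one]; split_ifs <;> simp
  map_add' a b := by ext n; simp [coeff_map]
  map_mul' a b := by
    ext k
    rw [coeff_map]
    change φ (∑ᶠ x, mulTerm a b k x) = ∑ᶠ x, mulTerm (map φ a) (map φ b) k x
    refine (AddMonoidHom.map_finsum φ.toAddMonoidHom (finite_mulTerm a b k)).trans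
      (finsum_congr fun x => ?_)
    simp only [mulTerm, coeff_map, ← hφ.map_der, RingHom.toAddMonoidHom_eq_coe,
      AddMonoidHom.coe_coe, map_zsmul, map_mul]

variable {hφ : IsDiffHom φ}

theorem coeff_mapHom (a : PsiDO R) (n : ℤ) : (mapHom φ hφ a).coeff n = φ (a.coeff n) := rfl

theorem mapHom_mono (n : ℤ) (x : R) : mapHom φ hφ (mono n x) = mono n (φ x) := by
  ext k
  rw [coeff_mapHom, coeff_mono, coeff_mono, apply_ite φ, map_zero]

theorem mapHom_const (x : R) : mapHom φ hφ (const x) = const (φ x) := mapHom_mono 0 x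

theorem mapHom_D : mapHom φ hφ D = D := by rw [D, mapHom_mono, map_one, D]

theorem IsDiffOp.mapHom {a : PsiDO R} (ha : a.IsDiffOp) : (mapHom φ hφ a).IsDiffOp :=
  fun n hn => by rw [coeff_mapHom, ha n hn, map_zero]

theorem OrdLE.mapHom {a : PsiDO R} {A : ℤ} (ha : a.OrdLE A) : (mapHom φ hφ a).OrdLE A :=
  fun n hn => by rw [coeff_mapHom, ha n hn, map_zero]

end PsiDO

/-! ### Filtered matrices of pseudodifferential operators -/

section Filtration

open PsiDO

variable {R : Type*} [CommRing R] {l m n : Type*}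

/-- The matrix `M` has filtration degree at most `d`, where `∂` has degree `2` and the basis
vectors of the target and of the source have degrees `x` and `y`. -/
def FilLE (x : m → ℤ) (y : n → ℤ) (d : ℤ) (M : Matrix m n (PsiDO R)) : Prop :=
  ∀ a b, (M a b).OrdLE ((d + x a - y b) / 2)

variable {x : l → ℤ} {y : m → ℤ} {z : n → ℤ} {d e : ℤ} {M N : Matrix m n (PsiDO R)}

theorem FilLE.mono (h : FilLE y z d M) (hde : d ≤ e) : FilLE y z e M :=
  fun a b => (h a b).mono (by omega)

theorem FilLE.add (hM : FilLE y z d M) (hN : FilLE y z d N) : FilLE y z d (M + N) :=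
  fun a b => (hM a b).add (hN a b)

theorem FilLE.neg (hM : FilLE y z d M) : FilLE y z d (-M) := fun a b => (hM a b).neg

theorem FilLE.sub (hM : FilLE y z d M) (hN : FilLE y z d N) : FilLE y z d (M - N) :=
  fun a b => (hM a b).sub (hN a b)

theorem FilLE.submatrix {l' n' : Type*} (hM : FilLE y z d M) (u : l' → m) (v : n' → n) :
    FilLE (y ∘ u) (z ∘ v) d (M.submatrix u v) :=
  fun a b => hM (u a) (v b)

theorem FilLE.sum {ι : Type*} {s : Finset ι} {M : ι → Matrix m n (PsiDO R)}
    (h : ∀ i ∈ s, FilLE y z d (M i)) : FilLE y z d (∑ i ∈ s, M i) := fun a b => by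
  rw [Matrix.sum_apply]
  exact OrdLE.sum fun i hi => h i hi a b

theorem FilLE.eq_zero (h : ∀ j : ℕ, FilLE y z (-j) M) : M = 0 := by
  ext a b k
  exact h (y a - z b - 2 * k + 1).toNat a b k (by omega)

theorem filLE_diagonal [DecidableEq m] {z : m → ℤ} {u : m → PsiDO R}
    (h : ∀ a, (u a).OrdLE ((d + y a - z a) / 2)) : FilLE y z d (Matrix.diagonal u) := by
  intro a b
  rcases eq_or_ne a b with rfl | hab
  · rw [Matrix.diagonal_apply_eq]
    exact h a
  · rw [Matrix.diagonal_apply_ne _ hab]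
    exact ordLE_zero _

theorem filLE_one [DecidableEq m] : FilLE y y 0 (1 : Matrix m m (PsiDO R)) :=
  Matrix.diagonal_one (n := m) (α := PsiDO R) ▸
    filLE_diagonal fun _ => ordLE_one.mono (by omega)

variable [Differential R]

theorem FilLE.mul [Fintype m] {M : Matrix l m (PsiDO R)} (hM : FilLE x y d M)
    (hN : FilLE y z e N) : FilLE x z (d + e) (M * N) := fun a b => by
  rw [Matrix.mul_apply]
  exact OrdLE.sum fun c _ => ((hM a c).mul (hN c b)).mono (by omega)

variable [Fintype m] [DecidableEq m] {N : Matrix m m (PsiDO R)}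

theorem FilLE.pow (h : FilLE y y d N) (j : ℕ) : FilLE y y (j * d) (N ^ j) := by
  induction j with
  | zero => simpa using filLE_one
  | succ j ih => exact pow_succ N j ▸ (ih.mul h).mono (by push_cast; linarith)

/-- The geometric series `∑ Nʲ` of a matrix `N` of filtration degree at most `-1`. Only the powers
`Nʲ` with `j ≤ y a - y b - 2k` contribute to the coefficient of `∂ᵏ` in the entry `(a, b)`. -/
def geomSeries (y : m → ℤ) (N : Matrix m m (PsiDO R)) : Matrix m m (PsiDO R) := fun a b =>
  ⟨fun k => ((∑ j ∈ Finset.range (y a - y b - 2 * k + 1).toNat, N ^ j) a b).coeff k,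
    |y a - y b|, fun k hk => by
      have := le_abs_self (y a - y b)
      have := abs_nonneg (y a - y b)
      simp [show (y a - y b - 2 * k + 1).toNat = 0 by omega]⟩

theorem FilLE.geomSeries_sub (h : FilLE y y (-1) N) (J : ℕ) :
    FilLE y y (-J) (geomSeries y N - ∑ j ∈ Finset.range J, N ^ j) := by
  intro a b k hk
  change ((∑ j ∈ Finset.range (y a - y b - 2 * k + 1).toNat, N ^ j) a b).coeff k -
    ((∑ j ∈ Finset.range J, N ^ j) a b).coeff k = 0
  rw [sub_eq_zero]
  simp only [Matrix.sum_apply, coeff_sum]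
  refine Finset.sum_subset (Finset.range_mono (by omega)) fun j _ hj => ?_
  rw [Finset.mem_range, not_lt] at hj
  exact h.pow j a b k (by omega)

theorem filLE_geomSeries (h : FilLE y y (-1) N) : FilLE y y 0 (geomSeries y N) := by
  simpa using h.geomSeries_sub 0

theorem FilLE.mul_geomSeries (h : FilLE y y (-1) N) : (1 - N) * geomSeries y N = 1 := by
  refine sub_eq_zero.1 (FilLE.eq_zero (y := y) (z := y) fun J => ?_)
  have key : (1 - N) * geomSeries y N - 1 =
      (1 - N) * (geomSeries y N - ∑ j ∈ Finset.range J, N ^ j) - N ^ J := by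
    rw [mul_sub, mul_neg_geom_sum]
    abel
  rw [key]
  exact (((filLE_one.sub (h.mono (by omega))).mul (h.geomSeries_sub J)).mono (by omega)).sub
    ((h.pow J).mono (by omega))

theorem FilLE.geomSeries_mul (h : FilLE y y (-1) N) : geomSeries y N * (1 - N) = 1 := by
  refine sub_eq_zero.1 (FilLE.eq_zero (y := y) (z := y) fun J => ?_)
  have key : geomSeries y N * (1 - N) - 1 =
      (geomSeries y N - ∑ j ∈ Finset.range J, N ^ j) * (1 - N) - N ^ J := by
    rw [sub_mul, geom_sum_mul_neg]
    abel
  rw [key]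
  exact (((h.geomSeries_sub J).mul (filLE_one.sub (h.mono (by omega)))).mono (by omega)).sub
    ((h.pow J).mono (by omega))

theorem FilLE.exists_unit_eq_add {x : m → ℤ} {u : (Matrix m m (PsiDO R))ˣ}
    (hu : FilLE y x (-d) u⁻¹.val) (hN : FilLE x y (d - 1) N) :
    ∃ v : (Matrix m m (PsiDO R))ˣ, v.val = u + N ∧ FilLE y x (-d) v⁻¹.val := by
  have h : FilLE y y (-1) (-(u⁻¹.val * N)) := (hu.mul hN).neg.mono (by omega)
  let g : (Matrix m m (PsiDO R))ˣ :=
    ⟨1 - -(u⁻¹.val * N), geomSeries y (-(u⁻¹.val * N)), h.mul_geomSeries, h.geomSeries_mul⟩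
  refine ⟨u * g, ?_, ?_⟩
  · change u.val * (1 - -(u⁻¹.val * N)) = u + N
    rw [sub_neg_eq_add, mul_add, mul_one, Units.mul_inv_cancel_left]
  · rw [mul_inv_rev, Units.val_mul]
    exact ((filLE_geomSeries h).mul hu).mono (by omega)

end Filtration

/-! ### Unitriangular matrices -/

section Unitriangular

theorem exists_ringInverse_one_sub_eq {A : Type*} [Ring A] {N : A} (hN : IsNilpotent N) :
    ∃ J : ℕ, Ring.inverse (1 - N) = ∑ j ∈ Finset.range (J + 1), N ^ j := by
  obtain ⟨J, hJ⟩ := hN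
  have hJ' : N ^ (J + 1) = 0 := by rw [pow_succ, hJ, zero_mul]
  refine ⟨J, ?_⟩
  have h : (1 - N) * ∑ j ∈ Finset.range (J + 1), N ^ j = 1 := by
    rw [mul_neg_geom_sum, hJ', sub_zero]
  rw [← Ring.inverse_mul_cancel_left _ (∑ j ∈ Finset.range (J + 1), N ^ j)
    (IsNilpotent.isUnit_one_sub ⟨J, hJ⟩), h, mul_one]

variable {A B α m : Type*} [Ring A] [Ring B] [Preorder α] [Fintype m]

/-- The strictly triangular matrices with entries in `S`: the entry `(a, b)` vanishes unless
`x b < x a`. -/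
def strictTri (x : m → α) (S : Subring A) : NonUnitalSubring (Matrix m m A) where
  carrier := {N | ∀ a b, N a b ∈ S ∧ (¬x b < x a → N a b = 0)}
  zero_mem' _ _ := ⟨S.zero_mem, fun _ => rfl⟩
  add_mem' hM hN a b := ⟨S.add_mem (hM a b).1 (hN a b).1, fun h => by
    rw [Matrix.add_apply, (hM a b).2 h, (hN a b).2 h, add_zero]⟩
  neg_mem' hM a b := ⟨S.neg_mem (hM a b).1, fun h => by
    rw [Matrix.neg_apply, (hM a b).2 h, neg_zero]⟩
  mul_mem' {M N} hM hN a b := by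
    rw [Matrix.mul_apply]
    refine ⟨S.sum_mem fun c _ => S.mul_mem (hM a c).1 (hN c b).1, fun h => ?_⟩
    refine Finset.sum_eq_zero fun c _ => ?_
    by_cases hac : x c < x a
    · rw [(hN c b).2 fun hcb => h (hcb.trans hac), mul_zero]
    · rw [(hM a c).2 hac, zero_mul]

variable {x : m → α} {S : Subring A} {S' : Subring B} {M N : Matrix m m A}

variable [DecidableEq m]

theorem pow_apply_eq_zero_of_mem_strictTri (hN : N ∈ strictTri x S) (j : ℕ) (a b : m)
    (h : {c | x c < x a}.ncard < j) : (N ^ j) a b = 0 := by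
  induction j generalizing a with
  | zero => exact absurd h (Nat.not_lt_zero _)
  | succ j ih =>
    rw [pow_succ', Matrix.mul_apply]
    refine Finset.sum_eq_zero fun c _ => ?_
    by_cases hac : x c < x a
    · have hlt : {d | x d < x c}.ncard < {d | x d < x a}.ncard :=
        Set.ncard_lt_ncard (Set.ssubset_iff_of_subset (fun d hd => hd.trans hac) |>.2
          ⟨c, hac, lt_irrefl (x c)⟩) (Set.toFinite _)
      rw [ih c (by omega), mul_zero]
    · rw [(hN a c).2 hac, zero_mul]

theorem isNilpotent_of_mem_strictTri (hN : N ∈ strictTri x S) : IsNilpotent N := by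
  refine ⟨Nat.card m + 1, Matrix.ext fun a b => ?_⟩
  exact pow_apply_eq_zero_of_mem_strictTri hN _ a b (Nat.lt_succ_of_le (Set.ncard_le_card _))

theorem pow_succ_mem_strictTri (hN : N ∈ strictTri x S) (j : ℕ) : N ^ (j + 1) ∈ strictTri x S := by
  induction j with
  | zero => rwa [zero_add, pow_one]
  | succ j ih => exact pow_succ N (j + 1) ▸ mul_mem ih hN

/-- The monoid of unitriangular matrices with entries in `S`. -/
def unitri (x : m → α) (S : Subring A) : Submonoid (Matrix m m A) where
  carrier := {M | M - 1 ∈ strictTri x S}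
  one_mem' := by
    rw [Set.mem_ofPred_eq, sub_self]
    exact zero_mem _
  mul_mem' {M N} hM hN := by
    have h : M * N - 1 = (M - 1) + (N - 1) + (M - 1) * (N - 1) := by noncomm_ring
    rw [Set.mem_ofPred_eq, h]
    exact add_mem (add_mem hM hN) (mul_mem hM hN)

theorem mem_unitri : M ∈ unitri x S ↔ M - 1 ∈ strictTri x S := Iff.rfl

theorem one_sub_mem_unitri (hN : N ∈ strictTri x S) : 1 - N ∈ unitri x S := by
  rw [mem_unitri, sub_sub_cancel_left]
  exact neg_mem hN

theorem mem_matrix_of_mem_unitri (hM : M ∈ unitri x S) : M ∈ S.matrix := by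
  rw [← sub_add_cancel M 1]
  exact add_mem (fun a b => (hM a b).1) (one_mem S.matrix)

theorem isUnit_of_mem_unitri (hM : M ∈ unitri x S) : IsUnit M := by
  have hN : 1 - M ∈ strictTri x S := neg_sub M 1 ▸ neg_mem (mem_unitri.1 hM)
  rw [← sub_sub_cancel 1 M]
  exact (isNilpotent_of_mem_strictTri hN).isUnit_one_sub

theorem ringInverse_mem_unitri (hM : M ∈ unitri x S) : Ring.inverse M ∈ unitri x S := by
  have hN : 1 - M ∈ strictTri x S := neg_sub M 1 ▸ neg_mem (mem_unitri.1 hM)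
  obtain ⟨J, hJ⟩ := exists_ringInverse_one_sub_eq (isNilpotent_of_mem_strictTri hN)
  rw [sub_sub_cancel] at hJ
  rw [mem_unitri, hJ, Finset.sum_range_succ', pow_zero, add_sub_cancel_right]
  exact sum_mem fun j _ => pow_succ_mem_strictTri hN j

theorem submatrix_mem_unitri {l : Type*} [Fintype l] [DecidableEq l] (hM : M ∈ unitri x S)
    {u : l → m} (hu : Function.Injective u) : M.submatrix u u ∈ unitri (x ∘ u) S := by
  rw [mem_unitri, ← Matrix.submatrix_one u hu]
  exact fun a b => hM (u a) (u b)

theorem map_mem_unitri (hM : M ∈ unitri x S) {φ : A →+* B} (hφ : ∀ s ∈ S, φ s ∈ S') :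
    M.map φ ∈ unitri x S' := by
  have h : M.map φ - 1 = (M - 1).map φ := by
    rw [Matrix.map_sub φ (map_sub φ), Matrix.map_one φ (map_zero φ) (map_one φ)]
  rw [mem_unitri, h]
  exact fun a b => ⟨hφ _ (hM a b).1, fun hab => by rw [Matrix.map_apply, (hM a b).2 hab, map_zero]⟩

end Unitriangular

/-! ### Reduced matrix differential operators -/

section Reduced

open PsiDO Matrix

variable {R S : Type*} [CommRing R] [Differential R] [CommRing S] [Differential S]
variable {m : Type*} [Fintype m] [DecidableEq m] {p : m → ℕ}

/-- Equivalence of matrices under multiplication by unitriangular matrix differential operators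
on both sides, with opposite triangularity on the left and on the right. -/
def UnitriEquiv (p : m → ℕ) (T T' : Matrix m m (PsiDO R)) : Prop :=
  ∃ E ∈ unitri p (diffOps R), ∃ F ∈ unitri (toDual ∘ p) (diffOps R), E * T * F = T'

namespace UnitriEquiv

variable {T T' T'' : Matrix m m (PsiDO R)}

theorem refl (p : m → ℕ) (T : Matrix m m (PsiDO R)) : UnitriEquiv p T T :=
  ⟨1, one_mem _, 1, one_mem _, by rw [one_mul, mul_one]⟩

theorem symm (h : UnitriEquiv p T T') : UnitriEquiv p T' T := by
  obtain ⟨E, hE, F, hF, rfl⟩ := h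
  refine ⟨_, ringInverse_mem_unitri hE, _, ringInverse_mem_unitri hF, ?_⟩
  rw [mul_assoc E, Ring.inverse_mul_cancel_left _ _ (isUnit_of_mem_unitri hE), mul_assoc,
    Ring.mul_inverse_cancel _ (isUnit_of_mem_unitri hF), mul_one]

theorem trans (h : UnitriEquiv p T T') (h' : UnitriEquiv p T' T'') : UnitriEquiv p T T'' := by
  obtain ⟨E, hE, F, hF, rfl⟩ := h
  obtain ⟨E', hE', F', hF', rfl⟩ := h'
  exact ⟨E' * E, mul_mem hE' hE, F * F', mul_mem hF hF', by noncomm_ring⟩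

theorem map (h : UnitriEquiv p T T') {φ : R →+* S} (hφ : IsDiffHom φ) :
    UnitriEquiv p (T.map (mapHom φ hφ)) (T'.map (mapHom φ hφ)) := by
  have hmap : ∀ a ∈ diffOps R, mapHom φ hφ a ∈ diffOps S := fun _ ha => IsDiffOp.mapHom ha
  obtain ⟨E, hE, F, hF, rfl⟩ := h
  exact ⟨_, map_mem_unitri hE hmap, _, map_mem_unitri hF hmap, by
    rw [Matrix.map_mul, Matrix.map_mul]⟩

end UnitriEquiv

/-- The diagonal matrix `-(-∂)^p`, as a unit. -/
def topUnit (R : Type*) [CommRing R] [Differential R] (p : m → ℕ) : (Matrix m m (PsiDO R))ˣ :=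
  Units.map (Matrix.diagonalRingHom m (PsiDO R))
    (MulEquiv.piUnits.symm fun a => -(-unitD R) ^ p a)

theorem val_topUnit : (topUnit R p).val = Matrix.diagonal fun a => -(-D) ^ p a := rfl

theorem topUnit_mem_matrix_diffOps : (topUnit R p).val ∈ (diffOps R).matrix := fun a b => by
  rw [val_topUnit, Matrix.diagonal_apply]
  split_ifs
  exacts [neg_mem (S := Subring _) (isDiffOp_neg_D_pow _), zero_mem _]

theorem map_topUnit {φ : R →+* S} (hφ : IsDiffHom φ) :
    (topUnit R p).val.map (mapHom φ hφ) = topUnit S p := by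
  rw [val_topUnit, val_topUnit, Matrix.diagonal_map (map_zero _)]
  simp only [map_neg, map_pow, mapHom_D]

/-- `W` equals `-(-∂)^p` up to terms of order less than `min (p a) (p b)`. -/
def Reduced (p : m → ℕ) (W : Matrix m m (PsiDO R)) : Prop :=
  ∀ a b, ((W - (topUnit R p).val) a b).OrdLE (min (p a) (p b) - 1)

namespace Reduced

variable {W W₁ W₂ E G : Matrix m m (PsiDO R)} {N : m → PsiDO R} {q : ℕ}

theorem map (h : Reduced p W) {φ : R →+* S} (hφ : IsDiffHom φ) :
    Reduced p (W.map (mapHom φ hφ)) := fun a b => by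
  rw [← map_topUnit hφ, ← Matrix.map_sub _ (map_sub _)]
  exact (h a b).mapHom (hφ := hφ)

theorem row_eq_zero (hW : Reduced p W) (hN : ∀ b, (N b).IsDiffOp)
    (h0 : ∀ b, ¬p b < q → N b = 0) (h : ∀ b, p b < q → ((N ᵥ* W) b).OrdLE (p b - 1)) : N = 0 := by
  obtain ⟨j, hj⟩ := exists_nat_forall_ordLE N
  induction j with
  | zero => exact funext fun b => (hN b).eq_zero (by simpa using hj b)
  | succ j ih =>
    refine ih fun b => ?_
    by_cases hb : p b < q
    · have key : N b =
          ((N ᵥ* W) b - (N ᵥ* (W - (topUnit R p).val)) b) * ((-(-unitD R) ^ p b)⁻¹).val := by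
        rw [Units.eq_mul_inv_iff_mul_eq, Matrix.vecMul_sub, Pi.sub_apply, sub_sub_cancel,
          val_topUnit, Matrix.vecMul_diagonal]
        rfl
      have low : ((N ᵥ* (W - (topUnit R p).val)) b).OrdLE (j + p b - 1) :=
        OrdLE.sum fun c _ => ((hj c).mul (hW c b)).mono (by push_cast; omega)
      rw [key]
      exact ((((h b hb).mono (by omega)).sub low).mul (ordLE_inv_neg_unitD_pow _)).mono (by omega)
    · rw [h0 b hb]
      exact ordLE_zero _

theorem col_eq_zero (hW : Reduced p W) (hN : ∀ b, (N b).IsDiffOp)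
    (h0 : ∀ b, ¬p b < q → N b = 0) (h : ∀ b, p b < q → ((W *ᵥ N) b).OrdLE (p b - 1)) : N = 0 := by
  obtain ⟨j, hj⟩ := exists_nat_forall_ordLE N
  induction j with
  | zero => exact funext fun b => (hN b).eq_zero (by simpa using hj b)
  | succ j ih =>
    refine ih fun b => ?_
    by_cases hb : p b < q
    · have key : N b =
          ((-(-unitD R) ^ p b)⁻¹).val * ((W *ᵥ N) b - ((W - (topUnit R p).val) *ᵥ N) b) := by
        rw [Units.eq_inv_mul_iff_mul_eq, Matrix.sub_mulVec, Pi.sub_apply, sub_sub_cancel,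
          val_topUnit, Matrix.mulVec_diagonal]
        rfl
      have low : (((W - (topUnit R p).val) *ᵥ N) b).OrdLE (j + p b - 1) :=
        OrdLE.sum fun c _ => ((hW b c).mul (hj c)).mono (by push_cast; omega)
      rw [key]
      exact ((ordLE_inv_neg_unitD_pow _).mul (((h b hb).mono (by omega)).sub low)).mono (by omega)
    · rw [h0 b hb]
      exact ordLE_zero _

theorem ordLE_sub (h₁ : Reduced p W₁) (h₂ : Reduced p W₂) (a b : m) :
    ((W₂ - W₁) a b).OrdLE (min (p a) (p b) - 1) := by
  rw [← sub_sub_sub_cancel_right W₂ W₁ (topUnit R p).val]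
  exact (h₂ a b).sub (h₁ a b)

/-- By induction on `q`, rows of `E - 1` and columns of `G - 1` with `p a = q` vanish: all rows and
columns with smaller `p` are already known to be zero. -/
theorem sub_one_eq_zero (h₁ : Reduced p W₁) (h₂ : Reduced p W₂)
    (hE : E ∈ unitri p (diffOps R)) (hG : G ∈ unitri (toDual ∘ p) (diffOps R))
    (h : E * W₁ = W₂ * G) (q : ℕ) :
    ∀ a, p a = q → (E - 1).row a = 0 ∧ (G - 1).col a = 0 := by
  have hEG : (E - 1) * W₁ = W₂ - W₁ + W₂ * (G - 1) := by
    rw [sub_mul, h]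
    noncomm_ring
  have hGE : W₂ * (G - 1) = (E - 1) * W₁ - (W₂ - W₁) := by rw [hEG, add_sub_cancel_left]
  induction q using Nat.strong_induction_on with
  | _ q ih =>
    rintro a rfl
    refine ⟨h₁.row_eq_zero (fun b => (hE a b).1) (fun b => (hE a b).2) fun b hb => ?_,
      h₂.col_eq_zero (fun b => (hG b a).1) (fun b => (hG b a).2) fun b hb => ?_⟩
    · have e : (W₂ * (G - 1)) a b = 0 := by
        change W₂ a ⬝ᵥ (G - 1).col b = 0
        rw [(ih _ hb b rfl).2, dotProduct_zero]
      change (((E - 1) * W₁) a b).OrdLE _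
      rw [hEG, Matrix.add_apply, e, add_zero]
      exact (h₁.ordLE_sub h₂ a b).mono (by omega)
    · have e : ((E - 1) * W₁) b a = 0 := by
        change (E - 1).row b ⬝ᵥ W₁.col a = 0
        rw [(ih _ hb b rfl).1, zero_dotProduct]
      change ((W₂ * (G - 1)) b a).OrdLE _
      rw [hGE, Matrix.sub_apply, e, zero_sub]
      exact ((h₁.ordLE_sub h₂ b a).mono (by omega)).neg

theorem eq_of_unitriEquiv (h₁ : Reduced p W₁) (h₂ : Reduced p W₂) (h : UnitriEquiv p W₁ W₂) :
    W₁ = W₂ := by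
  obtain ⟨E, hE, F, hF, hEF⟩ := h
  have hEG : E * W₁ = W₂ * Ring.inverse F := by
    rw [← hEF, mul_assoc _ F, Ring.mul_inverse_cancel _ (isUnit_of_mem_unitri hF), mul_one]
  have hzero := fun a => h₁.sub_one_eq_zero h₂ hE (ringInverse_mem_unitri hF) hEG (p a) a rfl
  have hE1 : E = 1 := sub_eq_zero.1 (Matrix.ext fun a => congrFun (hzero a).1)
  have hG1 : Ring.inverse F = 1 := sub_eq_zero.1 (Matrix.ext fun b a => congrFun (hzero a).2 b)
  rw [← one_mul W₁, ← hE1, hEG, hG1, mul_one]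

end Reduced

end Reduced

/-! ### The quasideterminant `T(∂)` -/

section Selection

variable {A B : Type*} [Ring A] [Ring B] {l m n : Type*} [DecidableEq n]

/-- The inclusion of the span of the basis vectors with indices `u a`. -/
def selR (A : Type*) [Ring A] (u : m → n) : Matrix n m A := (1 : Matrix n n A).submatrix id u

/-- The coordinate projection onto the span of the basis vectors with indices `u a`. -/
def selL (A : Type*) [Ring A] (u : m → n) : Matrix m n A := (1 : Matrix n n A).submatrix u id

theorem selR_map (φ : A →+* B) (u : m → n) : (selR A u).map φ = selR B u := by
  rw [selR, ← Matrix.submatrix_map, Matrix.map_one φ (map_zero φ) (map_one φ), selR]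

theorem selL_map (φ : A →+* B) (u : m → n) : (selL A u).map φ = selL B u := by
  rw [selL, ← Matrix.submatrix_map, Matrix.map_one φ (map_zero φ) (map_one φ), selL]

theorem selL_mul_selR [Fintype n] [DecidableEq m] {u : m → n} (hu : Function.Injective u) :
    selL A u * selR A u = 1 :=
  (Matrix.submatrix_mul_equiv (1 : Matrix n n A) 1 u (Equiv.refl n) u).trans
    (by rw [mul_one, Matrix.submatrix_one u hu])

theorem mul_selR [Fintype n] (M : Matrix l n A) (u : m → n) : M * selR A u = M.submatrix id u :=
  (Matrix.submatrix_mul_equiv M 1 id (Equiv.refl n) u).trans (by rw [Matrix.mul_one])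

theorem selL_mul [Fintype n] (M : Matrix n l A) (u : m → n) : selL A u * M = M.submatrix u id :=
  (Matrix.submatrix_mul_equiv 1 M u (Equiv.refl n) id).trans (by rw [Matrix.one_mul])

theorem selL_mul_mul_selR [Fintype n] (M : Matrix n n A) (w : l → n) (u : m → n) :
    selL A w * M * selR A u = M.submatrix w u := by
  rw [mul_selR, selL_mul, Matrix.submatrix_submatrix, Function.comp_id, Function.id_comp]

theorem selR_mul_selL_apply [Fintype m] [Finite n] {u : m → n} (hu : Function.Injective u)
    (x y : n) [Decidable (x ∈ Set.range u)] :
    (selR A u * selL A u) x y = if x ∈ Set.range u then (1 : Matrix n n A) x y else 0 := by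
  classical
  have := Fintype.ofFinite n
  split_ifs with hx
  · obtain ⟨a, rfl⟩ := hx
    have h : (selR A u * selL A u).submatrix u id = selL A u := by
      rw [← selL_mul, ← Matrix.mul_assoc, selL_mul_selR hu, Matrix.one_mul]
    exact congrFun₂ h a y
  · refine Finset.sum_eq_zero fun a _ => ?_
    have h : selR A u x a = 0 := Matrix.one_apply_ne fun h => hx ⟨a, h.symm⟩
    exact mul_eq_zero_of_left h _

theorem quasidetExists_and_eq [Fintype n] [Fintype m] [DecidableEq m] {M : Matrix n n A}
    {u w : m → n} {X : Matrix n m A} {Y : Matrix m n A} {T T' : Matrix m m A} (hM : IsUnit M)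
    (hX : M * X = selR A u * T) (hwX : selL A w * X = 1)
    (hY : Y * M = T' * selL A w) (hYu : Y * selR A u = 1) :
    QuasidetExists M u w ∧ quasidet M u w = T ∧ quasidet M u w = T' := by
  have hB : (Ring.inverse M).submatrix w u = selL A w * Ring.inverse M * selR A u :=
    (selL_mul_mul_selR _ w u).symm
  have hT' : T' * (Ring.inverse M).submatrix w u = 1 := by
    rw [hB, ← Matrix.mul_assoc, ← Matrix.mul_assoc, ← hY, Matrix.mul_assoc Y,
      Ring.mul_inverse_cancel _ hM, Matrix.mul_one, hYu]
  have hT : (Ring.inverse M).submatrix w u * T = 1 := by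
    rw [hB, Matrix.mul_assoc, ← hX, Matrix.mul_assoc, ← Matrix.mul_assoc (Ring.inverse M),
      Ring.inverse_mul_cancel _ hM, Matrix.one_mul, hwX]
  obtain rfl : T' = T := left_inv_eq_right_inv hT' hT
  have h := Ring.inverse_unit ⟨_, T', hT, hT'⟩
  exact ⟨⟨hM, ⟨_, T', hT, hT'⟩, rfl⟩, h, h⟩

end Selection

namespace Pyramid

open PsiDO

variable {r : ℕ} (P : Pyramid r)

/-- Twice the eigenvalue of `χ`. -/
def ht (x : P.Box) : ℤ := (P.part x.1 : ℤ) - 1 - 2 * ((x.2 : ℕ) : ℤ)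

theorem deg_eq (x : P.Box × P.Box) : P.deg x = ((P.ht x.1 - P.ht x.2 : ℤ) : ℚ) / 2 := by
  simp only [deg, chi, ht]
  push_cast
  ring

theorem deg_le_iff (x : P.Box × P.Box) : P.deg x ≤ 1 / 2 ↔ P.ht x.1 - P.ht x.2 ≤ 1 := by
  rw [deg_eq, div_le_div_iff_of_pos_right (by norm_num)]
  exact_mod_cast Iff.rfl

theorem le_deg_iff (x : P.Box × P.Box) : 1 / 2 ≤ P.deg x ↔ 1 ≤ P.ht x.1 - P.ht x.2 := by
  rw [deg_eq, div_le_div_iff_of_pos_right (by norm_num)]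
  exact_mod_cast Iff.rfl

theorem box_ext {x y : P.Box} (h1 : x.1 = y.1) (h2 : (x.2 : ℕ) = y.2) : x = y := by
  obtain ⟨a, i⟩ := x
  obtain ⟨b, j⟩ := y
  obtain rfl : a = b := h1
  obtain rfl : i = j := Fin.ext h2
  rfl

theorem firstBox_injective : Function.Injective P.firstBox := fun _ _ h => congrArg Sigma.fst h

theorem lastBox_injective : Function.Injective P.lastBox := fun _ _ h => congrArg Sigma.fst h

theorem mem_range_firstBox (x : P.Box) : x ∈ Set.range P.firstBox ↔ ¬0 < (x.2 : ℕ) := by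
  refine ⟨?_, fun h => ⟨x.1, P.box_ext rfl (by simp only [firstBox]; omega)⟩⟩
  rintro ⟨a, rfl⟩
  exact lt_irrefl 0

theorem mem_range_lastBox (x : P.Box) :
    x ∈ Set.range P.lastBox ↔ ¬(x.2 : ℕ) + 1 < P.part x.1 := by
  refine ⟨?_, fun h => ⟨x.1, P.box_ext rfl (by have := x.2.2; simp only [lastBox]; omega)⟩⟩
  rintro ⟨a, rfl⟩
  have := P.pos a
  simp only [lastBox]
  omega

theorem ht_firstBox (a : Fin r) : P.ht (P.firstBox a) = P.part a - 1 := by simp [ht, firstBox]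

theorem ht_lastBox (a : Fin r) : P.ht (P.lastBox a) = 1 - P.part a := by
  have := P.pos a
  simp only [ht, lastBox]
  omega

/-- The box after `x` in its row. -/
def next (x : P.Box) (h : (x.2 : ℕ) + 1 < P.part x.1) : P.Box := ⟨x.1, ⟨(x.2 : ℕ) + 1, h⟩⟩

/-- The box before `x` in its row; a first box is its own predecessor. -/
def prev (x : P.Box) : P.Box := ⟨x.1, ⟨(x.2 : ℕ) - 1, by have := x.2.2; omega⟩⟩

theorem ht_next (x : P.Box) (h : (x.2 : ℕ) + 1 < P.part x.1) : P.ht (P.next x h) = P.ht x - 2 := by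
  simp only [ht, next]
  push_cast
  ring

theorem ht_prev {x : P.Box} (h : 0 < (x.2 : ℕ)) : P.ht (P.prev x) = P.ht x + 2 := by
  simp only [ht, prev]
  omega

theorem prev_next (x : P.Box) (h : (x.2 : ℕ) + 1 < P.part x.1) : P.prev (P.next x h) = x := rfl

theorem next_prev {x : P.Box} (h : 0 < (x.2 : ℕ))
    (h' : ((P.prev x).2 : ℕ) + 1 < P.part (P.prev x).1) : P.next (P.prev x) h' = x :=
  P.box_ext rfl (by simp only [next, prev]; omega)

theorem prev_lt {x : P.Box} (h : 0 < (x.2 : ℕ)) :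
    ((P.prev x).2 : ℕ) + 1 < P.part (P.prev x).1 := by
  have := x.2.2
  simp only [prev]
  omega

section Shift

variable {A : Type*} [Ring A] {l : Type*}

/-- The partial bijection of the boxes that moves each box to the next one in its row. -/
def shift : P.Box ≃. P.Box where
  toFun x := if h : (x.2 : ℕ) + 1 < P.part x.1 then some (P.next x h) else none
  invFun x := if 0 < (x.2 : ℕ) then some (P.prev x) else none
  inv x y := by
    simp only [Option.ite_none_right_eq_some, Option.dite_none_right_eq_some,
      Option.some.injEq]
    constructor
    · rintro ⟨h, rfl⟩
      exact ⟨P.prev_lt h, P.next_prev h _⟩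
    · rintro ⟨h, rfl⟩
      exact ⟨Nat.succ_pos _, P.prev_next x h⟩

theorem shift_apply (x : P.Box) : P.shift x =
    if h : (x.2 : ℕ) + 1 < P.part x.1 then some (P.next x h) else none := rfl

theorem shift_symm_apply (x : P.Box) :
    P.shift.symm x = if 0 < (x.2 : ℕ) then some (P.prev x) else none := rfl

/-- The nilpotent matrix `f` over a ring `A`. -/
def shiftF (A : Type*) [Ring A] : Matrix P.Box P.Box A := P.shift.symm.toMatrix

/-- The transpose of `f`. -/
def shiftE (A : Type*) [Ring A] : Matrix P.Box P.Box A := P.shift.toMatrix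

theorem shiftE_mul (N : Matrix P.Box l A) (x : P.Box) (y : l) : (P.shiftE A * N) x y =
    if h : (x.2 : ℕ) + 1 < P.part x.1 then N (P.next x h) y else 0 := by
  rw [shiftE, PEquiv.toMatrix_mul_apply, shift_apply]
  split_ifs <;> rfl

theorem shiftF_mul (N : Matrix P.Box l A) (x : P.Box) (y : l) : (P.shiftF A * N) x y =
    if 0 < (x.2 : ℕ) then N (P.prev x) y else 0 := by
  rw [shiftF, PEquiv.toMatrix_mul_apply, shift_symm_apply]
  split_ifs <;> rfl

theorem mul_shiftE (N : Matrix l P.Box A) (x : l) (y : P.Box) : (N * P.shiftE A) x y =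
    if 0 < (y.2 : ℕ) then N x (P.prev y) else 0 := by
  rw [shiftE, PEquiv.mul_toMatrix_apply, shift_symm_apply]
  split_ifs <;> rfl

theorem mul_shiftF (N : Matrix l P.Box A) (x : l) (y : P.Box) : (N * P.shiftF A) x y =
    if h : (y.2 : ℕ) + 1 < P.part y.1 then N x (P.next y h) else 0 := by
  rw [shiftF, PEquiv.mul_toMatrix_apply, PEquiv.symm_symm, shift_apply]
  split_ifs <;> rfl

theorem shiftF_apply (x y : P.Box) : P.shiftF A x y =
    if x.1 = y.1 ∧ (x.2 : ℕ) = (y.2 : ℕ) + 1 then 1 else 0 := by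
  rw [shiftF, PEquiv.toMatrix_apply]
  refine if_congr (P.shift.mem_iff_mem.trans ?_) rfl rfl
  simp only [shift_apply, Option.mem_def, Option.dite_none_right_eq_some, Option.some.injEq]
  constructor
  · rintro ⟨h, rfl⟩
    exact ⟨rfl, rfl⟩
  · rintro ⟨h1, h2⟩
    have hx := x.2.2
    rw [h2, h1] at hx
    exact ⟨hx, P.box_ext h1.symm h2.symm⟩

theorem shiftE_mul_shiftF :
    P.shiftE A * P.shiftF A = 1 - selR A P.lastBox * selL A P.lastBox := by
  classical
  have h : P.shiftE A * (P.shiftF A * 1) = 1 - selR A P.lastBox * selL A P.lastBox := by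
    ext1 x y
    rw [shiftE_mul, Matrix.sub_apply, selR_mul_selL_apply P.lastBox_injective,
      if_congr (P.mem_range_lastBox x) rfl rfl]
    by_cases h : (x.2 : ℕ) + 1 < P.part x.1
    · rw [dif_pos h, shiftF_mul, if_pos (by exact Nat.succ_pos _), prev_next,
        if_neg (not_not_intro h), sub_zero]
    · rw [dif_neg h, if_pos h, sub_self]
  rwa [Matrix.mul_one] at h

theorem shiftF_mul_shiftE :
    P.shiftF A * P.shiftE A = 1 - selR A P.firstBox * selL A P.firstBox := by
  classical
  have h : P.shiftF A * (P.shiftE A * 1) = 1 - selR A P.firstBox * selL A P.firstBox := by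
    ext1 x y
    rw [shiftF_mul, Matrix.sub_apply, selR_mul_selL_apply P.firstBox_injective,
      if_congr (P.mem_range_firstBox x) rfl rfl]
    by_cases h : 0 < (x.2 : ℕ)
    · rw [if_pos h, shiftE_mul, dif_pos (P.prev_lt h), P.next_prev h, if_neg (not_not_intro h),
        sub_zero]
    · rw [if_neg h, if_pos h, sub_self]
  rwa [Matrix.mul_one] at h

theorem selL_last_mul_shiftE : selL A P.lastBox * P.shiftE A = 0 := by
  ext a x
  rw [← Matrix.mul_one (P.shiftE A), selL_mul, Matrix.submatrix_apply, shiftE_mul, dif_neg]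
  · rfl
  · exact (P.mem_range_lastBox _).1 ⟨a, rfl⟩

theorem shiftE_mul_selR_first : P.shiftE A * selR A P.firstBox = 0 := by
  ext x a
  rw [← Matrix.one_mul (P.shiftE A), mul_selR, Matrix.submatrix_apply, mul_shiftE, if_neg]
  · rfl
  · exact (P.mem_range_firstBox _).1 ⟨a, rfl⟩

theorem eq_selR_first_mul_of_shiftE_mul_eq_zero {Z : Matrix P.Box l A} (h : P.shiftE A * Z = 0) :
    Z = selR A P.firstBox * (selL A P.firstBox * Z) := by
  rw [← Matrix.mul_assoc, ← sub_sub_cancel 1 (selR A P.firstBox * _), ← shiftF_mul_shiftE,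
    Matrix.sub_mul, Matrix.one_mul, Matrix.mul_assoc, h, Matrix.mul_zero, sub_zero]

theorem eq_mul_selL_last_of_mul_shiftE_eq_zero {Z : Matrix l P.Box A} (h : Z * P.shiftE A = 0) :
    Z = Z * selR A P.lastBox * selL A P.lastBox := by
  rw [Matrix.mul_assoc, ← sub_sub_cancel 1 (selR A P.lastBox * _), ← shiftE_mul_shiftF,
    Matrix.mul_sub, Matrix.mul_one, ← Matrix.mul_assoc, h, Matrix.zero_mul, sub_zero]

variable {N G : Matrix P.Box P.Box A}

theorem selL_last_mul_of_inverse (h : (1 + P.shiftE A * N) * G = 1) :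
    selL A P.lastBox * G = selL A P.lastBox := by
  calc selL A P.lastBox * G = selL A P.lastBox * (1 + P.shiftE A * N) * G := by
        rw [Matrix.mul_add, ← Matrix.mul_assoc _ (P.shiftE A), selL_last_mul_shiftE,
          Matrix.zero_mul, add_zero, Matrix.mul_one]
    _ = selL A P.lastBox := by rw [Matrix.mul_assoc, h, Matrix.mul_one]

theorem mul_selR_first_of_inverse (h : G * (1 + N * P.shiftE A) = 1) :
    G * selR A P.firstBox = selR A P.firstBox := by
  calc G * selR A P.firstBox = G * ((1 + N * P.shiftE A) * selR A P.firstBox) := by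
        rw [Matrix.add_mul, Matrix.mul_assoc _ (P.shiftE A), shiftE_mul_selR_first,
          Matrix.mul_zero, add_zero, Matrix.one_mul]
    _ = selR A P.firstBox := by rw [← Matrix.mul_assoc, h, Matrix.one_mul]

theorem shiftF_add_mul_of_inverse (h : (1 + P.shiftE A * N) * G = 1) :
    (P.shiftF A + N) * (G * selR A P.lastBox) = selR A P.firstBox *
      (selL A P.firstBox * ((P.shiftF A + N) * (G * selR A P.lastBox))) := by
  refine P.eq_selR_first_mul_of_shiftE_mul_eq_zero ?_
  have hEF : P.shiftE A * (P.shiftF A + N) =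
      1 + P.shiftE A * N - selR A P.lastBox * selL A P.lastBox := by
    rw [Matrix.mul_add, shiftE_mul_shiftF]
    abel
  rw [← Matrix.mul_assoc, hEF, ← Matrix.mul_assoc, Matrix.sub_mul, h, Matrix.mul_assoc _ _ G,
    P.selL_last_mul_of_inverse h, Matrix.sub_mul, Matrix.one_mul, Matrix.mul_assoc,
    selL_mul_selR P.lastBox_injective, Matrix.mul_one, sub_self]

theorem mul_shiftF_add_of_inverse (h : G * (1 + N * P.shiftE A) = 1) :
    selL A P.firstBox * G * (P.shiftF A + N) =
      selL A P.firstBox * G * (P.shiftF A + N) * selR A P.lastBox * selL A P.lastBox := by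
  refine P.eq_mul_selL_last_of_mul_shiftE_eq_zero ?_
  have hFE : (P.shiftF A + N) * P.shiftE A =
      1 + N * P.shiftE A - selR A P.firstBox * selL A P.firstBox := by
    rw [Matrix.add_mul, shiftF_mul_shiftE]
    abel
  rw [Matrix.mul_assoc, hFE, Matrix.mul_assoc, Matrix.mul_sub, h, ← Matrix.mul_assoc G,
    P.mul_selR_first_of_inverse h, Matrix.mul_sub, Matrix.mul_one, ← Matrix.mul_assoc,
    selL_mul_selR P.firstBox_injective, Matrix.one_mul, sub_self]

end Shift

end Pyramid

theorem emb_matUnit {n : Type*} [Fintype n] [DecidableEq n] (x : n × n) :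
    emb (matUnit x) = MvPolynomial.X (x, 0) := by
  rw [emb, Finset.sum_eq_single x]
  · simp [matUnit]
  · intro y _ hy
    rw [matUnit, Matrix.single_apply, if_neg, map_zero, zero_mul]
    rintro ⟨h1, h2⟩
    exact hy (Prod.ext h1.symm h2.symm)
  · simp

theorem trace_mul_matUnit {n : Type*} [Fintype n] [DecidableEq n] (a : Matrix n n ℂ) (x : n × n) :
    (a * matUnit x).trace = a x.2 x.1 := by
  rw [matUnit, Matrix.trace_mul_single]
  simp

namespace Pyramid

open PsiDO

variable {r : ℕ} (P : Pyramid r)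

/-- The generic element of `g_{≥ -1/2}`. -/
def genQ : Matrix P.Box P.Box P.Vle := Matrix.of fun x y =>
  if h : P.deg (y, x) ≤ 1 / 2 then MvPolynomial.X (⟨(y, x), h⟩, 0) else 0

theorem genQ_apply (x y : P.Box) : P.genQ x y =
  if h : P.deg (y, x) ≤ 1 / 2 then MvPolynomial.X (⟨(y, x), h⟩, 0) else 0 := rfl

theorem genQ_eq_zero {x y : P.Box} (h : P.ht x + 1 < P.ht y) : P.genQ x y = 0 := by
  rw [genQ_apply, dif_neg]
  rw [deg_le_iff]
  simp only
  omega

theorem rho_X_zero (x : P.Box × P.Box) : P.rho (MvPolynomial.X (x, 0)) =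
    P.genQ x.2 x.1 + MvPolynomial.C (P.nilp x.2 x.1) := by
  rw [rho, MvPolynomial.aeval_X, if_pos rfl, trace_mul_matUnit]
  rfl

theorem nilp_eq_shiftF : P.nilp = P.shiftF ℂ :=
  Matrix.ext fun x y => (P.shiftF_apply x y).symm

/-- `∂ + Q`, where `Q` is the generic element of `g_{≥ -1/2}`. -/
def dQ : Matrix P.Box P.Box (PsiDO P.Vle) :=
  Matrix.diagonal (fun _ => D) + P.genQ.map const

theorem dQ_apply (x y : P.Box) :
    P.dQ x y = (if x = y then D else 0) + const (P.genQ x y) := by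
  rw [dQ, Matrix.add_apply, Matrix.diagonal_apply, Matrix.map_apply]

theorem dQ_eq_zero {x y : P.Box} (h : P.ht x + 1 < P.ht y) : P.dQ x y = 0 := by
  rw [dQ_apply, P.genQ_eq_zero h, if_neg (by rintro rfl; omega), const_zero, add_zero]

theorem rhoA_eq : P.rhoA = P.shiftF (PsiDO P.Vle) + P.dQ := by
  ext1 x y
  have h : P.rhoA x y = PsiDO.map P.rho.toRingHom ((if x = y then D else 0) +
    const (emb (matUnit (y, x)))) := rfl
  rw [h, Matrix.add_apply, dQ_apply, emb_matUnit, shiftF_apply]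
  ext n
  simp only [coeff_map, coeff_add, AlgHom.toRingHom_eq_coe, RingHom.coe_coe, map_add, const,
    coeff_mono, apply_ite (fun a => PsiDO.coeff a n), apply_ite P.rho, P.rho_X_zero, coeff_zero, D,
    coeff_one, map_one, map_zero, nilp_eq_shiftF, shiftF_apply]
  split_ifs <;> simp <;> ring

theorem dQ_apply_mem_diffOps (x y : P.Box) : P.dQ x y ∈ diffOps P.Vle := by
  rw [dQ_apply]
  refine add_mem ?_ (isDiffOp_const _)
  split_ifs
  exacts [isDiffOp_D, zero_mem _]

theorem rhoA_mem_matrix_diffOps : P.rhoA ∈ (diffOps P.Vle).matrix := fun x y => by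
  rw [rhoA_eq, Matrix.add_apply, shiftF_apply]
  refine (diffOps P.Vle).add_mem ?_ (P.dQ_apply_mem_diffOps x y)
  split_ifs
  exacts [one_mem _, zero_mem _]

theorem shiftE_mul_dQ_mem_strictTri :
    P.shiftE (PsiDO P.Vle) * P.dQ ∈ strictTri P.ht (diffOps P.Vle) := by
  intro x y
  rw [shiftE_mul]
  split_ifs with h
  · exact ⟨P.dQ_apply_mem_diffOps _ _, fun hxy => P.dQ_eq_zero (by rw [ht_next]; omega)⟩
  · exact ⟨zero_mem _, fun _ => rfl⟩

theorem dQ_mul_shiftE_mem_strictTri :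
    P.dQ * P.shiftE (PsiDO P.Vle) ∈ strictTri P.ht (diffOps P.Vle) := by
  intro x y
  rw [mul_shiftE]
  split_ifs with h
  · exact ⟨P.dQ_apply_mem_diffOps _ _, fun hxy => P.dQ_eq_zero (by rw [P.ht_prev h]; omega)⟩
  · exact ⟨zero_mem _, fun _ => rfl⟩

theorem filLE_genQ : FilLE P.ht P.ht 1 (P.genQ.map const) := by
  intro x y
  rw [Matrix.map_apply]
  by_cases h : P.ht x + 1 < P.ht y
  · rw [P.genQ_eq_zero h, const_zero]
    exact ordLE_zero _
  · exact (ordLE_const _).mono (by omega)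

theorem filLE_dQ : FilLE P.ht P.ht 2 P.dQ :=
  (filLE_diagonal fun _ => ordLE_D.mono (by omega)).add (P.filLE_genQ.mono (by omega))

theorem filLE_dQ_mul_shiftE : FilLE P.ht P.ht 0 (P.dQ * P.shiftE (PsiDO P.Vle)) := by
  intro x y
  rw [mul_shiftE]
  split_ifs with h
  · exact (P.filLE_dQ x (P.prev y)).mono (by rw [P.ht_prev h]; omega)
  · exact ordLE_zero _

theorem isUnit_rhoA : IsUnit P.rhoA := by
  have hu : FilLE (fun _ => 0) (fun _ => 0) (-2)
      (Units.map (Matrix.diagonalRingHom P.Box (PsiDO P.Vle)).toMonoidHom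
        (MulEquiv.piUnits.symm fun _ => unitD P.Vle))⁻¹.val :=
    filLE_diagonal fun _ => ordLE_mono _ _
  have hN : FilLE (fun _ => 0) (fun _ => 0) (2 - 1)
      (P.shiftF (PsiDO P.Vle) + P.genQ.map const) := fun x y => by
    rw [Matrix.add_apply, Matrix.map_apply, shiftF_apply]
    refine OrdLE.add ?_ (ordLE_const _)
    split_ifs
    exacts [ordLE_one, ordLE_zero _]
  obtain ⟨v, hv, -⟩ := hu.exists_unit_eq_add hN
  refine ⟨v, hv.trans ?_⟩
  rw [rhoA_eq, dQ, add_left_comm]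
  rfl

/-- The resolvent `(1 + Eₛ(∂ + Q))⁻¹`, where `Eₛ` is the transpose of `f`. Its columns at the last
boxes are carried by `ρA` into the span of the first boxes. -/
def rightRes : Matrix P.Box P.Box (PsiDO P.Vle) := Ring.inverse (1 + P.shiftE (PsiDO P.Vle) * P.dQ)

/-- The resolvent `(1 + (∂ + Q)Eₛ)⁻¹`, where `Eₛ` is the transpose of `f`. -/
def leftRes : Matrix P.Box P.Box (PsiDO P.Vle) := Ring.inverse (1 + P.dQ * P.shiftE (PsiDO P.Vle))

theorem one_add_shiftE_mul_dQ_mem_unitri :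
    1 + P.shiftE (PsiDO P.Vle) * P.dQ ∈ unitri P.ht (diffOps P.Vle) := by
  rw [mem_unitri, add_sub_cancel_left]
  exact P.shiftE_mul_dQ_mem_strictTri

theorem one_add_dQ_mul_shiftE_mem_unitri :
    1 + P.dQ * P.shiftE (PsiDO P.Vle) ∈ unitri P.ht (diffOps P.Vle) := by
  rw [mem_unitri, add_sub_cancel_left]
  exact P.dQ_mul_shiftE_mem_strictTri

theorem rightRes_mem_unitri : P.rightRes ∈ unitri P.ht (diffOps P.Vle) :=
  ringInverse_mem_unitri P.one_add_shiftE_mul_dQ_mem_unitri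

theorem leftRes_mem_unitri : P.leftRes ∈ unitri P.ht (diffOps P.Vle) :=
  ringInverse_mem_unitri P.one_add_dQ_mul_shiftE_mem_unitri

theorem mul_rightRes : (1 + P.shiftE (PsiDO P.Vle) * P.dQ) * P.rightRes = 1 :=
  Ring.mul_inverse_cancel _ (isUnit_of_mem_unitri P.one_add_shiftE_mul_dQ_mem_unitri)

theorem leftRes_mul : P.leftRes * (1 + P.dQ * P.shiftE (PsiDO P.Vle)) = 1 :=
  Ring.inverse_mul_cancel _ (isUnit_of_mem_unitri P.one_add_dQ_mul_shiftE_mem_unitri)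

theorem filLE_leftRes : FilLE P.ht P.ht 0 P.leftRes := by
  obtain ⟨J, hJ⟩ := exists_ringInverse_one_sub_eq
    (isNilpotent_of_mem_strictTri (neg_mem P.dQ_mul_shiftE_mem_strictTri))
  rw [sub_neg_eq_add] at hJ
  rw [leftRes, hJ]
  exact FilLE.sum fun j _ => (P.filLE_dQ_mul_shiftE.neg.pow j).mono (by simp)

theorem selL_last_mul_rightRes_mul_selR_last :
    selL (PsiDO P.Vle) P.lastBox * (P.rightRes * selR (PsiDO P.Vle) P.lastBox) = 1 := by
  rw [← Matrix.mul_assoc, P.selL_last_mul_of_inverse P.mul_rightRes,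
    selL_mul_selR P.lastBox_injective]

theorem selL_first_mul_leftRes_mul_selR_first :
    selL (PsiDO P.Vle) P.firstBox * P.leftRes * selR (PsiDO P.Vle) P.firstBox = 1 := by
  rw [Matrix.mul_assoc, P.mul_selR_first_of_inverse P.leftRes_mul,
    selL_mul_selR P.firstBox_injective]

theorem quasidetExists_rhoA_and_opT_eq : QuasidetExists P.rhoA P.firstBox P.lastBox ∧
    P.opT = selL (PsiDO P.Vle) P.firstBox *
      (P.rhoA * (P.rightRes * selR (PsiDO P.Vle) P.lastBox)) ∧
    P.opT = selL (PsiDO P.Vle) P.firstBox * P.leftRes * P.rhoA *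
      selR (PsiDO P.Vle) P.lastBox := by
  refine quasidetExists_and_eq P.isUnit_rhoA ?_ P.selL_last_mul_rightRes_mul_selR_last ?_
    P.selL_first_mul_leftRes_mul_selR_first
  · rw [rhoA_eq]
    exact P.shiftF_add_mul_of_inverse P.mul_rightRes
  · rw [rhoA_eq]
    exact P.mul_shiftF_add_of_inverse P.leftRes_mul

theorem rhoA_mul_rightRes : P.rhoA * (P.rightRes * selR (PsiDO P.Vle) P.lastBox) =
    selR (PsiDO P.Vle) P.firstBox * P.opT := by
  rw [P.quasidetExists_rhoA_and_opT_eq.2.1, rhoA_eq]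
  exact P.shiftF_add_mul_of_inverse P.mul_rightRes

theorem leftRes_mul_rhoA : selL (PsiDO P.Vle) P.firstBox * P.leftRes * P.rhoA =
    P.opT * selL (PsiDO P.Vle) P.lastBox := by
  rw [P.quasidetExists_rhoA_and_opT_eq.2.2, rhoA_eq]
  exact P.mul_shiftF_add_of_inverse P.leftRes_mul

section Kernel

variable (R : Type*) [CommRing R] [Differential R]

/-- The solution of `(∂ + f) X = 0` outside the first boxes with `1_{V₋} X = 1`. -/
def solX : Matrix P.Box (Fin r) (PsiDO R) :=
  Matrix.of fun x b => if x.1 = b then (-D) ^ (P.part b - 1 - (x.2 : ℕ)) else 0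

theorem solX_apply (x : P.Box) (b : Fin r) :
    P.solX R x b = if x.1 = b then (-D) ^ (P.part b - 1 - (x.2 : ℕ)) else 0 := rfl

theorem selL_last_mul_solX : selL (PsiDO R) P.lastBox * P.solX R = 1 := by
  ext1 a b
  rw [selL_mul, Matrix.submatrix_apply, id, solX_apply, Matrix.one_apply]
  by_cases h : a = b
  · subst h
    simp [lastBox]
  · rw [if_neg h, if_neg (show (P.lastBox a).1 ≠ b from h)]

theorem mul_solX : (P.shiftF (PsiDO R) + Matrix.diagonal fun _ => (D : PsiDO R)) * P.solX R =
    selR (PsiDO R) P.firstBox * (topUnit R P.part).val := by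
  ext1 x b
  rw [Matrix.add_mul, Matrix.add_apply, shiftF_mul, Matrix.diagonal_mul, solX_apply, solX_apply,
    val_topUnit, Matrix.mul_diagonal, selR, Matrix.submatrix_apply, id]
  have hx := x.2.2
  by_cases hb : x.1 = b
  · subst hb
    rw [if_pos rfl]
    by_cases h : 0 < (x.2 : ℕ)
    · rw [if_pos h, if_pos (show (P.prev x).1 = x.1 from rfl), Matrix.one_apply_ne, zero_mul]
      · rw [show P.part x.1 - 1 - ((P.prev x).2 : ℕ) = P.part x.1 - 1 - (x.2 : ℕ) + 1 by
          simp only [prev]; omega, pow_succ', neg_mul, neg_add_cancel]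
      · exact fun h' => (P.mem_range_firstBox x).1 ⟨_, h'.symm⟩ h
    · obtain ⟨a, rfl⟩ := (P.mem_range_firstBox x).2 h
      have e : P.part a - 1 - ((P.firstBox a).2 : ℕ) + 1 = P.part a := Nat.sub_add_cancel (P.pos a)
      rw [if_neg h, zero_add]
      change D * (-D) ^ (P.part a - 1 - ((P.firstBox a).2 : ℕ)) =
        (1 : Matrix _ _ (PsiDO R)) (P.firstBox a) (P.firstBox a) * -(-D) ^ P.part a
      rw [Matrix.one_apply_eq, one_mul]
      conv_rhs => rw [← e, pow_succ', neg_mul, neg_neg]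
  · rw [if_neg hb, if_neg (show (P.prev x).1 ≠ b from hb), ite_self,
      Matrix.one_apply_ne (by rintro rfl; exact hb rfl), mul_zero, zero_mul, add_zero]

theorem filLE_solX : FilLE P.ht (P.ht ∘ P.lastBox) 0 (P.solX R) := by
  intro x b
  rw [solX_apply]
  split_ifs with h
  · subst h
    refine (ordLE_neg_D_pow _).mono ?_
    have := x.2.2
    rw [Function.comp, ht_lastBox, ht]
    omega
  · exact ordLE_zero _

end Kernel

theorem opT_eq_topUnit_add : P.opT = (topUnit P.Vle P.part).val +
    selL (PsiDO P.Vle) P.firstBox * P.leftRes * P.genQ.map const * P.solX P.Vle := by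
  have h : P.opT = selL (PsiDO P.Vle) P.firstBox * P.leftRes * P.rhoA * P.solX P.Vle := by
    rw [leftRes_mul_rhoA, Matrix.mul_assoc, selL_last_mul_solX, Matrix.mul_one]
  rw [h, rhoA_eq, dQ, ← add_assoc, Matrix.mul_add, Matrix.add_mul, Matrix.mul_assoc _ _ (P.solX _),
    mul_solX, ← Matrix.mul_assoc, selL_first_mul_leftRes_mul_selR_first, Matrix.one_mul]

/-- A matrix differential operator on `V₋ → V₊` that differs from `-(-∂)^p` by terms of lower
filtration degree. -/
def Admissible (M : Matrix (Fin r) (Fin r) (PsiDO P.Vle)) : Prop :=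
  M ∈ (diffOps P.Vle).matrix ∧
    FilLE (fun a => (P.part a : ℤ)) (fun a => -(P.part a : ℤ)) (-1)
      (M - (topUnit P.Vle P.part).val)

theorem admissible_opT : P.Admissible P.opT := by
  constructor
  · rw [P.quasidetExists_rhoA_and_opT_eq.2.2, Matrix.mul_assoc _ P.leftRes, selL_mul, mul_selR]
    exact fun a b => mul_mem (mem_matrix_of_mem_unitri P.leftRes_mem_unitri)
      P.rhoA_mem_matrix_diffOps _ _
  · rw [opT_eq_topUnit_add, add_sub_cancel_left, selL_mul]
    intro a b
    refine (((P.filLE_leftRes.submatrix P.firstBox id).mul P.filLE_genQ).mul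
      (P.filLE_solX P.Vle) a b).mono ?_
    simp only [Function.comp, ht_firstBox, ht_lastBox]
    omega

end Pyramid

/-! ### The recursion -/

namespace Pyramid

open PsiDO

variable {r : ℕ} (P : Pyramid r)

theorem block_lt_block_of_part_lt {a b : Fin r} (h : P.part b < P.part a) :
    P.block a < P.block b := by
  refine Nat.add_lt_add_right (Finset.card_lt_card ?_) 1
  refine Finset.ssubset_iff.2 ⟨P.part a, by simp, ?_⟩
  intro l hl
  rw [Finset.mem_insert] at hl
  rcases hl with rfl | hl
  · simp [h]
  · rw [Finset.mem_filter] at hl ⊢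
    exact ⟨hl.1, h.trans hl.2⟩

theorem part_eq_of_block_eq {a b : Fin r} (h : P.block a = P.block b) : P.part a = P.part b := by
  by_contra hne
  rcases lt_or_gt_of_ne hne with hlt | hlt <;>
    exact (P.block_lt_block_of_part_lt hlt).ne (by rw [h])

theorem part_lt_of_block_lt {a b : Fin r} (h : P.block a < P.block b) : P.part b < P.part a := by
  rcases lt_trichotomy (P.part b) (P.part a) with hlt | heq | hlt
  · exact hlt
  · rw [block, block, heq] at h
    exact absurd h (lt_irrefl _)
  · exact absurd (P.block_lt_block_of_part_lt hlt) h.not_gt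

theorem block_le_numBlocks (a : Fin r) : P.block a ≤ P.numBlocks := by
  refine Nat.succ_le_of_lt (Finset.card_lt_card ?_)
  refine Finset.ssubset_iff.2 ⟨P.part a, by simp, ?_⟩
  intro l hl
  rw [Finset.mem_insert] at hl
  rcases hl with rfl | hl
  · simp
  · exact Finset.filter_subset _ _ hl

variable {P} {k : ℕ} {M : Matrix (Fin r) (Fin r) (PsiDO P.Vle)}

section Order

variable (P) in
theorem filLE_topUnit : FilLE (fun a => (P.part a : ℤ)) (fun a => -(P.part a : ℤ)) 0
    (topUnit P.Vle P.part).val :=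
  filLE_diagonal fun _ => (ordLE_neg_D_pow _).neg.mono (by omega)

theorem Admissible.filLE (hM : P.Admissible M) :
    FilLE (fun a => (P.part a : ℤ)) (fun a => -(P.part a : ℤ)) 0 M := by
  rw [← sub_add_cancel M (topUnit P.Vle P.part).val]
  exact (hM.2.mono (by omega)).add P.filLE_topUnit

theorem Admissible.corner (hM : P.Admissible M) (k : ℕ) : IsUnit (P.corner k M) ∧
    FilLE (fun a : {a // k ≤ P.block a} => -(P.part a : ℤ))
      (fun a : {a // k ≤ P.block a} => (P.part a : ℤ)) 0
      (Ring.inverse (P.corner k M)) := by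
  have hdiag : (topUnit P.Vle fun a : {a // k ≤ P.block a} => P.part a).val =
      (topUnit P.Vle P.part).val.submatrix Subtype.val Subtype.val := by
    rw [val_topUnit, val_topUnit, Matrix.submatrix_diagonal _ _ Subtype.val_injective]
    rfl
  have htop : P.corner k M = (topUnit P.Vle fun a : {a // k ≤ P.block a} => P.part a).val +
      (M - (topUnit P.Vle P.part).val).submatrix Subtype.val Subtype.val := by
    rw [hdiag]
    exact (add_sub_cancel _ _).symm
  have hinv : FilLE (fun a : {a // k ≤ P.block a} => -(P.part a : ℤ))
      (fun a : {a // k ≤ P.block a} => (P.part a : ℤ)) (-0)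
      (topUnit P.Vle fun a : {a // k ≤ P.block a} => P.part a)⁻¹.val :=
    filLE_diagonal fun a => (ordLE_inv_neg_unitD_pow (P.part a)).mono (by omega)
  obtain ⟨v, hv, hFil⟩ := hinv.exists_unit_eq_add
    ((hM.2.submatrix Subtype.val Subtype.val).mono (by omega))
  rw [htop, ← hv, Ring.inverse_unit]
  exact ⟨v.isUnit, hFil⟩

variable (P k M) in
theorem rightQuot_eq : P.rightQuot k M =
    (M.submatrix id Subtype.val : Matrix (Fin r) {a // k + 1 ≤ P.block a} _) *
      Ring.inverse (P.corner (k + 1) M) := rfl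

variable (P k M) in
theorem leftQuot_eq : P.leftQuot k M = Ring.inverse (P.corner (k + 1) M) *
    (M.submatrix Subtype.val id : Matrix {a // k + 1 ≤ P.block a} (Fin r) _) := rfl

theorem Admissible.ordLE_rightQuot (hM : P.Admissible M) {a : Fin r} (ha : P.block a = k)
    (b : {b // k + 1 ≤ P.block b}) :
    (P.rightQuot k M a b).OrdLE ((-1 + (P.part a : ℤ) - P.part b) / 2) := by
  have hrow : P.rightQuot k M a b = (((M - (topUnit P.Vle P.part).val).submatrix id Subtype.val :
      Matrix (Fin r) {a // k + 1 ≤ P.block a} _) * Ring.inverse (P.corner (k + 1) M)) a b := by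
    rw [rightQuot_eq, Matrix.mul_apply, Matrix.mul_apply]
    refine Finset.sum_congr rfl fun c _ => ?_
    have hac : a ≠ c.1 := fun h => by
      have := c.2
      rw [← h] at this
      omega
    simp [val_topUnit, hac]
  rw [hrow]
  exact (hM.2.submatrix id Subtype.val).mul (hM.corner (k + 1)).2 a b

theorem Admissible.ordLE_leftQuot (hM : P.Admissible M) {b : Fin r} (hb : P.block b = k)
    (a : {a // k + 1 ≤ P.block a}) :
    (P.leftQuot k M a b).OrdLE ((-1 - (P.part a : ℤ) + P.part b) / 2) := by
  have hcol : P.leftQuot k M a b = (Ring.inverse (P.corner (k + 1) M) *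
      ((M - (topUnit P.Vle P.part).val).submatrix Subtype.val id :
        Matrix {a // k + 1 ≤ P.block a} (Fin r) _)) a b := by
    rw [leftQuot_eq, Matrix.mul_apply, Matrix.mul_apply]
    refine Finset.sum_congr rfl fun c _ => ?_
    have hcb : c.1 ≠ b := fun h => by
      have := c.2
      rw [h] at this
      omega
    simp [val_topUnit, hcb]
  rw [hcol]
  refine ((hM.corner (k + 1)).2.mul (hM.2.submatrix Subtype.val id) a b).mono ?_
  simp only [Function.comp, id]
  omega

end Order

section Factors

variable (P k M)

theorem one_sub_eMinus_apply (a b : Fin r) : (1 - P.eMinus k M) a b =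
    if h : P.block a = k ∧ k + 1 ≤ P.block b then (P.rightQuot k M a ⟨b, h.2⟩).posPart else 0 := by
  rw [eMinus, sub_sub_cancel, Matrix.of_apply]

theorem one_sub_fMinus_apply (a b : Fin r) : (1 - P.fMinus k M) a b =
    if h : k + 1 ≤ P.block a ∧ P.block b = k then (P.leftQuot k M ⟨a, h.1⟩ b).posPart else 0 := by
  rw [fMinus, sub_sub_cancel, Matrix.of_apply]

theorem eMinus_mem_unitri : P.eMinus k M ∈ unitri P.part (diffOps P.Vle) := by
  rw [← sub_sub_cancel 1 (P.eMinus k M)]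
  refine one_sub_mem_unitri fun a b => ?_
  rw [one_sub_eMinus_apply]
  split_ifs with h
  · exact ⟨isDiffOp_posPart _, fun hab => absurd (P.part_lt_of_block_lt (by omega)) hab⟩
  · exact ⟨zero_mem _, fun _ => rfl⟩

theorem fMinus_mem_unitri : P.fMinus k M ∈ unitri (toDual ∘ P.part) (diffOps P.Vle) := by
  rw [← sub_sub_cancel 1 (P.fMinus k M)]
  refine one_sub_mem_unitri fun a b => ?_
  rw [one_sub_fMinus_apply]
  split_ifs with h
  · exact ⟨isDiffOp_posPart _, fun hab => absurd (P.part_lt_of_block_lt (by omega)) hab⟩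
  · exact ⟨zero_mem _, fun _ => rfl⟩

variable {P k M}

theorem Admissible.filLE_one_sub_eMinus (hM : P.Admissible M) :
    FilLE (fun a => (P.part a : ℤ)) (fun a => (P.part a : ℤ)) (-1) (1 - P.eMinus k M) := by
  intro a b
  rw [one_sub_eMinus_apply]
  split_ifs with h
  exacts [(hM.ordLE_rightQuot h.1 _).posPart, ordLE_zero _]

theorem Admissible.filLE_one_sub_fMinus (hM : P.Admissible M) :
    FilLE (fun a => -(P.part a : ℤ)) (fun a => -(P.part a : ℤ)) (-1) (1 - P.fMinus k M) := by
  intro a b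
  rw [one_sub_fMinus_apply]
  split_ifs with h
  exacts [(hM.ordLE_leftQuot h.2 _).posPart.mono (by dsimp only; omega), ordLE_zero _]

theorem Admissible.eMinus_mul_mul_fMinus (hM : P.Admissible M) :
    P.Admissible (P.eMinus k M * M * P.fMinus k M) := by
  refine ⟨mul_mem (mul_mem (mem_matrix_of_mem_unitri (P.eMinus_mem_unitri k M)) hM.1)
    (mem_matrix_of_mem_unitri (P.fMinus_mem_unitri k M)), ?_⟩
  have hsub : P.eMinus k M * M * P.fMinus k M - (topUnit P.Vle P.part).val =
      M - (topUnit P.Vle P.part).val - (1 - P.eMinus k M) * M - M * (1 - P.fMinus k M) +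
        (1 - P.eMinus k M) * M * (1 - P.fMinus k M) := by
    noncomm_ring
  rw [hsub]
  refine ((hM.2.sub ?_).sub ?_).add ?_
  · exact (hM.filLE_one_sub_eMinus.mul hM.filLE).mono (by omega)
  · exact (hM.filLE.mul hM.filLE_one_sub_fMinus).mono (by omega)
  · exact ((hM.filLE_one_sub_eMinus.mul hM.filLE).mul hM.filLE_one_sub_fMinus).mono (by omega)

theorem eMinus_mul_apply_of_lt (X : Matrix (Fin r) (Fin r) (PsiDO P.Vle)) {a : Fin r}
    (ha : k < P.block a) (b : Fin r) : (P.eMinus k M * X) a b = X a b := by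
  have h : ((1 - P.eMinus k M) * X) a b = 0 := by
    rw [Matrix.mul_apply]
    refine Finset.sum_eq_zero fun c _ => ?_
    rw [one_sub_eMinus_apply, dif_neg (by omega), zero_mul]
  rw [← sub_sub_cancel 1 (P.eMinus k M), sub_mul, one_mul, Matrix.sub_apply, h, sub_zero]

theorem mul_fMinus_apply_of_lt (X : Matrix (Fin r) (Fin r) (PsiDO P.Vle)) (a : Fin r) {b : Fin r}
    (hb : k < P.block b) : (X * P.fMinus k M) a b = X a b := by
  have h : (X * (1 - P.fMinus k M)) a b = 0 := by
    rw [Matrix.mul_apply]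
    refine Finset.sum_eq_zero fun c _ => ?_
    rw [one_sub_fMinus_apply, dif_neg (by omega), mul_zero]
  rw [← sub_sub_cancel 1 (P.fMinus k M), mul_sub, mul_one, Matrix.sub_apply, h, sub_zero]

theorem eMinus_mul_apply_of_eq (hW : IsUnit (P.corner (k + 1) M)) {a b : Fin r}
    (ha : P.block a = k) (hb : k + 1 ≤ P.block b) :
    (P.eMinus k M * M) a b = ∑ c : {c // k + 1 ≤ P.block c},
      (P.rightQuot k M a c - (P.rightQuot k M a c).posPart) * M c b := by
  have hquot : P.rightQuot k M * P.corner (k + 1) M = M.submatrix id Subtype.val := by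
    rw [rightQuot_eq, Matrix.mul_assoc, Ring.inverse_mul_cancel _ hW, Matrix.mul_one]
  have hM : M a b = ∑ c : {c // k + 1 ≤ P.block c}, P.rightQuot k M a c * M c b :=
    (congrFun₂ hquot a ⟨b, hb⟩).symm.trans (Matrix.mul_apply ..)
  have hE : ((1 - P.eMinus k M) * M) a b = ∑ c : {c // k + 1 ≤ P.block c},
      (P.rightQuot k M a c).posPart * M c b := by
    rw [Matrix.mul_apply]
    refine (Fintype.sum_of_injective _ Subtype.val_injective _ _ (fun c hc => ?_) fun c => ?_).symm
    · rw [one_sub_eMinus_apply, dif_neg fun h => hc ⟨⟨c, h.2⟩, rfl⟩, zero_mul]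
    · rw [one_sub_eMinus_apply, dif_pos ⟨ha, c.2⟩]
  rw [← sub_sub_cancel 1 (P.eMinus k M), sub_mul, one_mul, Matrix.sub_apply, hE, hM,
    ← Finset.sum_sub_distrib]
  exact Finset.sum_congr rfl fun c _ => (sub_mul ..).symm

theorem mul_fMinus_apply_of_eq (hW : IsUnit (P.corner (k + 1) M)) {a b : Fin r}
    (ha : k + 1 ≤ P.block a) (hb : P.block b = k) :
    (M * P.fMinus k M) a b = ∑ c : {c // k + 1 ≤ P.block c},
      M a c * (P.leftQuot k M c b - (P.leftQuot k M c b).posPart) := by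
  have hquot : P.corner (k + 1) M * P.leftQuot k M = M.submatrix Subtype.val id := by
    rw [leftQuot_eq, ← Matrix.mul_assoc, Ring.mul_inverse_cancel _ hW, Matrix.one_mul]
  have hM : M a b = ∑ c : {c // k + 1 ≤ P.block c}, M a c * P.leftQuot k M c b :=
    (congrFun₂ hquot ⟨a, ha⟩ b).symm.trans (Matrix.mul_apply ..)
  have hF : (M * (1 - P.fMinus k M)) a b = ∑ c : {c // k + 1 ≤ P.block c},
      M a c * (P.leftQuot k M c b).posPart := by
    rw [Matrix.mul_apply]
    refine (Fintype.sum_of_injective _ Subtype.val_injective _ _ (fun c hc => ?_) fun c => ?_).symm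
    · rw [one_sub_fMinus_apply, dif_neg fun h => hc ⟨⟨c, h.1⟩, rfl⟩, mul_zero]
    · rw [one_sub_fMinus_apply, dif_pos ⟨c.2, hb⟩]
  rw [← sub_sub_cancel 1 (P.fMinus k M), mul_sub, mul_one, Matrix.sub_apply, hF, hM,
    ← Finset.sum_sub_distrib]
  exact Finset.sum_congr rfl fun c _ => (mul_sub ..).symm

end Factors

/-- The corner of `M` in the blocks `≥ k` is reduced. -/
def CornerReduced (P : Pyramid r) (k : ℕ) (M : Matrix (Fin r) (Fin r) (PsiDO P.Vle)) : Prop :=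
  ∀ a b, k ≤ P.block a → k ≤ P.block b →
    ((M - (topUnit P.Vle P.part).val) a b).OrdLE (min (P.part a) (P.part b) - 1)

theorem Admissible.ordLE_of_block_eq (hM : P.Admissible M) {a b : Fin r}
    (h : P.block a = P.block b) :
    ((M - (topUnit P.Vle P.part).val) a b).OrdLE (min (P.part a) (P.part b) - 1) := by
  have := P.part_eq_of_block_eq h
  exact (hM.2 a b).mono (by dsimp only; omega)

theorem CornerReduced.ordLE (h : P.CornerReduced k M) {a b : Fin r} (ha : k ≤ P.block a)
    (hb : k ≤ P.block b) : (M a b).OrdLE (min (P.part a) (P.part b)) := by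
  rw [← sub_add_cancel M (topUnit P.Vle P.part).val, Matrix.add_apply]
  refine ((h a b ha hb).mono (by omega)).add ?_
  rw [val_topUnit, Matrix.diagonal_apply]
  split_ifs with hab
  · subst hab
    exact (ordLE_neg_D_pow _).neg.mono (by omega)
  · exact ordLE_zero _

theorem CornerReduced.ordLE_eMinus_mul (h : P.CornerReduced (k + 1) M)
    (hW : IsUnit (P.corner (k + 1) M)) {a b : Fin r} (ha : P.block a = k)
    (hb : k + 1 ≤ P.block b) : ((P.eMinus k M * M) a b).OrdLE (P.part b - 1) := by
  rw [eMinus_mul_apply_of_eq hW ha hb]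
  exact OrdLE.sum fun c _ => ((ordLE_sub_posPart _).mul (h.ordLE c.2 hb)).mono (by omega)

theorem CornerReduced.ordLE_mul_fMinus (h : P.CornerReduced (k + 1) M)
    (hW : IsUnit (P.corner (k + 1) M)) {a b : Fin r} (ha : k + 1 ≤ P.block a)
    (hb : P.block b = k) : ((M * P.fMinus k M) a b).OrdLE (P.part a - 1) := by
  rw [mul_fMinus_apply_of_eq hW ha hb]
  exact OrdLE.sum fun c _ => ((h.ordLE ha c.2).mul (ordLE_sub_posPart _)).mono (by omega)

theorem CornerReduced.eMinus_mul_mul_fMinus (h : P.CornerReduced (k + 1) M)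
    (hM : P.Admissible M) : P.CornerReduced k (P.eMinus k M * M * P.fMinus k M) := by
  intro a b ha hb
  have hW := (hM.corner (k + 1)).1
  rcases ha.lt_or_eq with ha | ha <;> rcases hb.lt_or_eq with hb | hb
  · rw [Matrix.sub_apply, mul_fMinus_apply_of_lt _ _ hb, eMinus_mul_apply_of_lt _ ha]
    exact h a b ha hb
  · have hlt := P.part_lt_of_block_lt (hb.symm.trans_lt ha)
    rw [Matrix.sub_apply, mul_assoc, eMinus_mul_apply_of_lt _ ha, val_topUnit,
      Matrix.diagonal_apply_ne _ (by rintro rfl; omega), sub_zero]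
    exact (h.ordLE_mul_fMinus hW ha hb.symm).mono (by omega)
  · have hlt := P.part_lt_of_block_lt (ha.symm.trans_lt hb)
    rw [Matrix.sub_apply, mul_fMinus_apply_of_lt _ _ hb, val_topUnit,
      Matrix.diagonal_apply_ne _ (by rintro rfl; omega), sub_zero]
    exact (h.ordLE_eMinus_mul hW ha.symm hb).mono (by omega)
  · exact hM.eMinus_mul_mul_fMinus.ordLE_of_block_eq (ha.symm.trans hb)

section Terms

variable (P k)

theorem recT_of_numBlocks_le (hk : P.numBlocks ≤ k) : P.recT k = P.opT := by
  rw [recT, Nat.sub_eq_zero_of_le hk, recAux]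

theorem admissible_recT : P.Admissible (P.recT k) := by
  induction hj : P.numBlocks - k generalizing k with
  | zero => exact P.recT_of_numBlocks_le k (by omega) ▸ P.admissible_opT
  | succ j ih =>
    exact P.recT_of_lt (k := k) (by omega) ▸ (ih (k + 1) (by omega)).eMinus_mul_mul_fMinus

theorem cornerReduced_recT : P.CornerReduced k (P.recT k) := by
  induction hj : P.numBlocks - k generalizing k with
  | zero =>
    intro a b ha hb
    have := P.block_le_numBlocks a
    have := P.block_le_numBlocks b
    exact (P.admissible_recT k).ordLE_of_block_eq (by omega)
  | succ j ih =>
    exact P.recT_of_lt (k := k) (by omega) ▸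
      (ih (k + 1) (by omega)).eMinus_mul_mul_fMinus (P.admissible_recT _)

theorem unitriEquiv_opT_recT : UnitriEquiv P.part P.opT (P.recT k) := by
  induction hj : P.numBlocks - k generalizing k with
  | zero => exact P.recT_of_numBlocks_le k (by omega) ▸ UnitriEquiv.refl _ _
  | succ j ih =>
    exact (ih (k + 1) (by omega)).trans ⟨_, P.eMinus_mem_unitri k _, _, P.fMinus_mem_unitri k _,
      (P.recT_of_lt (by omega)).symm⟩

theorem reduced_recT_one : Reduced P.part (P.recT 1) := fun a b =>
  P.cornerReduced_recT 1 a b (P.one_le_block a) (P.one_le_block b)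

end Terms

end Pyramid

/-! ### Infinitesimal gauge transformations -/

section LamD

variable {R : Type*} [CommRing R] [Differential R]

theorem lamD_add (p q : Polynomial R) : lamD (p + q) = lamD p + lamD q := by
  simp only [lamD, map_add, mul_add]
  abel

theorem lamD_zero : lamD (0 : Polynomial R) = 0 := by simp [lamD]

theorem lamD_C_mul (x : R) (p : Polynomial R) :
    lamD (Polynomial.C x * p) = Polynomial.C x * lamD p + Polynomial.C x′ * p := by
  simp only [lamD, Derivation.leibniz, Differential.mapCoeffs_C, smul_eq_mul]
  ring

theorem coeff_lamD_zero (p : Polynomial R) : (lamD p).coeff 0 = (p.coeff 0)′ := by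
  simp [lamD, Differential.coeff_mapCoeffs]

theorem coeff_lamD_succ (p : Polynomial R) (n : ℕ) :
    (lamD p).coeff (n + 1) = p.coeff n + (p.coeff (n + 1))′ := by
  simp [lamD, Differential.coeff_mapCoeffs]

theorem lamD_iterate_sum {ι : Type*} (n : ℕ) (s : Finset ι) (p : ι → Polynomial R) :
    lamD^[n] (∑ i ∈ s, p i) = ∑ i ∈ s, lamD^[n] (p i) := by
  let f : AddMonoid.End (Polynomial R) := ⟨⟨lamD, lamD_zero⟩, lamD_add⟩
  have hf : ⇑(f ^ n) = lamD^[n] := AddMonoid.End.coe_pow _ f n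
  rw [← hf, map_sum]

theorem IsDiffHom.map_lamD_iterate {S : Type*} [CommRing S] [Differential S] {φ : R →+* S}
    (hφ : IsDiffHom φ) (n : ℕ) (p : Polynomial R) :
    (lamD^[n] p).map φ = lamD^[n] (p.map φ) := by
  refine Function.Semiconj.iterate_right (f := Polynomial.map φ) (fun q => ?_) n p
  ext n
  cases n with
  | zero => simp only [Polynomial.coeff_map, coeff_lamD_zero, hφ (q.coeff 0)]
  | succ n => simp only [Polynomial.coeff_map, coeff_lamD_succ, map_add, hφ (q.coeff (n + 1))]

/-- The square-zero extension `R ⊕ R[λ]`, where `λⁿ` stands for the `n`-th derivative of an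
infinitesimal gauge parameter `ε`. -/
abbrev GaugeExt (R : Type*) [CommRing R] : Type _ := TrivSqZeroExt R (Polynomial R)

instance : Differential (GaugeExt R) where
  deriv := Derivation.mk' (AddMonoidHom.toIntLinearMap
    { toFun := fun s => TrivSqZeroExt.inl s.fst′ + TrivSqZeroExt.inr (lamD s.snd)
      map_zero' := by ext <;> simp [lamD_zero]
      map_add' := fun s t => by ext1 <;> simp [lamD_add] }) (by
    intro s t
    ext1
    · simp
    · simp only [AddMonoidHom.coe_toIntLinearMap, AddMonoidHom.coe_mk, ZeroHom.coe_mk,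
        TrivSqZeroExt.snd_mul, TrivSqZeroExt.fst_mul, TrivSqZeroExt.snd_add, TrivSqZeroExt.snd_inl,
        TrivSqZeroExt.snd_inr, zero_add, smul_eq_mul, TrivSqZeroExt.fst_add,
        TrivSqZeroExt.fst_inl, TrivSqZeroExt.fst_inr, add_zero, lamD_add, op_smul_eq_smul,
        Polynomial.smul_eq_C_mul, lamD_C_mul]
      ring)

theorem deriv_gaugeExt (s : GaugeExt R) :
    s′ = TrivSqZeroExt.inl s.fst′ + TrivSqZeroExt.inr (lamD s.snd) := rfl

theorem isDiffHom_inlHom : IsDiffHom (TrivSqZeroExt.inlHom R (Polynomial R)) := fun x => by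
  rw [deriv_gaugeExt]
  simp [lamD_zero]

end LamD

section DiffPoly

variable {σ : Type*}

theorem deriv_X (y : σ) (n : ℕ) :
    (MvPolynomial.X (y, n) : DiffPoly σ)′ = MvPolynomial.X (y, n + 1) :=
  MvPolynomial.mkDerivation_X ℂ _ _

theorem deriv_C (c : ℂ) : (MvPolynomial.C c : DiffPoly σ)′ = 0 :=
  MvPolynomial.derivation_C (MvPolynomial.mkDerivation ℂ fun y : σ × ℕ =>
    (MvPolynomial.X (y.1, y.2 + 1) : DiffPoly σ)) c

theorem isDiffHom_of_generators {S : Type*} [CommRing S] [Differential S] {φ : DiffPoly σ →+* S}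
    (hC : ∀ c, (φ (MvPolynomial.C c))′ = 0)
    (hX : ∀ y n, φ (MvPolynomial.X (y, n + 1)) = (φ (MvPolynomial.X (y, n)))′) :
    IsDiffHom φ := fun x => by
  induction x using MvPolynomial.induction_on with
  | C c => rw [deriv_C, hC, map_zero]
  | add p q hp hq => rw [map_add, map_add, hp, hq, map_add, map_add]
  | mul_X p y hp =>
    simp only [map_mul, Derivation.leibniz, smul_eq_mul, map_add, hp, ← hX, ← deriv_X]

theorem sum_vars_pderiv {M : Type*} [AddCommGroup M] [Module ℂ M] [Module (DiffPoly σ) M]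
    [IsScalarTower ℂ (DiffPoly σ) M] (b : σ × ℕ → M) (G : DiffPoly σ) :
    ∑ y ∈ G.vars, MvPolynomial.pderiv y G • b y = MvPolynomial.mkDerivation ℂ b G := by
  classical
  have hsum : ∀ x, (∑ y ∈ G.vars, (LinearMap.toSpanSingleton (DiffPoly σ) M (b y)).compDer
      (MvPolynomial.pderiv y)) x = ∑ y ∈ G.vars, MvPolynomial.pderiv y x • b y := fun x =>
    (congrFun (map_sum (Derivation.coeFnAddMonoidHom (R := ℂ) (A := DiffPoly σ) (M := M)) _ _)
      x).trans (Finset.sum_apply ..)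
  rw [← hsum]
  refine MvPolynomial.derivation_eq_of_forall_mem_vars fun z hz => ?_
  rw [hsum, MvPolynomial.mkDerivation_X, Finset.sum_eq_single z]
  · simp
  · intro y _ hy
    rw [MvPolynomial.pderiv_X_of_ne hy.symm, zero_smul]
  · exact fun h => absurd hz h

end DiffPoly

section Affine

variable {n : Type*} [Fintype n]

theorem emb_sum_smul {ι : Type*} [Fintype ι] (c : ι → ℂ) (m : ι → Matrix n n ℂ) :
    emb (∑ i, c i • m i) = ∑ i, MvPolynomial.C (c i) * emb (m i) := by
  simp only [emb, Matrix.sum_apply, Matrix.smul_apply, map_sum, Finset.sum_mul, Finset.mul_sum,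
    smul_eq_mul, map_mul, mul_assoc]
  exact Finset.sum_comm

theorem emb_sub (a b : Matrix n n ℂ) : emb (a - b) = emb a - emb b := by
  simp only [emb, Matrix.sub_apply, map_sub, sub_mul, Finset.sum_sub_distrib]

theorem sum_vars_emb {M : Type*} [AddCommMonoid M] (a : Matrix n n ℂ)
    {F : (n × n) × ℕ → DiffPoly (n × n) → M} (hF : ∀ x, F x 0 = 0) :
    ∑ x ∈ (emb a).vars, F x (MvPolynomial.pderiv x (emb a)) =
      ∑ x : n × n, F (x, 0) (MvPolynomial.C (a x.1 x.2)) := by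
  classical
  let ι : n × n ↪ (n × n) × ℕ := ⟨fun x => (x, 0), Prod.mk_left_injective 0⟩
  have hvars : (emb a).vars ⊆ Finset.univ.map ι := by
    refine (MvPolynomial.vars_sum_subset _ _).trans (Finset.biUnion_subset.2 fun x _ => ?_)
    refine (MvPolynomial.vars_mul _ _).trans ?_
    rw [MvPolynomial.vars_C, MvPolynomial.vars_X, Finset.empty_union, Finset.singleton_subset_iff]
    exact Finset.mem_map_of_mem ι (Finset.mem_univ x)
  rw [Finset.sum_subset hvars fun x _ hx => by
    rw [MvPolynomial.pderiv_eq_zero_of_notMem_vars hx, hF], Finset.sum_map]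
  refine Finset.sum_congr rfl fun x _ => congrArg (F (x, 0)) ?_
  simp only [ι, Function.Embedding.coeFn_mk, emb, map_sum, MvPolynomial.pderiv_mul,
    MvPolynomial.pderiv_C, zero_mul, zero_add, MvPolynomial.pderiv_X, Pi.single_apply,
    Prod.mk.injEq, and_true]
  simp

variable [DecidableEq n]

theorem eq_sum_matUnit (a : Matrix n n ℂ) : a = ∑ x : n × n, a x.1 x.2 • matUnit x := by
  conv_lhs => rw [Matrix.matrix_eq_sum_single a]
  rw [Fintype.sum_prod_type]
  simp [matUnit]

theorem sum_C_mul_emb_lie_matUnit (a b : Matrix n n ℂ) :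
    ∑ x : n × n, MvPolynomial.C (a x.1 x.2) * emb ⁅matUnit x, b⁆ = emb ⁅a, b⁆ := by
  have h : ⁅a, b⁆ = ∑ x : n × n, a x.1 x.2 • ⁅matUnit x, b⁆ := by
    conv_lhs => rw [eq_sum_matUnit a]
    simp only [Ring.lie_def, Finset.sum_mul, Finset.mul_sum, smul_mul_assoc, mul_smul_comm,
      smul_sub, Finset.sum_sub_distrib]
  rw [h, emb_sum_smul]

theorem sum_mul_trace_matUnit_mul (a b : Matrix n n ℂ) :
    ∑ x : n × n, a x.1 x.2 * (matUnit x * b).trace = (a * b).trace := by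
  conv_rhs => rw [eq_sum_matUnit a, Finset.sum_mul, Matrix.trace_sum]
  simp only [smul_mul_assoc, Matrix.trace_smul, smul_eq_mul]

/-- The values `{a_λ y⁽ᵏ⁾}` for `a` in `gl` and variables `y⁽ᵏ⁾`. -/
def gaugeVar (a : Matrix n n ℂ) (y : (n × n) × ℕ) : Polynomial (DiffPoly (n × n)) :=
  lamD^[y.2] (Polynomial.C (emb ⁅a, matUnit y.1⁆) +
    Polynomial.C (MvPolynomial.C (a * matUnit y.1).trace) * Polynomial.X)

theorem lamD_C_C {σ : Type*} (c : ℂ) : lamD (Polynomial.C (MvPolynomial.C c : DiffPoly σ)) =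
    Polynomial.C (MvPolynomial.C c) * Polynomial.X := by
  rw [lamD, Differential.mapCoeffs_C, deriv_C, map_zero, add_zero, mul_comm]

theorem affineBracket_emb (a : Matrix n n ℂ) (G : DiffPoly (n × n)) :
    affineBracket (emb a) G = MvPolynomial.mkDerivation ℂ (gaugeVar a) G := by
  rw [← sum_vars_pderiv, affineBracket, Finset.sum_comm]
  refine Finset.sum_congr rfl fun y _ => ?_
  let q (x : (n × n) × ℕ) (p : DiffPoly (n × n)) : Polynomial (DiffPoly (n × n)) :=
    (fun z => -lamD z)^[x.2] (Polynomial.C p)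
  have hq (x) : q x 0 = 0 := by
    simp only [q, map_zero]
    exact Function.iterate_fixed (by rw [lamD_zero, neg_zero]) _
  rw [Polynomial.smul_eq_C_mul, ← Finset.mul_sum, gaugeVar, ← lamD_iterate_sum,
    sum_vars_emb a (F := fun x p => Polynomial.C (emb ⁅matUnit x.1, matUnit y.1⁆) * q x p +
      Polynomial.C (MvPolynomial.C (matUnit x.1 * matUnit y.1).trace) * lamD (q x p))
      fun x => by rw [hq, lamD_zero, mul_zero, mul_zero, add_zero]]
  congr 2
  simp only [q, Function.iterate_zero_apply, lamD_C_C]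
  rw [Finset.sum_add_distrib, ← sum_C_mul_emb_lie_matUnit, ← sum_mul_trace_matUnit_mul]
  simp only [map_sum, map_mul, Finset.mul_sum, mul_comm, mul_left_comm]

theorem emb_lie_matUnit (a : Matrix n n ℂ) (x y : n) : emb ⁅a, matUnit (y, x)⁆ =
    ∑ z, MvPolynomial.C (a z y) * MvPolynomial.X ((z, x), 0) -
      ∑ z, MvPolynomial.C (a x z) * MvPolynomial.X ((y, z), 0) := by
  have hl : a * matUnit (y, x) = ∑ z, a z y • matUnit (z, x) := by
    ext i j
    simp [matUnit, Matrix.mul_apply, Matrix.sum_apply, Matrix.single_apply, ite_and]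
  have hr : matUnit (y, x) * a = ∑ z, a x z • matUnit (y, z) := by
    ext i j
    simp [matUnit, Matrix.mul_apply, Matrix.sum_apply, Matrix.single_apply, ite_and]
  rw [Ring.lie_def, emb_sub, hl, hr, emb_sum_smul, emb_sum_smul]
  simp only [emb_matUnit]

end Affine

namespace Pyramid

open PsiDO TrivSqZeroExt

variable {r : ℕ} (P : Pyramid r)

theorem rho_C (c : ℂ) : P.rho (MvPolynomial.C c) = MvPolynomial.C c := P.rho.commutes c

theorem isDiffHom_rho : IsDiffHom P.rho.toRingHom := by
  refine isDiffHom_of_generators (fun c => ?_) (fun y n => ?_)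
  · exact (congrArg _ (P.rho_C c)).trans (deriv_C c)
  · change P.rho (MvPolynomial.X (y, n + 1)) = Differential.deriv (P.rho (MvPolynomial.X (y, n)))
    have hconst :
        (if n = 0 then MvPolynomial.C (P.nilp * matUnit y).trace else 0 : P.Vle)′ = 0 := by
      split_ifs
      exacts [deriv_C _, map_zero _]
    rw [rho, MvPolynomial.aeval_X, MvPolynomial.aeval_X, map_add, if_neg (Nat.succ_ne_zero n),
      add_zero, hconst, add_zero]
    split_ifs
    exacts [(deriv_X _ _).symm, (map_zero _).symm]

/-- The constant matrix `a`, as a matrix over `𝒱(g_{≤ 1/2})`. -/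
def constMat (a : P.gl) : Matrix P.Box P.Box P.Vle := a.map MvPolynomial.C

theorem constMat_apply (a : P.gl) (x y : P.Box) : P.constMat a x y = MvPolynomial.C (a x y) := rfl

/-- The matrix `f + Q` of the values of `ρ` on the matrix units. -/
def genM : Matrix P.Box P.Box P.Vle := P.genQ + P.constMat P.nilp

theorem rho_X_eq_genM (x y : P.Box) : P.rho (MvPolynomial.X ((y, x), 0)) = P.genM x y :=
  P.rho_X_zero (y, x)

theorem nilp_eq_zero {x y : P.Box} (h : P.ht x ≠ P.ht y - 2) : P.nilp x y = 0 := by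
  rw [nilp_eq_shiftF, shiftF_apply, if_neg]
  rintro ⟨hrow, hcol⟩
  have hpart := congrArg P.part hrow
  simp only [ht] at h
  omega

theorem genM_eq_zero {x y : P.Box} (h : P.ht x + 2 < P.ht y) : P.genM x y = 0 := by
  rw [genM, Matrix.add_apply, constMat_apply, P.genQ_eq_zero (by omega),
    P.nilp_eq_zero (by omega), map_zero, add_zero]

theorem rhoA_eq_genM : P.rhoA = Matrix.diagonal (fun _ => D) + P.genM.map const := by
  have h : (P.constMat P.nilp).map (constHom P.Vle) = P.shiftF (PsiDO P.Vle) := by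
    ext1 x y
    simp only [Matrix.map_apply, constMat_apply, nilp_eq_shiftF, shiftF_apply,
      apply_ite MvPolynomial.C, apply_ite (constHom P.Vle), map_one, map_zero]
  change _ = _ + P.genM.map (constHom P.Vle)
  rw [genM, Matrix.map_add _ (map_add _), h, rhoA_eq, dQ, add_comm, add_assoc]
  rfl

theorem rho_incl (w : P.Vle) : P.rho (P.incl w) = w := by
  have h : P.rho.comp P.incl = AlgHom.id ℂ P.Vle := by
    refine MvPolynomial.algHom_ext fun ⟨y, n⟩ => ?_
    have hy := (P.deg_le_iff y.1).1 y.2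
    rw [AlgHom.comp_apply, incl, MvPolynomial.rename_X, rho, MvPolynomial.aeval_X, dif_pos y.2,
      trace_mul_matUnit, P.nilp_eq_zero (by simp only; omega), map_zero, ite_self, add_zero]
    rfl
  exact DFunLike.congr_fun h w

/-- The values `ρ{a_λ y}` for `a` in `gl` and matrix units `y`. -/
def gaugeLin (a : P.gl) (y : P.Box × P.Box) : Polynomial P.Vle :=
  Polynomial.C (P.rho (emb ⁅a, matUnit y⁆)) +
    Polynomial.C (MvPolynomial.C (a * matUnit y).trace) * Polynomial.X

/-- The derivation `w ↦ ρ{a_λ w}`. -/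
def gaugeDer (a : P.gl) : Derivation ℂ P.Vle (Polynomial P.Vle) :=
  MvPolynomial.mkDerivation ℂ fun y => lamD^[y.2] (P.gaugeLin a y.1.1)

theorem gaugeDer_X (a : P.gl) (y) :
    P.gaugeDer a (MvPolynomial.X y) = lamD^[y.2] (P.gaugeLin a y.1.1) :=
  MvPolynomial.mkDerivation_X ..

theorem map_rho_affineBracket_emb (a : P.gl) (w : P.Vle) :
    (affineBracket (emb a) (P.incl w)).map P.rho.toRingHom = P.gaugeDer a w := by
  rw [affineBracket_emb]
  induction w using MvPolynomial.induction_on with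
  | C c =>
    have hC : P.incl (MvPolynomial.C c) = MvPolynomial.C c := P.incl.commutes c
    rw [hC, MvPolynomial.derivation_C, Polynomial.map_zero, MvPolynomial.derivation_C]
  | add p q hp hq => rw [map_add, map_add, Polynomial.map_add, hp, hq, map_add]
  | mul_X p y hp =>
    have hX : MvPolynomial.mkDerivation ℂ (gaugeVar a) (P.incl (MvPolynomial.X y)) =
        gaugeVar a (y.1.1, y.2) := by
      rw [incl, MvPolynomial.rename_X, MvPolynomial.mkDerivation_X]
    have hvar : (gaugeVar a (y.1.1, y.2)).map P.rho.toRingHom =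
        P.gaugeDer a (MvPolynomial.X y) := by
      have hC : P.rho.toRingHom (MvPolynomial.C (a * matUnit y.1.1).trace) =
          MvPolynomial.C (a * matUnit y.1.1).trace := P.rho_C _
      rw [gaugeVar, P.isDiffHom_rho.map_lamD_iterate, gaugeDer_X, gaugeLin, Polynomial.map_add,
        Polynomial.map_mul, Polynomial.map_C, Polynomial.map_C, Polynomial.map_X, hC]
      rfl
    have hincl (x) : P.rho.toRingHom (P.incl x) = x := P.rho_incl x
    rw [map_mul, Derivation.leibniz, hX, Derivation.leibniz]
    simp only [Polynomial.smul_eq_C_mul, Polynomial.map_add, Polynomial.map_mul, Polynomial.map_C,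
      hvar, hp, hincl]

/-- The infinitesimal gauge transformation `w ↦ w + ρ{a_λ w}`. -/
def gaugeHom (a : P.gl) : P.Vle →+* GaugeExt P.Vle where
  toFun w := inl w + inr (P.gaugeDer a w)
  map_one' := by rw [Derivation.map_one_eq_zero, inr_zero, add_zero, inl_one]
  map_zero' := by rw [map_zero, inr_zero, add_zero, inl_zero]
  map_add' v w := by rw [map_add, inl_add, inr_add, add_add_add_comm]
  map_mul' v w := by ext1 <;> simp

theorem gaugeHom_apply (a : P.gl) (w : P.Vle) :
    P.gaugeHom a w = inl w + inr (P.gaugeDer a w) := rfl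

theorem isDiffHom_gaugeHom (a : P.gl) : IsDiffHom (P.gaugeHom a) := by
  refine isDiffHom_of_generators (fun c => ?_) (fun y n => ?_)
  · rw [gaugeHom_apply, MvPolynomial.derivation_C, inr_zero, add_zero, deriv_gaugeExt, fst_inl,
      snd_inl, lamD_zero, deriv_C, inl_zero, inr_zero, add_zero]
  · rw [gaugeHom_apply, gaugeHom_apply, gaugeDer_X, gaugeDer_X, deriv_gaugeExt]
    ext1
    · simp [deriv_X]
    · simp [Function.iterate_succ_apply']

theorem mem_wAlgebra {w : P.Vle} :
    w ∈ P.wAlgebra ↔ ∀ a ∈ P.gGe, P.gaugeHom a w = inlHom P.Vle _ w := by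
  refine forall₂_congr fun a _ => ?_
  rw [map_rho_affineBracket_emb, gaugeHom_apply, inlHom_apply, add_eq_left]
  exact (inr_injective.eq_iff' (inr_zero _)).symm

theorem gaugeLin_eq (a : P.gl) (x y : P.Box) : P.gaugeLin a (y, x) =
    Polynomial.C (MvPolynomial.C (a x y)) * Polynomial.X +
      Polynomial.C ((P.genM * P.constMat a) x y) -
      Polynomial.C ((P.constMat a * P.genM) x y) := by
  rw [gaugeLin, trace_mul_matUnit, emb_lie_matUnit, Matrix.mul_apply, Matrix.mul_apply, map_sub,
    map_sum, map_sum, map_sub, add_comm, add_sub_assoc]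
  simp only [map_mul, rho_C, rho_X_eq_genM, constMat_apply, mul_comm]

theorem eq_zero_of_mem_gGe {a : P.gl} (ha : a ∈ P.gGe) {x y : P.Box} (h : P.ht x ≤ P.ht y) :
    a x y = 0 := by
  by_contra hne
  have hdeg := (P.le_deg_iff (x, y)).1 (ha (x, y) hne)
  simp only at hdeg
  omega

theorem gaugeHom_genM {a : P.gl} (ha : a ∈ P.gGe) (x y : P.Box) :
    P.gaugeHom a (P.genM x y) = inl (P.genM x y) + inr (P.gaugeLin a (y, x)) := by
  have hgen : P.gaugeDer a (P.genM x y) = P.gaugeDer a (P.genQ x y) := by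
    rw [genM, Matrix.add_apply, constMat_apply, map_add, MvPolynomial.derivation_C, add_zero]
  rw [gaugeHom_apply, hgen, genQ_apply]
  split_ifs with h
  · rw [gaugeDer_X, Function.iterate_zero_apply]
  · rw [deg_le_iff] at h
    simp only at h
    have hleft : (P.genM * P.constMat a) x y = 0 := by
      rw [Matrix.mul_apply]
      refine Finset.sum_eq_zero fun z _ => ?_
      rcases le_or_gt (P.ht z) (P.ht y) with hz | hz
      · rw [constMat_apply, P.eq_zero_of_mem_gGe ha hz, map_zero, mul_zero]
      · rw [P.genM_eq_zero (by omega), zero_mul]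
    have hright : (P.constMat a * P.genM) x y = 0 := by
      rw [Matrix.mul_apply]
      refine Finset.sum_eq_zero fun z _ => ?_
      rcases le_or_gt (P.ht x) (P.ht z) with hz | hz
      · rw [constMat_apply, P.eq_zero_of_mem_gGe ha hz, map_zero, zero_mul]
      · rw [P.genM_eq_zero (by omega), mul_zero]
    rw [gaugeLin_eq, hleft, hright, P.eq_zero_of_mem_gGe ha (by omega)]
    simp only [map_zero, zero_mul, add_zero, sub_zero]

/-- The infinitesimal gauge parameter `ε a`. -/
def gaugeEps (a : P.gl) : Matrix P.Box P.Box (GaugeExt P.Vle) :=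
  a.map fun c => inr (Polynomial.C (MvPolynomial.C c))

theorem map_deriv_gaugeEps (a : P.gl) : (P.gaugeEps a).map (fun x => x′) =
    a.map fun c => inr (Polynomial.C (MvPolynomial.C c) * Polynomial.X) := by
  ext1 x y
  simp only [Matrix.map_apply, gaugeEps, deriv_gaugeExt, fst_inr, map_zero, inl_zero, snd_inr,
    zero_add, lamD_C_C]

theorem map_inlHom_mul_gaugeEps (M : Matrix P.Box P.Box P.Vle) (a : P.gl) :
    M.map (inlHom P.Vle _) * P.gaugeEps a =
      (M * P.constMat a).map fun x => inr (Polynomial.C x) := by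
  ext1 x y
  simp only [Matrix.mul_apply, Matrix.map_apply, constMat_apply, gaugeEps, inlHom_apply,
    inl_mul_inr, Polynomial.smul_C, smul_eq_mul, map_sum, inr_sum]

theorem gaugeEps_mul_map_inlHom (M : Matrix P.Box P.Box P.Vle) (a : P.gl) :
    P.gaugeEps a * M.map (inlHom P.Vle _) =
      (P.constMat a * M).map fun x => inr (Polynomial.C x) := by
  ext1 x y
  simp only [Matrix.mul_apply, Matrix.map_apply, constMat_apply, gaugeEps, inlHom_apply,
    inr_mul_inl, op_smul_eq_smul, Polynomial.smul_C, smul_eq_mul, map_sum, inr_sum]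
  simp only [mul_comm]

theorem map_gaugeHom_mul_gaugeEps (M : Matrix P.Box P.Box P.Vle) (a : P.gl) :
    M.map (P.gaugeHom a) * P.gaugeEps a = M.map (inlHom P.Vle _) * P.gaugeEps a := by
  ext1 x y
  simp only [Matrix.mul_apply, Matrix.map_apply, gaugeEps, gaugeHom_apply, inlHom_apply, add_mul,
    inr_mul_inr, add_zero]

theorem map_gaugeHom_genM {a : P.gl} (ha : a ∈ P.gGe) :
    P.genM.map (P.gaugeHom a) = P.genM.map (inlHom P.Vle _) + (P.gaugeEps a).map (fun x => x′) +
      P.genM.map (P.gaugeHom a) * P.gaugeEps a - P.gaugeEps a * P.genM.map (inlHom P.Vle _) := by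
  rw [map_gaugeHom_mul_gaugeEps, map_deriv_gaugeEps, map_inlHom_mul_gaugeEps,
    gaugeEps_mul_map_inlHom]
  ext1 x y
  simp only [Matrix.sub_apply, Matrix.add_apply, Matrix.map_apply, P.gaugeHom_genM ha,
    gaugeLin_eq, inr_sub, inr_add, inlHom_apply, add_sub_assoc, add_assoc]

/-- The gauge transformation matrix `1 - ε a`. -/
def gaugeMat (a : P.gl) : Matrix P.Box P.Box (PsiDO (GaugeExt P.Vle)) :=
  1 - (P.gaugeEps a).map const

theorem gaugeMat_mem_unitri {a : P.gl} (ha : a ∈ P.gGe) :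
    P.gaugeMat a ∈ unitri P.ht (diffOps (GaugeExt P.Vle)) := by
  refine one_sub_mem_unitri fun x y => ⟨isDiffOp_const _, fun h => ?_⟩
  rw [Matrix.map_apply, gaugeEps, Matrix.map_apply, P.eq_zero_of_mem_gGe ha (not_lt.1 h), map_zero,
    map_zero, inr_zero, const_zero]

theorem rhoA_map {S : Type*} [CommRing S] [Differential S] {φ : P.Vle →+* S} (hφ : IsDiffHom φ) :
    P.rhoA.map (mapHom φ hφ) = Matrix.diagonal (fun _ => D) + (P.genM.map φ).map const := by
  rw [rhoA_eq_genM, Matrix.map_add _ (map_add _), Matrix.diagonal_map (map_zero _)]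
  congr 1
  · simp only [mapHom_D]
  · ext1 x y
    exact mapHom_const (hφ := hφ) _

end Pyramid

namespace PsiDO

theorem diagonal_D_mul_map_const {R : Type*} [CommRing R] [Differential R] {n : Type*} [Fintype n]
    [DecidableEq n] (N : Matrix n n R) : Matrix.diagonal (fun _ => D) * N.map const =
      N.map const * Matrix.diagonal (fun _ => D) + (N.map fun x => x′).map const := by
  ext1 x y
  rw [Matrix.diagonal_mul, Matrix.add_apply, Matrix.mul_diagonal]
  exact D_mul_const _

end PsiDO

namespace Pyramid

open PsiDO TrivSqZeroExt

variable {r : ℕ} (P : Pyramid r)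

theorem rhoA_map_mul_gaugeMat {a : P.gl} (ha : a ∈ P.gGe) :
    P.rhoA.map (mapHom (P.gaugeHom a) (P.isDiffHom_gaugeHom a)) * P.gaugeMat a =
      P.gaugeMat a * P.rhoA.map (mapHom (inlHom P.Vle _) isDiffHom_inlHom) := by
  have hD := diagonal_D_mul_map_const (P.gaugeEps a)
  have hM := congrArg (constHom (GaugeExt P.Vle)).mapMatrix (P.map_gaugeHom_genM ha)
  have hconst (A : Matrix P.Box P.Box (GaugeExt P.Vle)) :
    A.map const = (constHom (GaugeExt P.Vle)).mapMatrix A := rfl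
  simp only [hconst, map_add, map_sub, map_mul] at hD hM
  rw [rhoA_map, rhoA_map, gaugeMat]
  simp only [hconst, mul_sub, sub_mul, add_mul, mul_add, mul_one, one_mul, hD]
  nth_rewrite 1 [hM]
  abel

theorem submatrix_firstBox_mem_unitri {A : Type*} [Ring A] {S : Subring A}
    {M : Matrix P.Box P.Box A} (hM : M ∈ unitri P.ht S) :
    M.submatrix P.firstBox P.firstBox ∈ unitri P.part S := by
  refine fun a b => (submatrix_mem_unitri hM P.firstBox_injective a b).imp_right
    fun h hlt => h fun hlt' => hlt ?_
  simp only [Function.comp, ht_firstBox] at hlt'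
  omega

theorem submatrix_lastBox_mem_unitri {A : Type*} [Ring A] {S : Subring A}
    {M : Matrix P.Box P.Box A} (hM : M ∈ unitri P.ht S) :
    M.submatrix P.lastBox P.lastBox ∈ unitri (toDual ∘ P.part) S := by
  refine fun a b => (submatrix_mem_unitri hM P.lastBox_injective a b).imp_right
    fun h hlt => h fun hlt' => hlt ?_
  simp only [Function.comp, ht_lastBox] at hlt'
  exact OrderDual.toDual_lt_toDual.2 (by omega)

theorem unitriEquiv_opT_map {R : Type*} [CommRing R] [Differential R] {φ ψ : P.Vle →+* R}
    (hφ : IsDiffHom φ) (hψ : IsDiffHom ψ) {g : Matrix P.Box P.Box (PsiDO R)}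
    (hg : g ∈ unitri P.ht (diffOps R))
    (h : P.rhoA.map (mapHom φ hφ) * g = g * P.rhoA.map (mapHom ψ hψ)) :
    UnitriEquiv P.part (P.opT.map (mapHom φ hφ)) (P.opT.map (mapHom ψ hψ)) := by
  set φ' := mapHom φ hφ
  set ψ' := mapHom ψ hψ
  have hA := P.submatrix_lastBox_mem_unitri (mul_mem hg
    (map_mem_unitri (φ := ψ') P.rightRes_mem_unitri fun _ hs => IsDiffOp.mapHom hs))
  have hB := P.submatrix_firstBox_mem_unitri (mul_mem
    (map_mem_unitri (φ := φ') P.leftRes_mem_unitri fun _ hs => IsDiffOp.mapHom hs) hg)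
  refine ⟨_, ringInverse_mem_unitri hB, _, hA, ?_⟩
  rw [mul_assoc, Ring.inverse_mul_eq_iff_eq_mul _ _ _ (isUnit_of_mem_unitri hB)]
  have hright : P.rhoA.map ψ' * (P.rightRes.map ψ' * selR (PsiDO R) P.lastBox) =
      selR (PsiDO R) P.firstBox * P.opT.map ψ' := by
    rw [← selR_map ψ', ← selR_map ψ', ← Matrix.map_mul, ← Matrix.map_mul, ← Matrix.map_mul,
      rhoA_mul_rightRes]
  have hleft : selL (PsiDO R) P.firstBox * P.leftRes.map φ' * P.rhoA.map φ' =
      P.opT.map φ' * selL (PsiDO R) P.lastBox := by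
    rw [← selL_map φ', ← selL_map φ', ← Matrix.map_mul, ← Matrix.map_mul, ← Matrix.map_mul,
      leftRes_mul_rhoA]
  rw [← selL_mul_mul_selR, ← selL_mul_mul_selR]
  calc P.opT.map φ' * (selL (PsiDO R) P.lastBox * (g * P.rightRes.map ψ') *
        selR (PsiDO R) P.lastBox)
      = selL (PsiDO R) P.firstBox * P.leftRes.map φ' * (P.rhoA.map φ' * g) *
          (P.rightRes.map ψ' * selR (PsiDO R) P.lastBox) := by
        simp only [← Matrix.mul_assoc, hleft]
    _ = selL (PsiDO R) P.firstBox * (P.leftRes.map φ' * g) *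
          (P.rhoA.map ψ' * (P.rightRes.map ψ' * selR (PsiDO R) P.lastBox)) := by
        simp only [h, Matrix.mul_assoc]
    _ = selL (PsiDO R) P.firstBox * (P.leftRes.map φ' * g) * selR (PsiDO R) P.firstBox *
          P.opT.map ψ' := by rw [hright, Matrix.mul_assoc _ (selR _ _)]

theorem unitriEquiv_opT_map_gaugeHom {a : P.gl} (ha : a ∈ P.gGe) :
    UnitriEquiv P.part (P.opT.map (mapHom (P.gaugeHom a) (P.isDiffHom_gaugeHom a)))
      (P.opT.map (mapHom (inlHom P.Vle _) isDiffHom_inlHom)) :=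
  P.unitriEquiv_opT_map _ _ (P.gaugeMat_mem_unitri ha) (P.rhoA_map_mul_gaugeMat ha)

end Pyramid

/-! ### Restriction to the slice -/

theorem der_X {σ : Type*} (n : ℕ) (y : σ) :
    PsiDO.der n (MvPolynomial.X (y, 0) : DiffPoly σ) = MvPolynomial.X (y, n) := by
  induction n with
  | zero => rfl
  | succ n ih => rw [PsiDO.der_succ, ih, deriv_X]

theorem matUnit_apply_of_ne {n : Type*} [DecidableEq n] {x y : n × n} (h : x ≠ y) :
    matUnit x y.1 y.2 = 0 := by
  rw [matUnit, Matrix.single_apply, if_neg fun h' => h (Prod.ext h'.1 h'.2)]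

theorem matUnit_apply_self {n : Type*} [DecidableEq n] (x : n × n) : matUnit x x.1 x.2 = 1 :=
  Matrix.single_apply_same ..

namespace Pyramid

open PsiDO

variable {r : ℕ} (P : Pyramid r)

/-- The matrix units `E_{(a,i),(b,1)}` whose transposes span `U`; the corresponding variables are
the coordinates on the slice. -/
def IsU (y : P.Box × P.Box) : Prop :=
  (y.2.2 : ℕ) = 0 ∧ P.part y.1.1 ≤ (y.1.2 : ℕ) + P.part y.2.1

instance : DecidablePred P.IsU := fun y =>
  inferInstanceAs (Decidable ((y.2.2 : ℕ) = 0 ∧ P.part y.1.1 ≤ (y.1.2 : ℕ) + P.part y.2.1))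

section Centralizer

variable {P}

theorem IsU.deg_le {y : P.Box × P.Box} (h : P.IsU y) : P.deg y ≤ 1 / 2 := by
  obtain ⟨hcol, hrow⟩ := h
  rw [deg_le_iff]
  simp only [ht]
  omega

theorem lie_nilp_apply (a : P.gl) (x y : P.Box) : ⁅P.nilp, a⁆ x y =
    (if 0 < (x.2 : ℕ) then a (P.prev x) y else 0) -
      if h : (y.2 : ℕ) + 1 < P.part y.1 then a x (P.next y h) else 0 := by
  rw [Ring.lie_def, Matrix.sub_apply, nilp_eq_shiftF, shiftF_mul, mul_shiftF]

theorem mem_gf {a : P.gl} : a ∈ P.gf ↔ ∀ x y, (if 0 < (x.2 : ℕ) then a (P.prev x) y else 0) =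
    if h : (y.2 : ℕ) + 1 < P.part y.1 then a x (P.next y h) else 0 := by
  simp only [← sub_eq_zero (b := dite _ _ _), ← lie_nilp_apply]
  exact Matrix.ext_iff.symm

theorem apply_eq_of_mem_gf {a : P.gl} (ha : a ∈ P.gf) {x y : P.Box} (hy : 0 < (y.2 : ℕ)) :
    a x y = if 0 < (x.2 : ℕ) then a (P.prev x) (P.prev y) else 0 := by
  rw [mem_gf.1 ha, dif_pos (P.prev_lt hy), P.next_prev hy]

theorem apply_eq_zero_of_mem_gf {a : P.gl} (ha : a ∈ P.gf) {x y : P.Box}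
    (h : (x.2 : ℕ) + P.part y.1 < P.part x.1 + (y.2 : ℕ)) : a x y = 0 := by
  obtain ⟨n, hn⟩ : ∃ n, (y.2 : ℕ) + n + 1 = P.part y.1 :=
    ⟨P.part y.1 - y.2 - 1, by have := y.2.2; omega⟩
  induction n generalizing x y with
  | zero =>
    have hx : (x.2 : ℕ) + 1 < P.part x.1 := by omega
    have hpos : 0 < ((P.next x hx).2 : ℕ) := Nat.succ_pos _
    have := mem_gf.1 ha (P.next x hx) y
    rwa [dif_neg (by omega), if_pos hpos] at this
  | succ n ih =>
    have hx : (x.2 : ℕ) + 1 < P.part x.1 := by omega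
    have hy : (y.2 : ℕ) + 1 < P.part y.1 := by omega
    have hpos : 0 < ((P.next x hx).2 : ℕ) := Nat.succ_pos _
    have heq := apply_eq_of_mem_gf ha (x := P.next x hx) (y := P.next y hy) (Nat.succ_pos _)
    rw [if_pos hpos, prev_next, prev_next] at heq
    exact heq.symm.trans (ih (by simp only [next]; omega) (by simp only [next]; omega))

theorem eq_zero_of_mem_gf {a : P.gl} (ha : a ∈ P.gf) (h : ∀ y, P.IsU y → a y.1 y.2 = 0) :
    a = 0 := by
  ext x y
  rw [Matrix.zero_apply]
  induction hn : (y.2 : ℕ) generalizing x y with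
  | zero =>
    by_cases hU : P.part x.1 ≤ (x.2 : ℕ) + P.part y.1
    · exact h (x, y) ⟨hn, hU⟩
    · exact apply_eq_zero_of_mem_gf ha (by omega)
  | succ n ih =>
    rw [apply_eq_of_mem_gf ha (by omega), ih _ _ (by simp only [prev]; omega), ite_self]

end Centralizer

/-- The basis of `g^f` dual to `U`, indexed by `IsU`: this is `f_{ab;i}` for `y = uPos a b i`. -/
def fU (y : P.Box × P.Box) : P.gl := Matrix.of fun x z =>
  if x.1 = y.1.1 ∧ z.1 = y.2.1 ∧ (x.2 : ℕ) = (y.1.2 : ℕ) + (z.2 : ℕ) then 1 else 0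

theorem fU_apply (y : P.Box × P.Box) (x z : P.Box) : P.fU y x z =
  if x.1 = y.1.1 ∧ z.1 = y.2.1 ∧ (x.2 : ℕ) = (y.1.2 : ℕ) + (z.2 : ℕ) then 1 else 0 := rfl

theorem fU_mem_gf {y : P.Box × P.Box} (h : P.IsU y) : P.fU y ∈ P.gf := by
  refine mem_gf.2 fun x z => ?_
  have hrow := h.2
  have hx := x.2.2
  have hz := z.2.2
  simp only [fU_apply, prev, next]
  by_cases hblock : x.1 = y.1.1 ∧ z.1 = y.2.1
  · have hpx := congrArg P.part hblock.1
    have hpz := congrArg P.part hblock.2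
    simp only [hblock, true_and]
    split_ifs <;> first | rfl | omega
  · simp only [← and_assoc, hblock, false_and, if_false, ite_self, dite_eq_ite]

theorem fU_apply_of_isU {y z : P.Box × P.Box} (hy : P.IsU y) (hz : P.IsU z) :
    P.fU y z.1 z.2 = if z = y then 1 else 0 := by
  refine if_congr ⟨fun h => ?_, fun h => ?_⟩ rfl rfl
  · exact Prod.ext (P.box_ext h.1 (by rw [h.2.2, hz.1, add_zero]))
      (P.box_ext h.2.1 (hz.1.trans hy.1.symm))
  · subst h
    exact ⟨rfl, rfl, by rw [hz.1, add_zero]⟩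

theorem eq_sum_fU {a : P.gl} (ha : a ∈ P.gf) :
    a = ∑ y with P.IsU y, a y.1 y.2 • P.fU y := by
  let commutant : Submodule ℂ P.gl :=
    LinearMap.ker (LinearMap.mulLeft ℂ P.nilp - LinearMap.mulRight ℂ P.nilp)
  have hmem : a - ∑ y with P.IsU y, a y.1 y.2 • P.fU y ∈ P.gf :=
    commutant.sub_mem ha (commutant.sum_mem fun y hy =>
      commutant.smul_mem _ (P.fU_mem_gf (Finset.mem_filter.1 hy).2))
  refine sub_eq_zero.1 (eq_zero_of_mem_gf hmem fun z hz => ?_)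
  rw [Matrix.sub_apply, Matrix.sum_apply, Finset.sum_eq_single z]
  · rw [Matrix.smul_apply, P.fU_apply_of_isU hz hz, if_pos rfl, smul_eq_mul, mul_one, sub_self]
  · intro y hy hyz
    rw [Matrix.smul_apply, P.fU_apply_of_isU (Finset.mem_filter.1 hy).2 hz, if_neg hyz.symm,
      smul_zero]
  · exact fun h => absurd (Finset.mem_filter.2 ⟨Finset.mem_univ z, hz⟩) h

/-- The position `((a, p_a - i), (b, 1))` of the coordinate dual to `f_{ab;i}`. -/
def uPos (a b : Fin r) (i : Fin (min (P.part a) (P.part b))) : P.Box × P.Box :=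
  (⟨a, ⟨P.part a - 1 - i, by have := i.2; omega⟩⟩, P.firstBox b)

theorem isU_uPos (a b : Fin r) (i : Fin (min (P.part a) (P.part b))) : P.IsU (P.uPos a b i) := by
  have hi := i.2
  refine ⟨rfl, ?_⟩
  simp only [uPos, firstBox]
  omega

theorem exists_uPos {y : P.Box × P.Box} (h : P.IsU y) : ∃ a b i, y = P.uPos a b i := by
  obtain ⟨hcol, hrow⟩ := h
  refine ⟨y.1.1, y.2.1, ⟨P.part y.1.1 - 1 - y.1.2, by omega⟩,
    Prod.ext (P.box_ext rfl ?_) (P.box_ext rfl hcol)⟩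
  simp only [uPos]
  omega

theorem fElt_eq (a b : Fin r) (i : Fin (min (P.part a) (P.part b))) :
    P.fElt a b i = P.fU (P.uPos a b i) := by
  ext x z
  have hx := x.2.2
  rw [fElt, Matrix.sum_apply, fU_apply]
  simp only [matUnit, Matrix.single_apply, uPos, firstBox]
  by_cases h : x.1 = a ∧ z.1 = b ∧ (x.2 : ℕ) = P.part a - 1 - i + z.2
  · refine Eq.trans ?_ (if_pos h).symm
    obtain ⟨hxa, hzb, hcol⟩ := h
    have hpart := congrArg P.part hxa
    rw [Finset.sum_eq_single ⟨(z.2 : ℕ), by omega⟩, if_pos]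
    · exact ⟨P.box_ext hxa.symm hcol.symm, P.box_ext hzb.symm rfl⟩
    · intro j _ hj
      refine if_neg ?_
      rintro ⟨-, rfl⟩
      exact hj rfl
    · exact fun h => absurd (Finset.mem_univ _) h
  · refine Eq.trans ?_ (if_neg h).symm
    refine Finset.sum_eq_zero fun j _ => if_neg ?_
    rintro ⟨rfl, rfl⟩
    exact h ⟨rfl, rfl, rfl⟩

theorem embLe_sum_smul {ι : Type*} (s : Finset ι) (c : ι → ℂ) (m : ι → P.gl) :
    P.embLe (∑ i ∈ s, c i • m i) = ∑ i ∈ s, MvPolynomial.C (c i) * P.embLe (m i) := by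
  simp only [embLe, Matrix.sum_apply, Matrix.smul_apply, map_sum, Finset.sum_mul, Finset.mul_sum,
    smul_eq_mul, map_mul, mul_assoc]
  exact Finset.sum_comm

theorem embLe_matUnit {y : P.Box × P.Box} (h : P.deg y ≤ 1 / 2) :
    P.embLe (matUnit y) = MvPolynomial.X (⟨y, h⟩, 0) := by
  rw [embLe, Finset.sum_eq_single ⟨y, h⟩]
  · rw [matUnit_apply_self, map_one, one_mul]
  · intro z _ hz
    rw [matUnit_apply_of_ne fun h' => hz (Subtype.ext h'.symm), map_zero, zero_mul]
  · exact fun h => absurd (Finset.mem_univ _) h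

section SliceHom

variable (g : P.Box × P.Box → P.Vle)

/-- The differential algebra endomorphism that sends the coordinates on the slice to given
elements and all other generators to zero. -/
def sliceHom : P.Vle →ₐ[ℂ] P.Vle :=
  MvPolynomial.aeval fun y => if P.IsU y.1.1 then der y.2 (g y.1.1) else 0

theorem sliceHom_X_of_isU {y : {x : P.Box × P.Box // P.deg x ≤ 1 / 2}} (h : P.IsU y.1) (n : ℕ) :
    P.sliceHom g (MvPolynomial.X (y, n)) = der n (g y.1) := by
  rw [sliceHom, MvPolynomial.aeval_X, if_pos h]

theorem sliceHom_X_of_not_isU {y : {x : P.Box × P.Box // P.deg x ≤ 1 / 2}} (h : ¬ P.IsU y.1)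
    (n : ℕ) : P.sliceHom g (MvPolynomial.X (y, n)) = 0 := by
  rw [sliceHom, MvPolynomial.aeval_X, if_neg h]

theorem sliceHom_C (c : ℂ) : P.sliceHom g (MvPolynomial.C c) = MvPolynomial.C c :=
  (P.sliceHom g).commutes c

theorem isDiffHom_sliceHom : IsDiffHom (P.sliceHom g).toRingHom := by
  refine isDiffHom_of_generators (fun c => ?_) (fun y n => ?_)
  · exact (congrArg _ (P.sliceHom_C g c)).trans (deriv_C c)
  · change P.sliceHom g _ = Differential.deriv (P.sliceHom g _)
    by_cases h : P.IsU y.1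
    · rw [sliceHom_X_of_isU _ _ h, sliceHom_X_of_isU _ _ h, der_succ]
    · rw [sliceHom_X_of_not_isU _ _ h, sliceHom_X_of_not_isU _ _ h, map_zero]

theorem sliceHom_der (n : ℕ) (x : P.Vle) : P.sliceHom g (der n x) = der n (P.sliceHom g x) :=
  (P.isDiffHom_sliceHom g).map_der n x

theorem sliceHom_embLe (a : P.gl) :
    P.sliceHom g (P.embLe a) = ∑ y with P.IsU y, MvPolynomial.C (a y.1 y.2) * g y := by
  let term (y : P.Box × P.Box) : P.Vle :=
    if P.IsU y then MvPolynomial.C (a y.1 y.2) * g y else 0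
  have hterm (y : {x : P.Box × P.Box // P.deg x ≤ 1 / 2}) :
      MvPolynomial.C (a y.1.1 y.1.2) * P.sliceHom g (MvPolynomial.X (y, 0)) = term y.1 := by
    by_cases h : P.IsU y.1
    · rw [sliceHom_X_of_isU _ _ h, der_zero_left]
      exact (if_pos h).symm
    · rw [sliceHom_X_of_not_isU _ _ h, mul_zero]
      exact (if_neg h).symm
  have hfilter : (Finset.univ.filter fun y => P.deg y ≤ 1 / 2 ∧ P.IsU y) =
      Finset.univ.filter P.IsU :=
    Finset.filter_congr fun y _ => and_iff_right_of_imp fun h => h.deg_le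
  simp only [embLe, map_sum, map_mul, sliceHom_C, hterm]
  rw [← Finset.subtype_univ, Finset.sum_subtype_eq_sum_filter, ← Finset.sum_filter,
    Finset.filter_filter, hfilter]

theorem sliceHom_sliceHom {g g' : P.Box × P.Box → P.Vle}
    (h : ∀ y, P.IsU y → P.sliceHom g (g' y) = g y) (x : P.Vle) :
    P.sliceHom g (P.sliceHom g' x) = P.sliceHom g x := by
  have hcomp : (P.sliceHom g).comp (P.sliceHom g') = P.sliceHom g := by
    refine MvPolynomial.algHom_ext fun ⟨y, n⟩ => ?_
    rw [AlgHom.comp_apply]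
    by_cases hy : P.IsU y.1
    · rw [sliceHom_X_of_isU _ _ hy, sliceHom_X_of_isU _ _ hy, sliceHom_der, h _ hy]
    · rw [sliceHom_X_of_not_isU _ _ hy, sliceHom_X_of_not_isU _ _ hy, map_zero]
  exact DFunLike.congr_fun hcomp x

end SliceHom

/-- Restriction to the slice: the generators that are not coordinates on the slice are set to
zero. -/
def kappa : P.Vle →ₐ[ℂ] P.Vle := P.sliceHom fun y => P.embLe (matUnit y)

theorem isDiffHom_kappa : IsDiffHom P.kappa.toRingHom := P.isDiffHom_sliceHom _

theorem kappa_X_of_isU {y : {x : P.Box × P.Box // P.deg x ≤ 1 / 2}} (h : P.IsU y.1) (n : ℕ) :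
    P.kappa (MvPolynomial.X (y, n)) = MvPolynomial.X (y, n) := by
  rw [kappa, sliceHom_X_of_isU _ _ h, embLe_matUnit _ y.2, der_X]

theorem kappa_X_of_not_isU {y : {x : P.Box × P.Box // P.deg x ≤ 1 / 2}} (h : ¬ P.IsU y.1)
    (n : ℕ) : P.kappa (MvPolynomial.X (y, n)) = 0 := P.sliceHom_X_of_not_isU _ h n

theorem kappa_sliceHom {g : P.Box × P.Box → P.Vle}
    (h : ∀ y, P.IsU y → P.kappa (g y) = P.embLe (matUnit y)) (x : P.Vle) :
    P.kappa (P.sliceHom g x) = P.kappa x := P.sliceHom_sliceHom h x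

theorem sliceHom_kappa (g : P.Box × P.Box → P.Vle) (x : P.Vle) :
    P.sliceHom g (P.kappa x) = P.sliceHom g x := by
  refine P.sliceHom_sliceHom (fun y hy => ?_) x
  rw [embLe_matUnit _ hy.deg_le, sliceHom_X_of_isU _ _ hy, der_zero_left]

theorem kappa_embLe_fU {y : P.Box × P.Box} (h : P.IsU y) :
    P.kappa (P.embLe (P.fU y)) = P.embLe (matUnit y) := by
  rw [kappa, sliceHom_embLe, Finset.sum_eq_single y]
  · rw [P.fU_apply_of_isU h h, if_pos rfl, map_one, one_mul]
  · intro z hz hzy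
    rw [P.fU_apply_of_isU h (Finset.mem_filter.1 hz).2, if_neg hzy, map_zero, zero_mul]
  · exact fun h' => absurd (Finset.mem_filter.2 ⟨Finset.mem_univ _, h⟩) h'

theorem sub_kappa_mem (x : P.Vle) : x - P.kappa x ∈ Ideal.span (MvPolynomial.X ''
    {y : {x : P.Box × P.Box // P.deg x ≤ 1 / 2} × ℕ | ¬ P.IsU y.1.1} : Set P.Vle) := by
  set J : Ideal P.Vle := Ideal.span (MvPolynomial.X '' {y | ¬ P.IsU y.1.1})
  have hmod : (Ideal.Quotient.mkₐ ℂ J).comp P.kappa = Ideal.Quotient.mkₐ ℂ J := by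
    refine MvPolynomial.algHom_ext fun ⟨y, n⟩ => ?_
    rw [AlgHom.comp_apply]
    by_cases hy : P.IsU y.1
    · rw [kappa_X_of_isU _ hy]
    · rw [kappa_X_of_not_isU _ hy, map_zero]
      exact (Ideal.Quotient.eq_zero_iff_mem.2 (Ideal.subset_span
        (Set.mem_image_of_mem _ hy))).symm
  exact Ideal.Quotient.eq.1 (DFunLike.congr_fun hmod x).symm

theorem matUnit_mem_uPerp {y : P.Box × P.Box} (hd : P.deg y ≤ 1 / 2) (h : ¬ P.IsU y) :
    matUnit y ∈ P.uPerp := by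
  refine ⟨fun x hx => ?_, fun u hu => ?_⟩
  · rwa [← not_imp_comm.1 matUnit_apply_of_ne hx]
  · rw [Matrix.trace_mul_comm, trace_mul_matUnit]
    induction hu using Submodule.span_induction with
    | mem u hu =>
      obtain ⟨a, b, i, rfl⟩ := hu
      refine matUnit_apply_of_ne (y := (y.2, y.1)) fun h' => h ?_
      obtain rfl : P.uPos a b i = y := congrArg Prod.swap h'
      exact P.isU_uPos a b i
    | zero => rfl
    | add u v _ _ hu hv => rw [Matrix.add_apply, hu, hv, add_zero]
    | smul c u _ hu => rw [Matrix.smul_apply, hu, smul_zero]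

theorem apply_eq_zero_of_mem_uPerp {u : P.gl} (hu : u ∈ P.uPerp) {y : P.Box × P.Box}
    (hy : P.IsU y) : u y.1 y.2 = 0 := by
  obtain ⟨a, b, i, rfl⟩ := P.exists_uPos hy
  have := hu.2 _ (Submodule.subset_span ⟨a, b, i, rfl⟩)
  rwa [trace_mul_matUnit] at this

theorem mem_uPerpIdeal {x : P.Vle} : x ∈ P.uPerpIdeal ↔ P.kappa x = 0 := by
  constructor
  · intro hx
    change x ∈ RingHom.ker P.kappa
    refine Ideal.span_le.2 ?_ hx
    rintro _ ⟨u, hu, n, rfl⟩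
    change P.kappa _ = 0
    have hzero : ∀ y ∈ Finset.univ.filter P.IsU,
        MvPolynomial.C (u y.1 y.2) * P.embLe (matUnit y) = 0 := fun y hy => by
      rw [P.apply_eq_zero_of_mem_uPerp hu (Finset.mem_filter.1 hy).2, map_zero, zero_mul]
    rw [kappa, sliceHom_der, sliceHom_embLe, Finset.sum_eq_zero hzero, der_zero]
  · intro hx
    have hspan := P.sub_kappa_mem x
    rw [hx, sub_zero] at hspan
    refine Ideal.span_le.2 ?_ hspan
    rintro _ ⟨⟨y, n⟩, hy, rfl⟩
    refine Ideal.subset_span ⟨_, P.matUnit_mem_uPerp y.2 hy, n, ?_⟩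
    rw [embLe_matUnit _ y.2, der_X]

theorem sub_mem_uPerpIdeal {x q : P.Vle} : x - q ∈ P.uPerpIdeal ↔ P.kappa x = P.kappa q := by
  rw [mem_uPerpIdeal, map_sub, sub_eq_zero]

/-- The retraction of `𝒱(g_{≤ 1/2})` onto `𝒱(g^f)` with kernel `⟨U^⊥⟩`. -/
def toGf : P.Vle →ₐ[ℂ] P.Vle := P.sliceHom fun y => P.embLe (P.fU y)

theorem toGf_mem (x : P.Vle) : P.toGf x ∈ P.vgf := by
  induction x using MvPolynomial.induction_on with
  | C c =>
    rw [toGf, sliceHom_C]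
    exact P.vgf.algebraMap_mem c
  | add p q hp hq =>
    rw [map_add]
    exact P.vgf.add_mem hp hq
  | mul_X p y hp =>
    rw [map_mul]
    refine P.vgf.mul_mem hp ?_
    obtain ⟨y, n⟩ := y
    by_cases hy : P.IsU y.1
    · rw [toGf, sliceHom_X_of_isU _ _ hy]
      exact Algebra.subset_adjoin ⟨_, P.fU_mem_gf hy, n, rfl⟩
    · rw [toGf, sliceHom_X_of_not_isU _ _ hy]
      exact P.vgf.zero_mem

theorem kappa_toGf (x : P.Vle) : P.kappa (P.toGf x) = P.kappa x :=
  P.kappa_sliceHom (fun _ hy => P.kappa_embLe_fU hy) x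

theorem toGf_eq_self {q : P.Vle} (hq : q ∈ P.vgf) : P.toGf q = q := by
  have hfix : P.vgf ≤ AlgHom.equalizer P.toGf (AlgHom.id ℂ P.Vle) := by
    refine Algebra.adjoin_le ?_
    rintro _ ⟨a, ha, n, rfl⟩
    change P.toGf _ = der n (P.embLe a)
    rw [toGf, sliceHom_der, sliceHom_embLe]
    conv_rhs => rw [P.eq_sum_fU ha, embLe_sum_smul]
  exact hfix hq

theorem eq_of_mem_vgf_of_kappa_eq {q q' : P.Vle} (hq : q ∈ P.vgf) (hq' : q' ∈ P.vgf)
    (h : P.kappa q = P.kappa q') : q = q' := by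
  have htoGf (x) : P.toGf (P.kappa x) = P.toGf x := P.sliceHom_kappa _ x
  rw [← P.toGf_eq_self hq, ← P.toGf_eq_self hq', ← htoGf q, h, htoGf]

theorem kappa_genQ (x y : P.Box) : P.kappa (P.genQ x y) =
    if P.IsU (y, x) then P.embLe (matUnit (y, x)) else 0 := by
  rw [genQ_apply]
  split_ifs with hdeg hU hU
  · rw [kappa_X_of_isU _ hU, embLe_matUnit]
  · exact P.kappa_X_of_not_isU hU 0
  · exact absurd hU.deg_le hdeg
  · exact map_zero _

theorem map_solX {R S : Type*} [CommRing R] [Differential R] [CommRing S] [Differential S]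
    {φ : R →+* S} (hφ : IsDiffHom φ) : (P.solX R).map (mapHom φ hφ) = P.solX S := by
  ext1 x b
  simp only [Matrix.map_apply, solX_apply, apply_ite (mapHom φ hφ), map_zero, map_pow, map_neg,
    mapHom_D]

theorem shiftE_mul_map_kappa_genQ :
    P.shiftE (PsiDO P.Vle) * (P.genQ.map P.kappa).map const = 0 := by
  ext1 x y
  rw [shiftE_mul, Matrix.zero_apply]
  split_ifs with h
  · have hzero : P.kappa (P.genQ (P.next x h) y) = 0 := by
      rw [kappa_genQ, if_neg fun hU => Nat.succ_ne_zero _ hU.1]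
    exact (congrArg const hzero).trans const_zero
  · rfl

theorem selL_first_mul_map_kappa_leftRes_mul :
    selL (PsiDO P.Vle) P.firstBox *
        P.leftRes.map (mapHom P.kappa.toRingHom P.isDiffHom_kappa) *
        (P.genQ.map P.kappa).map const =
      selL (PsiDO P.Vle) P.firstBox * (P.genQ.map P.kappa).map const := by
  generalize mapHom P.kappa.toRingHom P.isDiffHom_kappa = φ
  generalize hQ : (P.genQ.map P.kappa).map const = Q
  have hshift : P.shiftE (PsiDO P.Vle) * Q = 0 := hQ ▸ P.shiftE_mul_map_kappa_genQ
  have hres := congrArg (fun M => M.map φ) P.selL_first_mul_leftRes_mul_selR_first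
  simp only [Matrix.map_mul, selR_map, selL_map, Matrix.map_one _ (map_zero φ) (map_one φ)] at hres
  rw [P.eq_selR_first_mul_of_shiftE_mul_eq_zero hshift, ← Matrix.mul_assoc, hres, Matrix.one_mul,
    ← Matrix.mul_assoc, selL_mul_selR P.firstBox_injective, Matrix.one_mul]

theorem map_opT_kappa : P.opT.map (mapHom P.kappa.toRingHom P.isDiffHom_kappa) =
    (topUnit P.Vle P.part).val + selL (PsiDO P.Vle) P.firstBox *
      (P.genQ.map P.kappa).map const * P.solX P.Vle := by
  have hQ : (P.genQ.map const).map (mapHom P.kappa.toRingHom P.isDiffHom_kappa) =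
      (P.genQ.map P.kappa).map const := by
    ext1 x y
    exact mapHom_const (hφ := P.isDiffHom_kappa) _
  rw [opT_eq_topUnit_add, Matrix.map_add _ (map_add _), map_topUnit, Matrix.map_mul,
    Matrix.map_mul, Matrix.map_mul, hQ, selL_map, map_solX, selL_first_mul_map_kappa_leftRes_mul]

theorem map_opT_kappa_sub_apply (a b : Fin r) :
    (P.opT.map (mapHom P.kappa.toRingHom P.isDiffHom_kappa) - (topUnit P.Vle P.part).val) a b =
      ∑ j : Fin (P.part b), const (P.kappa (P.genQ (P.firstBox a) ⟨b, j⟩)) *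
        (-D) ^ (P.part b - 1 - (j : ℕ)) := by
  rw [map_opT_kappa, add_sub_cancel_left, selL_mul, Matrix.mul_apply, Fintype.sum_sigma,
    Finset.sum_eq_single b]
  · refine Finset.sum_congr rfl fun j _ => ?_
    rw [solX_apply, if_pos rfl]
    rfl
  · intro c _ hc
    refine Finset.sum_eq_zero fun j _ => ?_
    rw [solX_apply, if_neg hc, mul_zero]
  · exact fun h => absurd (Finset.mem_univ b) h

theorem reduced_map_opT_kappa :
    Reduced P.part (P.opT.map (mapHom P.kappa.toRingHom P.isDiffHom_kappa)) := fun a b => by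
  rw [map_opT_kappa_sub_apply]
  refine OrdLE.sum fun j _ => ?_
  rw [kappa_genQ]
  split_ifs with h
  · have hrow := h.2
    simp only [firstBox] at hrow
    exact ((ordLE_const _).mul (ordLE_neg_D_pow _)).mono (by omega)
  · rw [const_zero, zero_mul]
    exact ordLE_zero _

theorem coeff_map_opT_kappa_sub (a b : Fin r) (i : Fin (min (P.part b) (P.part a))) :
    ((P.opT.map (mapHom P.kappa.toRingHom P.isDiffHom_kappa) -
      (topUnit P.Vle P.part).val) a b).coeff i =
        (-1) ^ (i : ℕ) * P.embLe (matUnit (P.uPos b a i)) := by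
  have hi := i.2
  have hexp : P.part b - 1 - (P.part b - 1 - (i : ℕ)) = i := by omega
  rw [map_opT_kappa_sub_apply, coeff_sum, Finset.sum_eq_single ⟨P.part b - 1 - i, by omega⟩]
  · have hgen : P.kappa (P.genQ (P.firstBox a) ⟨b, ⟨P.part b - 1 - i, by omega⟩⟩) =
        P.embLe (matUnit (P.uPos b a i)) :=
      (P.kappa_genQ _ _).trans (if_pos (P.isU_uPos b a i))
    rw [hexp, coeff_const_mul_neg_D_pow, if_pos rfl, hgen, mul_comm]
  · intro j _ hj
    rw [coeff_const_mul_neg_D_pow, if_neg]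
    refine fun h => hj (Fin.ext ?_)
    have := j.2
    simp only
    omega
  · exact fun h => absurd (Finset.mem_univ _) h

end Pyramid

/-! ### Injectivity of the restriction of the `W`-algebra to the slice -/

section Weight

variable {σ R : Type*} [CommRing R] (w : σ → ℕ)

variable (R) in
/-- The polynomials all of whose monomials have weight at least `j`. The bound is an integer, so
that lowering it needs no side condition. -/
def weightGE (j : ℤ) : Submodule R (MvPolynomial σ R) :=
  MvPolynomial.restrictSupport R {d | j ≤ (Finsupp.weight w d : ℕ)}

variable {w} {j k : ℤ} {p q : MvPolynomial σ R}

theorem mem_weightGE : p ∈ weightGE R w j ↔ ∀ d ∈ p.support, j ≤ (Finsupp.weight w d : ℕ) := Iff.rfl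

theorem weightGE_anti (hp : p ∈ weightGE R w j) (hk : k ≤ j) : p ∈ weightGE R w k :=
  fun _ hd => hk.trans (hp hd)

theorem mem_weightGE_of_nonpos (hj : j ≤ 0) (p : MvPolynomial σ R) : p ∈ weightGE R w j :=
  fun _ _ => hj.trans (Int.natCast_nonneg _)

theorem mul_mem_weightGE (hp : p ∈ weightGE R w j) (hq : q ∈ weightGE R w k) :
    p * q ∈ weightGE R w (j + k) := by
  have h := Submodule.mul_mem_mul hp hq
  rw [weightGE, weightGE, ← MvPolynomial.restrictSupport_add] at h
  refine MvPolynomial.restrictSupport_mono R ?_ h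
  rintro _ ⟨d, hd, e, he, rfl⟩
  rw [Set.mem_ofPred_eq] at hd he ⊢
  rw [map_add]
  push_cast
  omega

theorem monomial_mem_weightGE (d : σ →₀ ℕ) (c : R) :
    MvPolynomial.monomial d c ∈ weightGE R w (Finsupp.weight w d : ℕ) :=
  (MvPolynomial.monomial_mem_restrictSupport R).2 (Or.inl (le_refl (_ : ℤ)))

theorem X_mem_weightGE (i : σ) : (MvPolynomial.X i : MvPolynomial σ R) ∈ weightGE R w (w i) := by
  have h := monomial_mem_weightGE (R := R) (w := w) (Finsupp.single i 1) 1
  rwa [Finsupp.weight_single, one_smul] at h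

theorem derivation_mem_weightGE {s : ℤ} {E : Derivation R (MvPolynomial σ R) (MvPolynomial σ R)}
    (hE : ∀ i, E (MvPolynomial.X i) ∈ weightGE R w (w i + s)) (hp : p ∈ weightGE R w j) :
    E p ∈ weightGE R w (j + s) := by
  have hE_eq : E = MvPolynomial.mkDerivation R fun i => E (MvPolynomial.X i) :=
    MvPolynomial.derivation_ext fun i => by rw [MvPolynomial.mkDerivation_X]
  rw [p.as_sum, map_sum]
  refine sum_mem fun d hd => ?_
  rw [hE_eq, MvPolynomial.mkDerivation_monomial]
  refine Submodule.smul_mem _ _ (sum_mem fun i hi => ?_)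
  have hweight := Finsupp.weight_sub_single_add (w := w) (Finsupp.mem_support_iff.1 hi)
  have hj := mem_weightGE.1 hp d hd
  exact weightGE_anti (p := MvPolynomial.monomial _ _ * _)
    (mul_mem_weightGE (monomial_mem_weightGE _ _) (hE i)) (by omega)

/-- Comparing coefficients at `d - i`: the error `E - ∂/∂x_i` only contributes monomials of higher
weight. -/
theorem derivation_ne_zero_of_sub_pderiv_mem [IsDomain R] [CharZero R] {d : σ →₀ ℕ} {i : σ}
    (hd : d ∈ p.support) (hmin : p ∈ weightGE R w (Finsupp.weight w d : ℕ)) (hi : d i ≠ 0)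
    {E : Derivation R (MvPolynomial σ R) (MvPolynomial σ R)}
    (hE : ∀ v, E (MvPolynomial.X v) - MvPolynomial.pderiv i (MvPolynomial.X v) ∈
      weightGE R w (w v - w i + 1)) : E p ≠ 0 := by
  intro hzero
  have hweight := Finsupp.weight_sub_single_add (w := w) hi
  have hpderiv : MvPolynomial.pderiv i p ∈ weightGE R w ((Finsupp.weight w d : ℕ) - w i + 1) := by
    have hdiff := derivation_mem_weightGE (E := E - MvPolynomial.pderiv i) (s := 1 - w i)
      (fun v => weightGE_anti (hE v) (by omega)) hmin
    rw [Derivation.sub_apply, hzero, zero_sub, neg_mem_iff] at hdiff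
    exact weightGE_anti hdiff (by omega)
  have hcoeff : (MvPolynomial.pderiv i p).coeff (d - Finsupp.single i 1) ≠ 0 := by
    rw [MvPolynomial.coeff_pderiv, Finsupp.sub_add_single_one_cancel hi]
    exact mul_ne_zero (MvPolynomial.mem_support_iff.1 hd) (Nat.cast_add_one_ne_zero _)
  have hle := mem_weightGE.1 hpderiv _ (MvPolynomial.mem_support_iff.2 hcoeff)
  omega

end Weight

namespace Pyramid

open PsiDO

variable {r : ℕ} (P : Pyramid r)

/-- The subspace of `gl` spanned by the matrix units at the positions satisfying `p`. -/
def supportedOn (p : P.Box × P.Box → Prop) : Submodule ℂ P.gl where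
  carrier := {a | ∀ x, a x.1 x.2 ≠ 0 → p x}
  zero_mem' := fun _ hx => absurd rfl hx
  add_mem' := fun {a b} ha hb x hx => by
    by_cases h : a x.1 x.2 = 0
    · exact hb x fun h' => hx (by rw [Matrix.add_apply, h, h', add_zero])
    · exact ha x h
  smul_mem' := fun c a ha x hx => ha x fun h => hx (by rw [Matrix.smul_apply, h, smul_zero])

variable {P} in
theorem matUnit_mem_supportedOn {p : P.Box × P.Box → Prop} {y : P.Box × P.Box} (h : p y) :
    matUnit y ∈ P.supportedOn p := fun x hx => by
  rwa [← not_imp_comm.1 matUnit_apply_of_ne hx]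

theorem trace_nilp_mul_lie (a z : P.gl) :
    (P.nilp * ⁅a, z⁆).trace = -(a * ⁅P.nilp, z⁆).trace := by
  rw [Ring.lie_def, Ring.lie_def, mul_sub, mul_sub, Matrix.trace_sub, Matrix.trace_sub,
    Matrix.trace_mul_comm P.nilp (a * z), mul_assoc, Matrix.trace_mul_comm P.nilp (z * a),
    mul_assoc, Matrix.trace_mul_comm z, mul_assoc]
  ring

section Nondegenerate

/-- The positions of the variables that vanish on the slice. -/
def IsOffU (y : P.Box × P.Box) : Prop := P.deg y ≤ 1 / 2 ∧ ¬ P.IsU y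

variable {P}

theorem lie_nilp_apply_eq_zero {z : P.gl} (hz : ∀ x y, 1 < P.ht x - P.ht y → z x y = 0)
    {x y : P.Box} (h : P.ht y - P.ht x < 1) : ⁅P.nilp, z⁆ x y = 0 := by
  have hprev : (if 0 < (x.2 : ℕ) then z (P.prev x) y else 0) = 0 := by
    split_ifs with hx
    · exact hz _ _ (by rw [P.ht_prev hx]; omega)
    · rfl
  have hnext : (if hy : (y.2 : ℕ) + 1 < P.part y.1 then z x (P.next y hy) else 0) = 0 := by
    split_ifs with hy
    · exact hz _ _ (by rw [P.ht_next]; omega)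
    · rfl
  rw [lie_nilp_apply, hprev, hnext, sub_zero]

theorem eq_zero_of_trace_nilp_mul_lie_eq_zero {z : P.gl} (hz : z ∈ P.supportedOn P.IsOffU)
    (h : ∀ a ∈ P.gGe, (P.nilp * ⁅a, z⁆).trace = 0) : z = 0 := by
  have hdeg : ∀ x y, 1 < P.ht x - P.ht y → z x y = 0 := fun x y hxy => by
    by_contra hne
    have := (P.deg_le_iff (x, y)).1 (hz (x, y) hne).1
    simp only at this
    omega
  have hgf : z ∈ P.gf := by
    ext x y
    by_cases hxy : P.ht y - P.ht x < 1
    · exact lie_nilp_apply_eq_zero hdeg hxy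
    · have hmem : matUnit (y, x) ∈ P.gGe :=
        matUnit_mem_supportedOn (p := fun x => 1 / 2 ≤ P.deg x)
          ((P.le_deg_iff (y, x)).2 (by simp only; omega))
      have := h _ hmem
      rwa [trace_nilp_mul_lie, Matrix.trace_mul_comm, trace_mul_matUnit, neg_eq_zero] at this
  refine eq_zero_of_mem_gf hgf fun y hy => ?_
  by_contra hne
  exact (hz y hne).2 hy

/-- By nondegeneracy of `(a, z) ↦ (f|[a, z])`. -/
theorem exists_mem_gGe_trace_nilp_mul_lie (l : Module.Dual ℂ P.gl) :
    ∃ a ∈ P.gGe, ∀ z ∈ P.supportedOn P.IsOffU, (P.nilp * ⁅a, z⁆).trace = l z := by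
  let B : P.gl →ₗ[ℂ] P.gl →ₗ[ℂ] ℂ := LinearMap.mk₂ ℂ (fun z a => (P.nilp * ⁅a, z⁆).trace)
    (fun z z' a => by simp only [Ring.lie_def, add_mul, mul_add, mul_sub, Matrix.trace_add,
      Matrix.trace_sub]; ring)
    (fun c z a => by simp only [Ring.lie_def, smul_mul_assoc, mul_smul_comm, ← smul_sub,
      Matrix.trace_smul])
    (fun z a a' => by simp only [Ring.lie_def, add_mul, mul_add, mul_sub, Matrix.trace_add,
      Matrix.trace_sub]; ring)
    (fun c z a => by simp only [Ring.lie_def, smul_mul_assoc, mul_smul_comm, ← smul_sub,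
      Matrix.trace_smul])
  let B' := B.domRestrict₁₂ (P.supportedOn P.IsOffU) (P.supportedOn fun x => 1 / 2 ≤ P.deg x)
  have hB' : Function.Injective B' := (injective_iff_map_eq_zero B').2 fun z hz =>
    Subtype.ext (eq_zero_of_trace_nilp_mul_lie_eq_zero z.2 fun a ha =>
      LinearMap.congr_fun hz ⟨a, ha⟩)
  obtain ⟨a, ha⟩ := LinearMap.flip_surjective_iff₂.2 hB' (l.domRestrict (P.supportedOn P.IsOffU))
  exact ⟨a.1, a.2, fun z hz => LinearMap.congr_fun ha ⟨z, hz⟩⟩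

end Nondegenerate

/-- The weight of variables: `n + 1` on the slice and `n + 2` off the slice. The shift makes
`ρ{a_λ ·}`, for `a` dual to a variable off the slice, the corresponding partial derivative up to
terms of higher weight. -/
def wt (v : {x : P.Box × P.Box // P.deg x ≤ 1 / 2} × ℕ) : ℕ :=
  v.2 + 1 + if P.IsU v.1.1 then 0 else 1

theorem deriv_mem_weightGE {j : ℤ} {p : P.Vle} (hp : p ∈ weightGE ℂ P.wt j) :
    p′ ∈ weightGE ℂ P.wt (j + 1) := by
  refine derivation_mem_weightGE (E := MvPolynomial.mkDerivation ℂ fun y =>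
    MvPolynomial.X (y.1, y.2 + 1)) (fun y => ?_) hp
  rw [MvPolynomial.mkDerivation_X]
  exact weightGE_anti (X_mem_weightGE _) (by simp only [wt]; omega)

theorem rho_emb (a : P.gl) : P.rho (emb a) =
    ∑ x : P.Box × P.Box, a x.1 x.2 • P.genQ x.2 x.1 + MvPolynomial.C (P.nilp * a).trace := by
  rw [Matrix.trace_mul_comm, ← sum_mul_trace_matUnit_mul, emb, map_sum, map_sum,
    ← Finset.sum_add_distrib]
  refine Finset.sum_congr rfl fun x _ => ?_
  rw [map_mul, rho_C, rho_X_zero, map_mul, Matrix.trace_mul_comm, trace_mul_matUnit,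
    MvPolynomial.smul_eq_C_mul, mul_add]

theorem rho_emb_sub_mem (a : P.gl) :
    P.rho (emb a) - MvPolynomial.C (P.nilp * a).trace ∈ weightGE ℂ P.wt 1 := by
  rw [rho_emb, add_sub_cancel_right]
  refine sum_mem fun x _ => Submodule.smul_mem _ _ ?_
  rw [genQ_apply]
  split_ifs
  · exact weightGE_anti (X_mem_weightGE _) (by simp only [wt]; omega)
  · exact zero_mem _

theorem coeff_lamD_gaugeLin_sub_mem (a : P.gl) (x : P.Box × P.Box) (n k : ℕ) :
    (lamD^[n] (P.gaugeLin a x)).coeff k -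
      MvPolynomial.C (if k = n then (P.nilp * ⁅a, matUnit x⁆).trace else 0) ∈
        weightGE ℂ P.wt (n - k + 1) := by
  have hderiv {j : ℤ} {p : P.Vle} {c : ℂ} (h : p - MvPolynomial.C c ∈ weightGE ℂ P.wt j) :
      p′ ∈ weightGE ℂ P.wt (j + 1) := by
    have := P.deriv_mem_weightGE h
    rwa [map_sub, deriv_C, sub_zero] at this
  induction n generalizing k with
  | zero =>
    cases k with
    | zero => simpa [gaugeLin] using P.rho_emb_sub_mem ⁅a, matUnit x⁆
    | succ k => exact mem_weightGE_of_nonpos (by push_cast; omega) _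
  | succ n ih =>
    rw [Function.iterate_succ_apply']
    cases k with
    | zero =>
      rw [coeff_lamD_zero, if_neg (Nat.succ_ne_zero n).symm, map_zero, sub_zero]
      exact weightGE_anti (hderiv (ih 0)) (by push_cast; omega)
    | succ k =>
      rw [coeff_lamD_succ, add_sub_right_comm]
      simp only [Nat.add_right_cancel_iff]
      exact add_mem (weightGE_anti (ih k) (by push_cast; omega))
        (weightGE_anti (hderiv (ih (k + 1))) (by push_cast; omega))

theorem coeff_gaugeDer_X_sub_pderiv_mem {y : {x : P.Box × P.Box // P.deg x ≤ 1 / 2}}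
    (hy : ¬ P.IsU y.1) {a : P.gl}
    (ha : ∀ z ∈ P.supportedOn P.IsOffU, (P.nilp * ⁅a, z⁆).trace = z y.1.1 y.1.2) (k : ℕ) (v) :
    (P.gaugeDer a (MvPolynomial.X v)).coeff k -
        MvPolynomial.pderiv (y, k) (MvPolynomial.X v : P.Vle) ∈
      weightGE ℂ P.wt (P.wt v - P.wt (y, k) + 1) := by
  obtain ⟨z, n⟩ := v
  have hmem := P.coeff_lamD_gaugeLin_sub_mem a z.1 n k
  have hwt : P.wt (y, k) = k + 2 := by rw [wt, if_neg hy]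
  rw [gaugeDer_X, hwt]
  by_cases hkn : k = n
  · subst hkn
    by_cases hz : P.IsU z.1
    · exact mem_weightGE_of_nonpos (by rw [wt, if_pos hz]; push_cast; omega) _
    · have hpderiv : MvPolynomial.pderiv (y, k) (MvPolynomial.X (z, k) : P.Vle) =
          MvPolynomial.C (P.nilp * ⁅a, matUnit z.1⁆).trace := by
        rw [ha _ (matUnit_mem_supportedOn ⟨z.2, hz⟩)]
        by_cases hzy : z = y
        · subst hzy
          rw [MvPolynomial.pderiv_X_self, matUnit_apply_self, map_one]
        · rw [MvPolynomial.pderiv_X_of_ne fun h => hzy (congrArg Prod.fst h),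
            matUnit_apply_of_ne fun h => hzy (Subtype.ext h), map_zero]
      rw [if_pos rfl] at hmem
      rw [hpderiv]
      exact weightGE_anti hmem (by rw [wt, if_neg hz]; push_cast; omega)
  · rw [if_neg hkn, map_zero, sub_zero] at hmem
    rw [MvPolynomial.pderiv_X_of_ne fun h => hkn (congrArg Prod.snd h).symm, sub_zero]
    exact weightGE_anti hmem (by simp only [wt]; split_ifs <;> push_cast <;> omega)

theorem eq_zero_of_mem_wAlgebra_of_kappa_eq_zero {x : P.Vle} (hx : x ∈ P.wAlgebra)
    (h : P.kappa x = 0) : x = 0 := by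
  by_contra hne
  obtain ⟨d, hd, hmin⟩ := Finset.exists_min_image x.support (fun d => Finsupp.weight P.wt d)
    (MvPolynomial.support_nonempty.2 hne)
  have hspan := P.sub_kappa_mem x
  rw [h, sub_zero, MvPolynomial.mem_ideal_span_X_image] at hspan
  obtain ⟨⟨y, k⟩, hy, hdy⟩ := hspan d hd
  obtain ⟨a, ha, hdual⟩ :=
    exists_mem_gGe_trace_nilp_mul_lie (Matrix.entryLinearMap ℂ ℂ y.1.1 y.1.2)
  let gaugeDerCoeff : Derivation ℂ P.Vle P.Vle := (Polynomial.lcoeff P.Vle k).compDer (P.gaugeDer a)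
  have hzero : gaugeDerCoeff x = 0 := by
    have hgauge := (P.map_rho_affineBracket_emb a x).symm.trans (hx a ha)
    exact congrArg (Polynomial.coeff · k) hgauge
  exact derivation_ne_zero_of_sub_pderiv_mem (w := P.wt) (E := gaugeDerCoeff) hd
    (mem_weightGE.2 fun d' hd' => Int.ofNat_le.2 (hmin d' hd')) hdy
    (P.coeff_gaugeDer_X_sub_pderiv_mem hy hdual k) hzero

end Pyramid

/-! ### The generators of the `W`-algebra -/

namespace Pyramid

open PsiDO

variable {r : ℕ} (P : Pyramid r)

/-- The `W`-algebra as a subalgebra of `𝒱(g_{≤ 1/2})`. -/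
def wSubalgebra : Subalgebra ℂ P.Vle where
  __ := ⨅ a ∈ P.gGe, (P.gaugeHom a).eqLocus (TrivSqZeroExt.inlHom P.Vle _)
  algebraMap_mem' c := by
    change _ ∈ ⨅ a ∈ P.gGe, (P.gaugeHom a).eqLocus (TrivSqZeroExt.inlHom P.Vle _)
    simp only [Subring.mem_iInf, RingHom.mem_eqLocus, gaugeHom_apply, Derivation.map_algebraMap,
      TrivSqZeroExt.inr_zero, add_zero, TrivSqZeroExt.inlHom_apply, implies_true]

variable {P}

theorem mem_wSubalgebra {x : P.Vle} : x ∈ P.wSubalgebra ↔ x ∈ P.wAlgebra := by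
  change x ∈ ⨅ a ∈ P.gGe, (P.gaugeHom a).eqLocus (TrivSqZeroExt.inlHom P.Vle _) ↔ _
  simp only [Subring.mem_iInf, RingHom.mem_eqLocus, mem_wAlgebra]

theorem der_mem_wAlgebra {x : P.Vle} (hx : x ∈ P.wAlgebra) (n : ℕ) : der n x ∈ P.wAlgebra :=
  P.mem_wAlgebra.2 fun a ha => by
    rw [(P.isDiffHom_gaugeHom a).map_der, isDiffHom_inlHom.map_der, P.mem_wAlgebra.1 hx a ha]

theorem eq_of_mem_wAlgebra_of_kappa_eq {x y : P.Vle} (hx : x ∈ P.wAlgebra) (hy : y ∈ P.wAlgebra)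
    (h : P.kappa x = P.kappa y) : x = y :=
  sub_eq_zero.1 <| P.eq_zero_of_mem_wAlgebra_of_kappa_eq_zero
    (mem_wSubalgebra.1 (sub_mem (mem_wSubalgebra.2 hx) (mem_wSubalgebra.2 hy)))
    (by rw [map_sub, h, sub_self])

theorem sliceHom_mem_wAlgebra {g : P.Box × P.Box → P.Vle}
    (hg : ∀ y, P.IsU y → g y ∈ P.wAlgebra) (x : P.Vle) : P.sliceHom g x ∈ P.wAlgebra := by
  rw [← mem_wSubalgebra]
  induction x using MvPolynomial.induction_on with
  | C c =>
    rw [sliceHom_C]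
    exact P.wSubalgebra.algebraMap_mem c
  | add p q hp hq => exact map_add (P.sliceHom g) p q ▸ add_mem hp hq
  | mul_X p y hp =>
    rw [map_mul]
    refine mul_mem hp ?_
    by_cases hy : P.IsU y.1
    · exact P.sliceHom_X_of_isU g hy y.2 ▸ mem_wSubalgebra.2 (der_mem_wAlgebra (hg _ hy) y.2)
    · exact P.sliceHom_X_of_not_isU g hy y.2 ▸ zero_mem _

theorem exists_mem_wAlgebra_kappa_eq {c : ∀ a b, Fin (min (P.part a) (P.part b)) → P.Vle}
    (hc : ∀ a b i, c a b i ∈ P.wAlgebra)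
    (hκ : ∀ a b i, P.kappa (c a b i) = P.embLe (matUnit (P.uPos a b i))) (x : P.Vle) :
    ∃ w ∈ P.wAlgebra, P.kappa w = P.kappa x := by
  have h : ∀ y, ∃ w, P.IsU y → w ∈ P.wAlgebra ∧ P.kappa w = P.embLe (matUnit y) := fun y => by
    by_cases hy : P.IsU y
    · obtain ⟨a, b, i, rfl⟩ := P.exists_uPos hy
      exact ⟨c a b i, fun _ => ⟨hc a b i, hκ a b i⟩⟩
    · exact ⟨0, fun h => absurd h hy⟩
  choose g hg using h
  exact ⟨P.sliceHom g x, sliceHom_mem_wAlgebra (fun y hy => (hg y hy).1) x,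
    P.kappa_sliceHom (fun y hy => (hg y hy).2) x⟩

variable (P)

theorem map_recT_one_eq {R : Type*} [CommRing R] [Differential R] {φ ψ : P.Vle →+* R}
    (hφ : IsDiffHom φ) (hψ : IsDiffHom ψ)
    (h : UnitriEquiv P.part (P.opT.map (mapHom φ hφ)) (P.opT.map (mapHom ψ hψ))) :
    (P.recT 1).map (mapHom φ hφ) = (P.recT 1).map (mapHom ψ hψ) :=
  (P.reduced_recT_one.map hφ).eq_of_unitriEquiv (P.reduced_recT_one.map hψ) <|
    (((P.unitriEquiv_opT_recT 1).map hφ).symm.trans h).trans ((P.unitriEquiv_opT_recT 1).map hψ)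

theorem map_recT_one_kappa :
    (P.recT 1).map (mapHom P.kappa.toRingHom P.isDiffHom_kappa) =
      P.opT.map (mapHom P.kappa.toRingHom P.isDiffHom_kappa) :=
  (P.reduced_recT_one.map P.isDiffHom_kappa).eq_of_unitriEquiv P.reduced_map_opT_kappa
    ((P.unitriEquiv_opT_recT 1).map P.isDiffHom_kappa).symm

/-- The coefficient of `(-∂)ⁱ` in the `(a, b)` entry of `T⁽¹⁾(∂) + (-∂)^p`. It will turn out to be
the generator `w_{ba;i}`. -/
def recCoeff (a b : Fin r) (i : ℕ) : P.Vle :=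
  (-1) ^ i * ((P.recT 1 - (topUnit P.Vle P.part).val) a b).coeff i

theorem recCoeff_mem_wAlgebra (a b : Fin r) (i : ℕ) : P.recCoeff a b i ∈ P.wAlgebra := by
  refine mem_wSubalgebra.1 (mul_mem (pow_mem (neg_mem (one_mem _)) i) (mem_wSubalgebra.2 ?_))
  refine P.mem_wAlgebra.2 fun c hc => ?_
  have h := P.map_recT_one_eq _ _ (P.unitriEquiv_opT_map_gaugeHom hc)
  have h' : (P.recT 1 - (topUnit P.Vle P.part).val).map
        (mapHom (P.gaugeHom c) (P.isDiffHom_gaugeHom c)) =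
      (P.recT 1 - (topUnit P.Vle P.part).val).map
        (mapHom (TrivSqZeroExt.inlHom P.Vle _) isDiffHom_inlHom) := by
    rw [Matrix.map_sub _ (map_sub _), Matrix.map_sub _ (map_sub _), h, map_topUnit, map_topUnit]
  exact congrArg (fun M => (M a b).coeff i) h'

theorem kappa_recCoeff (a b : Fin r) (i : Fin (min (P.part b) (P.part a))) :
    P.kappa (P.recCoeff a b i) = P.embLe (matUnit (P.uPos b a i)) := by
  have h := P.coeff_map_opT_kappa_sub a b i
  rw [← map_recT_one_kappa, ← map_topUnit P.isDiffHom_kappa, ← Matrix.map_sub _ (map_sub _),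
    Matrix.map_apply, coeff_mapHom] at h
  change P.kappa _ = _ at h
  rw [recCoeff, map_mul, h, map_pow, map_neg, map_one, ← mul_assoc, ← pow_add,
    Even.neg_one_pow ⟨_, rfl⟩, one_mul]

theorem exists_isLift (q : P.Vle) : ∃ x, P.IsLift q x := by
  obtain ⟨w, hw, hκ⟩ := exists_mem_wAlgebra_kappa_eq
    (fun a b i => P.recCoeff_mem_wAlgebra b a i) (fun a b i => P.kappa_recCoeff b a i) q
  exact ⟨w, hw, P.sub_mem_uPerpIdeal.2 hκ⟩

variable {P}

theorem IsLift.kappa_eq {q x : P.Vle} (h : P.IsLift q x) : P.kappa x = P.kappa q :=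
  P.sub_mem_uPerpIdeal.1 h.2

theorem IsLift.eq {q x y : P.Vle} (hx : P.IsLift q x) (hy : P.IsLift q y) : x = y :=
  eq_of_mem_wAlgebra_of_kappa_eq hx.1 hy.1 (hx.kappa_eq.trans hy.kappa_eq.symm)

theorem IsLift.wMap_eq {q x : P.Vle} (hx : P.IsLift q x) : P.wMap q = x := by
  have h : ∃ x, P.IsLift q x := ⟨x, hx⟩
  rw [wMap, dif_pos h]
  exact h.choose_spec.eq hx

variable (P)

theorem isLift_toGf {x : P.Vle} (hx : x ∈ P.wAlgebra) : P.IsLift (P.toGf x) x :=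
  ⟨hx, P.sub_mem_uPerpIdeal.2 (P.kappa_toGf x).symm⟩

theorem wGen_eq_recCoeff (a b : Fin r) (i : Fin (min (P.part b) (P.part a))) :
    P.wGen b a i = P.recCoeff a b i := by
  refine IsLift.wMap_eq ⟨P.recCoeff_mem_wAlgebra a b i, P.sub_mem_uPerpIdeal.2 ?_⟩
  rw [kappa_recCoeff, fElt_eq, P.kappa_embLe_fU (P.isU_uPos b a i)]

theorem val_topUnit_part : (topUnit P.Vle P.part).val = -P.negDPow := by
  rw [val_topUnit, negDPow, Matrix.diagonal_neg]

theorem recT_one_eq : P.recT 1 = -P.negDPow + P.genMatrix := by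
  rw [← val_topUnit_part, ← sub_eq_iff_eq_add']
  refine Matrix.ext fun a b => ?_
  have hdiff : ((P.recT 1 - (topUnit P.Vle P.part).val) a b).IsDiffOp :=
    sub_mem (S := Subring _) (P.admissible_recT 1).1 topUnit_mem_matrix_diffOps a b
  have hord : ((P.recT 1 - (topUnit P.Vle P.part).val) a b).OrdLE
      ((min (P.part b) (P.part a) : ℕ) - 1) := by
    rw [min_comm]
    exact P.reduced_recT_one a b
  rw [hdiff.eq_sum hord, genMatrix, Matrix.of_apply]
  exact Finset.sum_congr rfl fun i _ => by rw [wGen_eq_recCoeff, recCoeff]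

theorem recW_one_eq :
    P.recW 1 = (-P.negDPow + P.genMatrix).submatrix Subtype.val Subtype.val := by
  rw [recW, recT_one_eq, corner]

end Pyramid

end

end WGL

theorem mainTheorem3 {r : ℕ} (P : WGL.Pyramid r) :
    -- the projection modulo `⟨U^⊥⟩` is a bijection from the `W`-algebra onto `𝒱(g^f)`,
    -- so that `w` and the generators `w_{ab;i}` are well defined
    (∀ q ∈ P.vgf, ∃! x, P.IsLift q x) ∧
    (∀ x ∈ P.wAlgebra, ∃! q, q ∈ P.vgf ∧ P.IsLift q x) ∧
    -- `T(∂)` and all the steps of the recursion are well defined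
    WGL.QuasidetExists P.rhoA P.firstBox P.lastBox ∧
    (∀ k, 1 ≤ k → k ≤ P.numBlocks →
      (∀ a b, (P.recT k a b).IsDiffOp) ∧ IsUnit (P.recW k)) ∧
    -- the last term of the recursion
    P.recW 1 = (-P.negDPow + P.genMatrix).submatrix Subtype.val Subtype.val := by
  refine ⟨fun q _ => ?_, fun x hx => ?_, P.quasidetExists_rhoA_and_opT_eq.1, fun k _ _ => ?_,
    P.recW_one_eq⟩
  · obtain ⟨x, hx⟩ := P.exists_isLift q
    exact ⟨x, hx, fun y hy => hy.eq hx⟩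
  · exact ⟨P.toGf x, ⟨P.toGf_mem x, P.isLift_toGf hx⟩, fun q hq => P.eq_of_mem_vgf_of_kappa_eq hq.1
      (P.toGf_mem x) (hq.2.kappa_eq.symm.trans (P.isLift_toGf hx).kappa_eq)⟩
  · exact ⟨(P.admissible_recT k).1, ((P.admissible_recT k).corner k).1⟩
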